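/- **Setting.** Let $T$ be a locally compact Polish space. A *local transformation* of $T$ is a homeomorphism between open subsets of $T$; let $\operatorname{Loct}(T)$ be the set of all of them, with composites defined on the largest possible domains. A *pseudogroup* on $T$ is a set of local transformations that contains $\mathrm{id}_T$ and is closed under composition, inversion, restriction to open sets, and combination (unions that are homeomorphisms between open sets). The pseudogroup *generated* by a set of local transformations is the smallest one containing it. A *local pseudo\*group* is a set of local transformations closed under composition, inversion and restriction to open sets. Let $\mathcal H$ be a pseudogroup on $T$ such that: * $\mathcal H$ is *minimal*: all orbits $\mathcal H(x)=\{h(x)\mid h\in\mathcal H,\ x\in\operatorname{dom}h\}$ are dense; * $\mathcal H$ is *compactly generated*: there are a relatively compact open $U\subset T$ meeting all orbits and a finite set $E$ generating the pseudogroup $\mathcal H|_U=\{h\in\mathcal H\mid\operatorname{dom}h\cup\operatorname{im}h\subset U\}$ on $U$, such that each $h\in E$ is the restriction of some $\tilde h\in\mathcal H$ with $\overline{\operatorname{dom}h}\subset\operatorname{dom}\tilde h$. Let $S\subset\mathcal H$ be a local pseudo\*group that generates $\mathcal H$, the domains of whose elements cover $T$, and such that: * ($\mathcal H$ is equicontinuous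 with $S$) there are an open cover $\{T_i\}$ of $T$ and metrics $d_i$ on $T_i$ inducing its topology such that (a) there is a function $\delta:(0,\infty)\to(0,\infty)$ such that every $z\in T_i\cap T_j$, for any $i,j$, has an open neighborhood $V\subset T_i\cap T_j$ with $d_i(x,y)<\delta(\varepsilon)\Rightarrow d_j(x,y)<\varepsilon$ for all $x,y\in V$ and $\varepsilon>0$; and (b) for every $\varepsilon>0$ there is $\delta>0$ with $d_i(x,y)<\delta\Rightarrow d_j(h(x),h(y))<\varepsilon$ for all $h\in S$, all $i,j$, and all $x,y\in T_i\cap h^{-1}(T_j\cap\operatorname{im}h)$; * (the closure $\overline{\mathcal H}$ is strongly quasi-analytic with $\overline S$) let $\overline S$ be the set of local transformations $f$ that, with $O=\operatorname{dom}f$, lie in the closure of $\{s\in S\mid\operatorname{dom}s=O\}$ in $C(O,T)$ for the compact-open topology, and let $\overline{\mathcal H}$ be the set of local transformations that restrict to an element of $\overline S$ on a neighborhood of each point of their domain; then every $f\in\overline S$ that is the identity on some non-empty open subset of its domain is the identity on its domain. **The pseudogroup $\widehat{\mathcal H}_0$.** Endow $\overline S$ with the compact-open topology, which has as subbasis the sets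 $\{h\in\overline S\mid K\subset\operatorname{dom}h,\ h(K)\subset O\}$ with $K\subset T$ compact and $O\subset T$ open. Let $\widehat T$ be the set of germs $\gamma(f,x)$ of maps $f\in\overline{\mathcal H}$ at points $x\in\operatorname{dom}f$, endowed with the quotient topology given by the germ map $\{(f,x)\in\overline S\times T\mid x\in\operatorname{dom}f\}\to\widehat T$. Fix $x_0\in T$, let $\widehat T_0=\{\gamma(g,x)\in\widehat T\mid g(x)=x_0\}$ with the subspace topology, and let $\hat\pi_0:\widehat T_0\to T$, $\gamma(g,x)\mapsto x$. For $h\in S$ let $\hat h:\hat\pi_0^{-1}(\operatorname{dom}h)\to\hat\pi_0^{-1}(\operatorname{im}h)$, $\hat h(\gamma(g,x))=\gamma(gh^{-1},h(x))$. Let $\widehat{\mathcal H}_0$ be the pseudogroup on $\widehat T_0$ generated by the local transformations of the form $\hat h$, $h\in S$. **Local groups.** A *local group* is a topological space $G$ with an element $e$, a product defined on a subset of $G\times G$ and an inversion defined on a subset of $G$, such that $\{e\}$ is closed and there is an open neighborhood $O$ of $e$ such that products of two elements of $O$ and inverses of elements of $O$ are defined, both operations are continuous there, $a^{-1}\in O$,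 $ae=ea=a$ and $aa^{-1}=a^{-1}a=e$ for $a\in O$, and $(ab)c=a(bc)$ whenever $a,b,c,ab,bc\in O$. A subset $\Gamma\subset G$ containing $e$ is a *sub-local group* if it is a local group with the induced operations and topology; it is *finitely generated* if there is a finite $F\subset G$ such that $\Gamma$ is the set of all elements $s_1(s_2(\cdots(s_ne)))$, $n\ge0$, with each $s_i$ in $F$ or the inverse of an element of $F$, for which all these products are defined. **Statement.** There are a locally compact Polish local group $G$ and a dense finitely generated sub-local group $\Gamma\subset G$ such that $\widehat{\mathcal H}_0$ is equivalent to the pseudogroup on $G$ generated by the local left translations $L_\gamma:x\mapsto\gamma x$, $\gamma\in\Gamma$. Here $G$ can be chosen so that left multiplication is a local action of $G$ on itself by local transformations: the domain of the product is open and contains $\{e\}\times G$ and $G\times\{e\}$, the product is continuous on it, inversion is defined and continuous on $G$, the unit and inverse laws hold on all of $G$, $(ab)c=a(bc)$ whenever both sides and $bc$, $ab$ are defined, and $a^{-1}(ab)$ is defined whenever $ab$ is. Here an *equivalence* between pseudogroups $\mathcal G$ on $X$ and $\mathcal G'$ on $X'$ is a family $\Phi$ of homeomorphisms from open sets of $X$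 to open sets of $X'$ such that $\Phi$ is a morphism $\mathcal G\to\mathcal G'$ and $\Phi^{-1}=\{\varphi^{-1}\mid\varphi\in\Phi\}$ is a morphism $\mathcal G'\to\mathcal G$; a *morphism* $\mathcal G\to\mathcal G'$ is a maximal family $\Phi$ of such homeomorphisms such that $h'\varphi h\in\Phi$ for $\varphi\in\Phi$, $h\in\mathcal G$, $h'\in\mathcal G'$, the domains of maps in $\Phi$ cover $X$, and $\varphi'\varphi^{-1}\in\mathcal G'$ for $\varphi,\varphi'\in\Phi$. -/

import Mathlib

open Set Topology TopologicalSpace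

universe u

noncomputable section

namespace Molino

/-! ### Local transformations, pseudogroups and pseudo*groups

A local transformation of `T` is an `OpenPartialHomeomorph T T`; its values outside of its source
are irrelevant, and all families below are insensitive to them. The composite `h'h` is
`h.trans h'`. -/

/-- Local transformations of `T`. -/
abbrev Loct (T : Type u) [TopologicalSpace T] : Type u := OpenPartialHomeomorph T T

section Pseudogroups

variable {T : Type u} [TopologicalSpace T]

/-- `P` is a pseudogroup on the open subspace `U` of `T` (its elements being regarded as local
transformations of `T`). For `U = ⊤` this says that `P` is the family of members of a
`StructureGroupoid` that is closed under restriction. -/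
structure IsPseudogroupOn (U : Opens T) (P : Set (Loct T)) : Prop where
  subset : ∀ h ∈ P, h.source ⊆ U ∧ h.target ⊆ U
  id_mem : OpenPartialHomeomorph.ofSet (U : Set T) U.isOpen ∈ P
  comp_mem : ∀ h ∈ P, ∀ h' ∈ P, h.trans h' ∈ P
  symm_mem : ∀ h ∈ P, h.symm ∈ P
  restr_mem : ∀ h ∈ P, ∀ (V : Set T) (hV : IsOpen V), h.restrOpen V hV ∈ P
  combination_mem : ∀ A ⊆ P, ∀ h : Loct T, h.source = ⋃ a ∈ A, a.source →
    (∀ a ∈ A, EqOn h a a.source) → h ∈ P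

/-- Pseudogroups on the whole space. -/
def IsPseudogroup (H : Set (Loct T)) : Prop := IsPseudogroupOn ⊤ H

/-- The smallest pseudogroup on the open subspace `U` that contains `E`. -/
def generatedOn (U : Opens T) (E : Set (Loct T)) : Set (Loct T) :=
  ⋂₀ {P | IsPseudogroupOn U P ∧ E ⊆ P}

/-- The pseudogroup on `T` generated by `E`. -/
def generated (E : Set (Loct T)) : Set (Loct T) := generatedOn ⊤ E

/-- The restriction `H|_U`. -/
def restriction (H : Set (Loct T)) (U : Opens T) : Set (Loct T) :=
  {h ∈ H | h.source ∪ h.target ⊆ U}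

/-- The orbit `H(x)`. -/
def orbit (H : Set (Loct T)) (x : T) : Set T :=
  {y | ∃ h ∈ H, x ∈ h.source ∧ h x = y}

/-- `H` is minimal: all orbits are dense. -/
def IsMinimal (H : Set (Loct T)) : Prop := ∀ x, Dense (orbit H x)

/-- Compact generation. -/
def IsCompactlyGenerated (H : Set (Loct T)) : Prop :=
  ∃ U : Opens T, IsCompact (closure (U : Set T)) ∧ (∀ x, (orbit H x ∩ U).Nonempty) ∧
    ∃ E : Set (Loct T), E.Finite ∧ E ⊆ restriction H U ∧ generatedOn U E = restriction H U ∧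
      ∀ h ∈ E, ∃ k ∈ H, closure h.source ⊆ k.source ∧ EqOn h k h.source

/-- `S` is a pseudo*group that is local, i.e. equal to its localization (closed under restriction
to open subsets). The field `congr_mem` says that membership of a local transformation in `S`
depends only on its graph. -/
structure IsLocalPseudoStarGroup (S : Set (Loct T)) : Prop where
  comp_mem : ∀ h ∈ S, ∀ h' ∈ S, h.trans h' ∈ S
  symm_mem : ∀ h ∈ S, h.symm ∈ S
  restr_mem : ∀ h ∈ S, ∀ (V : Set T) (hV : IsOpen V), h.restrOpen V hV ∈ S
  congr_mem : ∀ h ∈ S, ∀ h' : Loct T, h' ≈ h → h' ∈ S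

/-- The condition of strong quasi-analyticity for the family `S`: an element of `S` that is the
identity on some non-empty open subset of its domain is the identity on its domain. -/
def StronglyQuasiAnalyticWith (S : Set (Loct T)) : Prop :=
  ∀ f ∈ S, ∀ O : Set T, IsOpen O → O.Nonempty → O ⊆ f.source → EqOn f id O →
    EqOn f id f.source

/-! ### Equivalences -/

/-- The conditions, apart from maximality, on a morphism `H → H'`. -/
structure IsPreMorphism {T' : Type u} [TopologicalSpace T'] (H : Set (Loct T))
    (H' : Set (Loct T')) (Φ : Set (OpenPartialHomeomorph T T')) : Prop where
  comp_mem : ∀ φ ∈ Φ, ∀ h ∈ H, ∀ h' ∈ H', (h.trans φ).trans h' ∈ Φ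
  cover : ∀ x, ∃ φ ∈ Φ, x ∈ φ.source
  mem_target : ∀ φ ∈ Φ, ∀ φ' ∈ Φ, φ.symm.trans φ' ∈ H'

/-- (Étalé) morphisms of pseudogroups. -/
def IsMorphism {T' : Type u} [TopologicalSpace T'] (H : Set (Loct T)) (H' : Set (Loct T'))
    (Φ : Set (OpenPartialHomeomorph T T')) : Prop :=
  Maximal (IsPreMorphism H H') Φ

/-- `H` and `H'` are equivalent: there is a morphism `Φ : H → H'` such that `Φ⁻¹` is a
morphism `H' → H`. -/
def AreEquivalent {T' : Type u} [TopologicalSpace T'] (H : Set (Loct T))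
    (H' : Set (Loct T')) : Prop :=
  ∃ Φ : Set (OpenPartialHomeomorph T T'), IsMorphism H H' Φ ∧
    IsMorphism H' H (OpenPartialHomeomorph.symm '' Φ)

/-! ### Equicontinuity -/

/-- A cover of the topological space `T` by quasi-locally equal metric spaces `(dom i, metric i)`
that induces the topology of `T` (equivalently, the open balls of all the `(dom i, metric i)` form
a basis of the topology of `T`). -/
structure QuasiLocalMetricCover (T : Type u) [TopologicalSpace T] where
  ι : Type u
  dom : ι → Set T
  metric : ∀ i, MetricSpace (dom i)
  cover : ⋃ i, dom i = univ
  isOpen_dom : ∀ i, IsOpen (dom i)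
  topology_eq : ∀ i, (metric i).toPseudoMetricSpace.toUniformSpace.toTopologicalSpace =
    (instTopologicalSpaceSubtype : TopologicalSpace (dom i))
  quasi_locally_equal : ∃ δ : ℝ → ℝ, (∀ ε > 0, 0 < δ ε) ∧
    ∀ i j, ∀ z ∈ dom i ∩ dom j, ∃ V : Set T, IsOpen V ∧ z ∈ V ∧ V ⊆ dom i ∩ dom j ∧
      ∀ ε > 0, ∀ x ∈ V, ∀ y ∈ V, ∀ (hxi : x ∈ dom i) (hyi : y ∈ dom i)
        (hxj : x ∈ dom j) (hyj : y ∈ dom j),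
        (metric i).dist ⟨x, hxi⟩ ⟨y, hyi⟩ < δ ε → (metric j).dist ⟨x, hxj⟩ ⟨y, hyj⟩ < ε

/-- The condition of equicontinuity for the family `S` and the cover `Q`. -/
def EquicontinuousWith (Q : QuasiLocalMetricCover T) (S : Set (Loct T)) : Prop :=
  ∀ ε > 0, ∃ δ > 0, ∀ h ∈ S, ∀ i j, ∀ x ∈ h.source, ∀ y ∈ h.source,
    ∀ (hx : x ∈ Q.dom i) (hy : y ∈ Q.dom i) (hhx : h x ∈ Q.dom j) (hhy : h y ∈ Q.dom j),
      (Q.metric i).dist ⟨x, hx⟩ ⟨y, hy⟩ < δ → (Q.metric j).dist ⟨h x, hhx⟩ ⟨h y, hhy⟩ < ε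

/-! ### The closure of a pseudogroup -/

/-- A local transformation as a continuous map on its domain. -/
def toMap (f : Loct T) : C(f.source, T) :=
  ⟨f.source.domRestrict f, f.continuousOn.domRestrict⟩

/-- `S̄`: the local transformations `f`, with domain `O` say, that belong to the closure of
`C(O, T) ∩ S` in `C(O, T)` with the compact-open topology. -/
def starClosure (S : Set (Loct T)) : Set (Loct T) :=
  {f | toMap f ∈ closure {g : C(f.source, T) |
    ∃ s ∈ S, s.source = f.source ∧ ∀ x : f.source, g x = s x}}

/-- `H̄`, where `H` is the pseudogroup generated by `S`: the local transformations that
belong to `S̄` around every point of their domains. -/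
def pseudogroupClosure (S : Set (Loct T)) : Set (Loct T) :=
  {h | ∀ x ∈ h.source, ∃ (O : Set T) (hO : IsOpen O), x ∈ O ∧ O ⊆ h.source ∧
    h.restrOpen O hO ∈ starClosure S}

/-! ### Germs and the space `T̂₀` -/

variable (T) in
/-- The compact-open topology on `Loct T`, generated by the sets
`N(K, O) = {h | K ⊆ dom h, h(K) ⊆ O}`. -/
@[reducible]
def compactOpen : TopologicalSpace (Loct T) :=
  generateFrom {N | ∃ K O : Set T, IsCompact K ∧ IsOpen O ∧
    N = {h : Loct T | K ⊆ h.source ∧ h '' K ⊆ O}}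

variable (T) in
/-- Pairs `(f, x)` with `x ∈ dom f`. -/
abbrev Pointed : Type u := {p : Loct T × T // p.2 ∈ p.1.source}

variable (T) in
/-- Equality of germs. -/
def germSetoid : Setoid (Pointed T) where
  r p q := p.1.2 = q.1.2 ∧ p.1.1 =ᶠ[𝓝 p.1.2] q.1.1
  iseqv :=
    { refl := fun _ => ⟨rfl, Filter.EventuallyEq.rfl⟩
      symm := fun {_ _} h => ⟨h.1.symm, h.1 ▸ h.2.symm⟩
      trans := fun {_ _ _} h k => ⟨h.1.trans k.1, h.2.trans (h.1.symm ▸ k.2)⟩ }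

variable (T) in
/-- Germs of local transformations of `T`. -/
def LoctGerm : Type u := Quotient (germSetoid T)

/-- The germ of `f` at `x ∈ dom f`. -/
def germ (f : Loct T) (x : T) (hx : x ∈ f.source) : LoctGerm T :=
  Quotient.mk (germSetoid T) ⟨(f, x), hx⟩

/-- The source `x` of `germ f x`. -/
def LoctGerm.src : LoctGerm T → T :=
  Quotient.lift (fun p : Pointed T => p.1.2) fun _ _ h => h.1

/-- The target `f x` of `germ f x`. -/
def LoctGerm.tgt : LoctGerm T → T :=
  Quotient.lift (fun p : Pointed T => p.1.1 p.1.2)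
    fun _ _ h => h.2.eq_of_nhds.trans (congrArg _ h.1)

/-- `T̂`: the set of germs of the closure `H̄`. -/
def HatT (S : Set (Loct T)) : Type u :=
  {γ : LoctGerm T // ∃ f ∈ pseudogroupClosure S, ∃ (x : T) (hx : x ∈ f.source), γ = germ f x hx}

theorem starClosure_subset (S : Set (Loct T)) : starClosure S ⊆ pseudogroupClosure S := by
  intro f hf x hx
  refine ⟨f.source, f.open_source, hx, subset_rfl, ?_⟩
  have : f.restrOpen f.source f.open_source = f := by
    refine OpenPartialHomeomorph.ext _ _ (fun _ => rfl) (fun _ => rfl) ?_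
    simp
  rw [this]
  exact hf

/-- `S̄ * T = {(f, x) ∈ S̄ × T | x ∈ dom f}`. -/
def StarProd (S : Set (Loct T)) : Type u :=
  {p : Loct T × T // p.1 ∈ starClosure S ∧ p.2 ∈ p.1.source}

/-- `S̄ * T` as a subspace of `S̄ × T`, where `S̄` carries the compact-open topology. -/
instance (S : Set (Loct T)) : TopologicalSpace (StarProd S) :=
  induced Subtype.val (@instTopologicalSpaceProd (Loct T) T (compactOpen T) _)

/-- The germ map `S̄ * T → T̂`. -/
def germMap (S : Set (Loct T)) (p : StarProd S) : HatT S :=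
  ⟨germ p.1.1 p.1.2 p.2.2, p.1.1, starClosure_subset S p.2.1, p.1.2, p.2.2, rfl⟩

/-- `T̂` has the quotient topology with respect to the germ map. -/
instance (S : Set (Loct T)) : TopologicalSpace (HatT S) :=
  coinduced (germMap S) inferInstance

/-- `T̂₀ = {germ(g, x) ∈ T̂ | g(x) = x₀}`, as a subspace of `T̂`. -/
abbrev HatT₀ (S : Set (Loct T)) (x₀ : T) : Type u := {γ : HatT S // γ.1.tgt = x₀}

/-- The projection `π̂₀ : T̂₀ → T`, `germ(g, x) ↦ x`. -/
def hatProj (S : Set (Loct T)) (x₀ : T) (γ : HatT₀ S x₀) : T := γ.1.1.src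

/-- `φ` is the map `ĥ : π̂₀⁻¹(dom h) → π̂₀⁻¹(im h)`,
`ĥ(germ(g, x)) = germ(g h⁻¹, h(x))`. -/
def IsHat (S : Set (Loct T)) (x₀ : T) (h : Loct T) (φ : Loct (HatT₀ S x₀)) : Prop :=
  φ.source = hatProj S x₀ ⁻¹' h.source ∧ φ.target = hatProj S x₀ ⁻¹' h.target ∧
  ∀ γ : HatT₀ S x₀, ∀ (g : Loct T) (x : T) (hg : x ∈ g.source) (hh : x ∈ h.source),
    γ.1.1 = germ g x hg →
      (φ γ).1.1 = germ (h.symm.trans g) (h x) (by simp [hh, hg])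

/-- `Ŝ₀ = {ĥ | h ∈ S}`. -/
def hatS₀ (S : Set (Loct T)) (x₀ : T) : Set (Loct (HatT₀ S x₀)) :=
  {φ | ∃ h ∈ S, IsHat S x₀ h φ}

/-- `Ĥ₀`: the pseudogroup on `T̂₀` generated by `Ŝ₀`. -/
def hatH₀ (S : Set (Loct T)) (x₀ : T) : Set (Loct (HatT₀ S x₀)) := generated (hatS₀ S x₀)

end Pseudogroups

/-! ### Local groups -/

/-- An identity element and partially defined product and inversion. The values of `mul` and
`inv` outside of `mulDom` and `invDom` are irrelevant. -/
structure LocalGroupOps (G : Type u) where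
  e : G
  mulDom : Set (G × G)
  mul : G → G → G
  invDom : Set G
  inv : G → G

/-- The neighborhoods `O` of the identity that occur in the definition of a local group. -/
structure LocalGroupOps.IsPsi {G : Type u} [TopologicalSpace G] (L : LocalGroupOps G)
    (O : Set G) : Prop where
  isOpen : IsOpen O
  e_mem : L.e ∈ O
  prod_subset : O ×ˢ O ⊆ L.mulDom
  subset_invDom : O ⊆ L.invDom
  assoc : ∀ a ∈ O, ∀ b ∈ O, ∀ c ∈ O, L.mul a b ∈ O → L.mul b c ∈ O →
    L.mul (L.mul a b) c = L.mul a (L.mul b c)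
  inv_mem : ∀ a ∈ O, L.inv a ∈ O
  mul_e : ∀ a ∈ O, L.mul a L.e = a
  e_mul : ∀ a ∈ O, L.mul L.e a = a
  inv_mul : ∀ a ∈ O, L.mul (L.inv a) a = L.e
  mul_inv : ∀ a ∈ O, L.mul a (L.inv a) = L.e
  continuousOn_mul : ContinuousOn (fun p : G × G => L.mul p.1 p.2) (O ×ˢ O)
  continuousOn_inv : ContinuousOn L.inv O

/-- Local groups. -/
structure LocalGroupOps.IsLocalGroup {G : Type u} [TopologicalSpace G]
    (L : LocalGroupOps G) : Prop where
  exists_psi : ∃ O, L.IsPsi O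
  isClosed_e : IsClosed {L.e}

open Classical in
/-- The operations induced on a subset that contains the identity element. -/
def LocalGroupOps.induced {G : Type u} (L : LocalGroupOps G) (Γ : Set G) (he : L.e ∈ Γ) :
    LocalGroupOps Γ where
  e := ⟨L.e, he⟩
  mulDom := {p | ((p.1 : G), (p.2 : G)) ∈ L.mulDom ∧ L.mul p.1 p.2 ∈ Γ}
  mul a b := if h : L.mul a b ∈ Γ then ⟨L.mul a b, h⟩ else ⟨L.e, he⟩
  invDom := {a | (a : G) ∈ L.invDom ∧ L.inv a ∈ Γ}
  inv a := if h : L.inv a ∈ Γ then ⟨L.inv a, h⟩ else ⟨L.e, he⟩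

/-- `Γ` is a sub-local group: it is a local group with the induced operations and topology. -/
def LocalGroupOps.IsSubLocalGroup {G : Type u} [TopologicalSpace G] (L : LocalGroupOps G)
    (Γ : Set G) : Prop :=
  ∃ he : L.e ∈ Γ, (L.induced Γ he).IsLocalGroup

/-- The elements of `G` that can be written as `s₁(s₂(⋯(sₙ e)))` with each `sᵢ`, or its inverse,
in `F`, and with all the products that occur being defined. -/
inductive LocalGroupOps.IsWord {G : Type u} (L : LocalGroupOps G) (F : Set G) : G → Prop
  | one : L.IsWord F L.e
  | mul (s a : G) : s ∈ F → (s, a) ∈ L.mulDom → L.IsWord F a → L.IsWord F (L.mul s a)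
  | inv_mul (s a : G) : s ∈ F → s ∈ L.invDom → (L.inv s, a) ∈ L.mulDom → L.IsWord F a →
      L.IsWord F (L.mul (L.inv s) a)

/-- `Γ` is generated by some finite set. -/
def LocalGroupOps.IsFinitelyGenerated {G : Type u} (L : LocalGroupOps G) (Γ : Set G) : Prop :=
  ∃ F : Set G, F.Finite ∧ Γ = {a | L.IsWord F a}

/-- The laws of a local group hold wherever they make sense, not only around the identity element.
In particular, the product is a local action of `G` on itself (it is continuous and defined on an
open neighborhood of `{e} × G`, `e x = x`, and `a (b x) = (a b) x` if both sides are defined), and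
every local left translation `L_a : x ↦ a x`, with domain `{x | (a, x) ∈ mulDom}`, is a local
transformation of `G` whose inverse is the local left translation by the inverse of `a`. -/
structure LocalGroupOps.ActsByLeftTranslations {G : Type u} [TopologicalSpace G]
    (L : LocalGroupOps G) : Prop where
  isOpen_mulDom : IsOpen L.mulDom
  continuousOn_mul : ContinuousOn (fun p : G × G => L.mul p.1 p.2) L.mulDom
  e_mul : ∀ a, (L.e, a) ∈ L.mulDom ∧ L.mul L.e a = a
  mul_e : ∀ a, (a, L.e) ∈ L.mulDom ∧ L.mul a L.e = a
  assoc : ∀ a b c, (a, b) ∈ L.mulDom → (L.mul a b, c) ∈ L.mulDom → (b, c) ∈ L.mulDom →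
    (a, L.mul b c) ∈ L.mulDom → L.mul (L.mul a b) c = L.mul a (L.mul b c)
  mem_invDom : ∀ a, a ∈ L.invDom
  continuous_inv : Continuous L.inv
  inv_mul : ∀ a, (L.inv a, a) ∈ L.mulDom ∧ L.mul (L.inv a) a = L.e
  mul_inv : ∀ a, (a, L.inv a) ∈ L.mulDom ∧ L.mul a (L.inv a) = L.e
  inv_mul_mem : ∀ a b, (a, b) ∈ L.mulDom → (L.inv a, L.mul a b) ∈ L.mulDom

/-- The pseudogroup on `G` generated by the local left translations `L_γ`, `γ ∈ Γ` (restricted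
to open subsets of their domains). -/
def LocalGroupOps.translationPseudogroup {G : Type u} [TopologicalSpace G] (L : LocalGroupOps G)
    (Γ : Set G) : Set (Loct G) :=
  generated {h | ∃ γ ∈ Γ, ∀ x ∈ h.source, (γ, x) ∈ L.mulDom ∧ h x = L.mul γ x}

end Molino

end

namespace Molino
open Filter

/-! ### Germs of local homeomorphisms -/

section Germs

variable {X Y Z : Type*} [TopologicalSpace X] [TopologicalSpace Y] [TopologicalSpace Z]

/-! The local group is a neighborhood of the unit in the space of limits of elements of `S` near
`x₀`, with composition as product. An element `a` corresponds to the point γ(a⁻¹, a x₀) of T̂₀. For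
`s` in `S` the map ŝ sends it to γ(a⁻¹s⁻¹, s a x₀) = γ((sa)⁻¹, sa x₀), so ŝ is left translation by
`s` (`IsRigidModel.toHat_pre_iff`). By minimality the image of the group, an open subset of T̂₀,
meets all orbits of Ĥ₀, and restricting a pseudogroup to such a subset does not change its
equivalence class (`areEquivalent_of_openEmbedding`).

For this to be a group of maps, the germs of `S` near `x₀` need a common domain. Compact generation
makes every such germ a composite of steps from a finite family
(`exists_generatesGerms_of_isCompactlyGenerated`). There is a uniform amount of room around the
compact sets on which the steps are used, and equicontinuity, applied to whole composites, keeps the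
image of a fixed small ball within this room whatever the number of steps. So the germs of `S`
between points of a ball of radius ρ extend to elements of `S` on this ball
(`GeneratesGerms.exists_extension`).

Equicontinuity then gives a compact space of pointwise limits, on which evaluation and composition
are continuous. Strong quasi-analyticity of the closure makes a limit determined on a smaller ball
by any of its germs (`IsLocalModel.eqOn_of_eventuallyEq`). Hence a product or inverse is determined
by its germ, and the group laws are identities between germs
(`IsRigidModel.actsByLeftTranslations`). The elements coming from `S` form the dense part Γ.
Comparing the compact-open topology on representatives with pointwise convergence of limits shows
that the group is open in T̂₀ (`IsRigidModel.embedding`).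

Finite generation uses compact generation again, on a much smaller ball. A finite set `F` of
elements contains all steps there, together with elements that move nearby points into the small
ball. The group is cut out by an open symmetric condition on (a x₀, a⁻¹ x₀) for which `F` lies in
the group and every element can be moved by `F` into the small ball. Chains staying in the small
ball are then words in `F` (`IsFrame.gamma_eq`), and they also realize every germ of `S` acting on
the group as a product of translations (`IsFrame.mem_translations_iff`). -/

theorem eventuallyEq_symm {e e' : OpenPartialHomeomorph X Y} {x : X} (hx : x ∈ e.source)
    (hx' : x ∈ e'.source) (h : e =ᶠ[𝓝 x] e') : e.symm =ᶠ[𝓝 (e x)] e'.symm := by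
  filter_upwards [(e.tendsto_symm hx).eventually (h.and (e'.open_source.mem_nhds hx')),
    e.open_target.mem_nhds (e.map_source hx)] with y h1 hy
  have h2 : e' (e.symm y) = y := h1.1.symm.trans (e.right_inv hy)
  calc e.symm y = e'.symm (e' (e.symm y)) := (e'.left_inv h1.2).symm
    _ = e'.symm y := by rw [h2]

theorem eventuallyEq_trans {e e' : OpenPartialHomeomorph X Y} {f f' : OpenPartialHomeomorph Y Z}
    {x : X} (hx : x ∈ e.source) (h : e =ᶠ[𝓝 x] e') (k : f =ᶠ[𝓝 (e x)] f') :
    e.trans f =ᶠ[𝓝 x] e'.trans f' := by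
  filter_upwards [h, (e.continuousAt hx).eventually k] with y h1 h2
  simp only [OpenPartialHomeomorph.trans_apply]
  rw [← h1, h2]

theorem mem_trans_source {e : OpenPartialHomeomorph X Y} {f : OpenPartialHomeomorph Y Z} {x : X}
    (hx : x ∈ e.source) (hex : e x ∈ f.source) : x ∈ (e.trans f).source := ⟨hx, hex⟩

theorem symm_trans_self_eventuallyEq (e : OpenPartialHomeomorph X Y) {x : X} (hx : x ∈ e.source) :
    ⇑(e.trans e.symm) =ᶠ[𝓝 x] id := by
  filter_upwards [e.open_source.mem_nhds hx] with y hy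
  simp [e.left_inv hy]

theorem eventuallyEq_of_eqOn {Y : Type*} {f g : X → Y} {O : Set X} (hO : IsOpen O) {x : X} (hx : x ∈ O)
    (h : EqOn f g O) : f =ᶠ[𝓝 x] g :=
  mem_of_superset (hO.mem_nhds hx) h

end Germs

/-! ### Pseudogroups described by their germs, and equivalence with open restrictions -/

section Pseudogroups

variable {X : Type u} [TopologicalSpace X]

/-- The closure properties of a property of germs that make the local transformations with this
property at all points of their domains a pseudogroup. -/
structure IsGermRel (U : Opens X) (R : Loct X → X → Prop) : Prop where
  congr : ∀ h h' : Loct X, ∀ x ∈ h.source, x ∈ h'.source → h =ᶠ[𝓝 x] h' → R h x → R h' x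
  id : ∀ x ∈ U, R (OpenPartialHomeomorph.refl X) x
  comp : ∀ h h' : Loct X, ∀ x ∈ h.source, h x ∈ h'.source → R h x → R h' (h x) →
    R (h.trans h') x
  symm : ∀ h : Loct X, ∀ x ∈ h.source, R h x → R h.symm (h x)

/-- Used to bound a generated pseudogroup from above: a property of germs that holds for the
generators passes to everything generated by them. -/
theorem IsGermRel.isPseudogroupOn {U : Opens X} {R : Loct X → X → Prop} (hR : IsGermRel U R) :
    IsPseudogroupOn U {h | (h.source ⊆ U ∧ h.target ⊆ U) ∧ ∀ x ∈ h.source, R h x} where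
  subset h hh := hh.1
  id_mem := by
    refine ⟨⟨by simp, by simp⟩, fun x hx => ?_⟩
    exact hR.congr (OpenPartialHomeomorph.refl X) _ x (mem_univ x) hx EventuallyEq.rfl
      (hR.id x (by simpa using hx))
  comp_mem := by
    intro h hh h' hh'
    refine ⟨⟨fun x hx => hh.1.1 hx.1, fun x hx => hh'.1.2 hx.1⟩, fun x hx => ?_⟩
    exact hR.comp h h' x hx.1 hx.2 (hh.2 x hx.1) (hh'.2 _ hx.2)
  symm_mem := by
    intro h hh
    refine ⟨⟨hh.1.2, hh.1.1⟩, fun y hy => ?_⟩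
    have := hR.symm h _ (h.map_target hy) (hh.2 _ (h.map_target hy))
    rwa [h.right_inv hy] at this
  restr_mem := by
    intro h hh V hV
    refine ⟨⟨fun x hx => hh.1.1 hx.1, fun y hy => hh.1.2 hy.1⟩, fun x hx => ?_⟩
    exact hR.congr h _ x hx.1 hx EventuallyEq.rfl (hh.2 x hx.1)
  combination_mem := by
    intro A hA h hs he
    have key : ∀ x ∈ h.source, ∃ a ∈ A, x ∈ a.source := by
      intro x hx
      rw [hs] at hx
      simpa using hx
    refine ⟨⟨fun x hx => ?_, fun y hy => ?_⟩, fun x hx => ?_⟩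
    · obtain ⟨a, ha, hxa⟩ := key x hx
      exact (hA ha).1.1 hxa
    · obtain ⟨a, ha, hxa⟩ := key _ (h.map_target hy)
      have := he a ha hxa
      rw [h.right_inv hy] at this
      rw [this]
      exact (hA ha).1.2 (a.map_source hxa)
    · obtain ⟨a, ha, hxa⟩ := key x hx
      exact hR.congr a h x hxa hx (eventuallyEq_of_eqOn a.open_source hxa (he a ha)).symm
        ((hA ha).2 x hxa)

theorem isPseudogroupOn_generatedOn {U : Opens X} {E : Set (Loct X)}
    (hE : ∀ h ∈ E, h.source ⊆ U ∧ h.target ⊆ U) : IsPseudogroupOn U (generatedOn U E) where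
  subset h hh := by
    -- All local transformations of `U` form a pseudogroup containing `E`, so the intersection that
    -- defines `generatedOn` is not over an empty family.
    refine (hh {h | h.source ⊆ U ∧ h.target ⊆ U} ⟨?_, hE⟩)
    have := (IsGermRel.isPseudogroupOn (U := U) (R := fun _ _ => True)
      ⟨by simp, by simp, by simp, by simp⟩)
    simpa using this
  id_mem P hP := hP.1.id_mem
  comp_mem h hh h' hh' P hP := hP.1.comp_mem h (hh P hP) h' (hh' P hP)
  symm_mem h hh P hP := hP.1.symm_mem h (hh P hP)
  restr_mem h hh V hV P hP := hP.1.restr_mem h (hh P hP) V hV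
  combination_mem A hA h hs he P hP := hP.1.combination_mem A (fun _ ha => hA ha P hP) h hs he

theorem subset_generatedOn (U : Opens X) (E : Set (Loct X)) : E ⊆ generatedOn U E :=
  fun _ hh _ hP => hP.2 hh

theorem isPseudogroup_generated (E : Set (Loct X)) : IsPseudogroup (generated E) :=
  isPseudogroupOn_generatedOn (by simp)

/-- Membership in a pseudogroup is a local property. -/
theorem IsPseudogroup.mem_of_locally {P : Set (Loct X)} (hP : IsPseudogroup P) {h : Loct X}
    (hh : ∀ x ∈ h.source, ∃ p ∈ P, x ∈ p.source ∧ h =ᶠ[𝓝 x] p) : h ∈ P := by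
  refine hP.combination_mem {a | a ∈ P ∧ a.source ⊆ h.source ∧ EqOn h a a.source}
    (fun a ha => ha.1) h ?_ (fun a ha => ha.2.2)
  apply Subset.antisymm
  · intro x hx
    obtain ⟨p, hp, hxp, hpe⟩ := hh x hx
    obtain ⟨V, hV, hVo, hxV⟩ := mem_nhds_iff.1 (hpe.and (h.open_source.mem_nhds hx))
    simp only [mem_iUnion]
    refine ⟨p.restrOpen V hVo, ⟨hP.restr_mem p hp V hVo, fun y hy => (hV hy.2).2,
      fun y hy => (hV hy.2).1⟩, hxp, hxV⟩
  · exact iUnion₂_subset fun a ha => ha.2.1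

/-- A family of local transformations that is closed under composition and inversion and whose
domains cover the space generates the pseudogroup of local transformations with germs in it. -/
theorem mem_generated_iff {E : Set (Loct X)} (hcomp : ∀ e ∈ E, ∀ e' ∈ E, e.trans e' ∈ E)
    (hsymm : ∀ e ∈ E, e.symm ∈ E) (hcov : ∀ x, ∃ e ∈ E, x ∈ e.source) {h : Loct X} :
    h ∈ generated E ↔ ∀ x ∈ h.source, ∃ e ∈ E, x ∈ e.source ∧ h =ᶠ[𝓝 x] e := by
  constructor
  · intro hh
    have hR : IsGermRel (X := X) ⊤ (fun h x => ∃ e ∈ E, x ∈ e.source ∧ h =ᶠ[𝓝 x] e) := by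
      refine ⟨?_, ?_, ?_, ?_⟩
      · rintro h h' x - - hhh' ⟨e, he, hx, hhe⟩
        exact ⟨e, he, hx, hhh'.symm.trans hhe⟩
      · intro x _
        obtain ⟨e, he, hx⟩ := hcov x
        exact ⟨e.trans e.symm, hcomp e he _ (hsymm e he), by simp [hx],
          (symm_trans_self_eventuallyEq e hx).symm⟩
      · rintro h h' x hx - ⟨e, he, hxe, hhe⟩ ⟨e', he', hxe', hhe'⟩
        refine ⟨e.trans e', hcomp e he e' he', ⟨hxe, ?_⟩, eventuallyEq_trans hx hhe hhe'⟩
        rw [hhe.eq_of_nhds] at hxe'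
        exact hxe'
      · rintro h x hx ⟨e, he, hxe, hhe⟩
        refine ⟨e.symm, hsymm e he, ?_, eventuallyEq_symm hx hxe hhe⟩
        rw [hhe.eq_of_nhds]
        exact e.map_source hxe
    exact (hh _ ⟨hR.isPseudogroupOn, fun e he =>
      ⟨⟨by simp, by simp⟩, fun x hx => ⟨e, he, hx, EventuallyEq.rfl⟩⟩⟩).2
  · intro hh
    refine (isPseudogroup_generated E).mem_of_locally fun x hx => ?_
    obtain ⟨e, he, hxe, hhe⟩ := hh x hx
    exact ⟨e, subset_generatedOn _ _ he, hxe, hhe⟩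

theorem IsPseudogroup.refl_mem {P : Set (Loct X)} (hP : IsPseudogroup P) :
    OpenPartialHomeomorph.refl X ∈ P := by
  have := hP.id_mem
  rwa [show OpenPartialHomeomorph.ofSet ((⊤ : Opens X) : Set X) (⊤ : Opens X).isOpen =
    OpenPartialHomeomorph.refl X from OpenPartialHomeomorph.ofSet_univ_eq_refl] at this

/-- A pseudogroup is equivalent to its restriction to an open subspace that meets all orbits. -/
theorem areEquivalent_of_openEmbedding {G : Type u} [TopologicalSpace G] {P : Set (Loct X)}
    {P' : Set (Loct G)} (hP : IsPseudogroup P) (ι : OpenPartialHomeomorph G X)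
    (hι : ι.source = univ)
    (hP' : ∀ k : Loct G, k ∈ P' ↔ ∀ b ∈ k.source, ∃ p ∈ P, ι b ∈ p.source ∧
      ∀ᶠ b' in 𝓝 b, p (ι b') = ι (k b'))
    (horb : ∀ x, ∃ p ∈ P, x ∈ p.source ∧ p x ∈ ι.target) : AreEquivalent P P' := by
  have hmem : ∀ b, b ∈ ι.source := fun b => hι ▸ mem_univ b
  have hinj : ∀ b, ι.symm (ι b) = b := fun b => ι.left_inv (hmem b)
  have hιc : ∀ b, ContinuousAt ι b := fun b => ι.continuousAt (hmem b)
  -- The maps that locally become elements of `P` after composition with the embedding `ι`.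
  set Φ : Set (OpenPartialHomeomorph X G) :=
    {φ | ∀ x ∈ φ.source, ∃ p ∈ P, x ∈ p.source ∧ ∀ᶠ y in 𝓝 x, ι (φ y) = p y} with hΦ
  have hsymmΦ : ι.symm ∈ Φ := by
    intro x hx
    refine ⟨_, hP.refl_mem, mem_univ x, ?_⟩
    filter_upwards [ι.open_target.mem_nhds hx] with y hy
    simp [ι.right_inv hy]
  have hcover : ∀ x, ∃ φ ∈ Φ, x ∈ φ.source := by
    intro x
    obtain ⟨p, hp, hxp, hpx⟩ := horb x
    refine ⟨p.trans ι.symm, fun y hy => ⟨p, hp, hy.1, ?_⟩, hxp, hpx⟩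
    filter_upwards [(p.trans ι.symm).open_source.mem_nhds hy] with z hz
    exact ι.right_inv hz.2
  have hpre : IsPreMorphism P P' Φ := by
    refine ⟨?_, hcover, ?_⟩
    · intro φ hφ h hh h' hh' x hx
      have hx1 : x ∈ h.source := hx.1.1
      have hx2 : h x ∈ φ.source := hx.1.2
      have hx3 : φ (h x) ∈ h'.source := hx.2
      obtain ⟨p, hp, hxp, hpe⟩ := hφ _ hx2
      obtain ⟨q, hq, hxq, hqe⟩ := (hP' h').1 hh' _ hx3
      refine ⟨(h.trans p).trans q, hP.comp_mem _ (hP.comp_mem _ hh _ hp) _ hq,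
        ⟨⟨hx1, hxp⟩, ?_⟩, ?_⟩
      · simpa [← hpe.self_of_nhds] using hxq
      · filter_upwards [(h.continuousAt hx1).eventually hpe,
          (h.continuousAt hx1).eventually ((φ.continuousAt hx2).eventually hqe)] with y h1 h2
        simp [← h1, ← h2]
    · intro φ hφ φ' hφ'
      rw [hP']
      intro b hb
      have hb1 : b ∈ φ.target := hb.1
      have hb2 : φ.symm b ∈ φ'.source := hb.2
      obtain ⟨p, hp, hxp, hpe⟩ := hφ _ (φ.map_target hb1)
      obtain ⟨p', hp', hxp', hpe'⟩ := hφ' _ hb2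
      have h0 : ι b = p (φ.symm b) := by simpa [φ.right_inv hb1] using hpe.self_of_nhds
      refine ⟨p.symm.trans p', hP.comp_mem _ (hP.symm_mem _ hp) _ hp', ⟨?_, ?_⟩, ?_⟩
      · simpa [h0] using p.map_source hxp
      · simpa [h0, p.left_inv hxp] using hxp'
      · have hc : Tendsto φ.symm (𝓝 b) (𝓝 (φ.symm b)) := φ.symm.continuousAt hb1
        filter_upwards [hc.eventually hpe, hc.eventually hpe',
          hc.eventually (p.open_source.mem_nhds hxp), φ.open_target.mem_nhds hb1]
          with b' h1 h2 h3 h4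
        rw [φ.right_inv h4] at h1
        simp [h1, h2, p.left_inv h3]
  have hpre' : IsPreMorphism P' P (OpenPartialHomeomorph.symm '' Φ) := by
    refine ⟨?_, ?_, ?_⟩
    · rintro _ ⟨φ, hφ, rfl⟩ h hh h' hh'
      have hh2 : h.symm ∈ P' := by
        rw [hP']
        intro b hb
        obtain ⟨p, hp, hxp, hpe⟩ := (hP' h).1 hh _ (h.map_target hb)
        have h0 : p (ι (h.symm b)) = ι b := by simpa [h.right_inv hb] using hpe.self_of_nhds
        refine ⟨p.symm, hP.symm_mem _ hp, by simpa [← h0] using p.map_source hxp, ?_⟩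
        have hc : Tendsto h.symm (𝓝 b) (𝓝 (h.symm b)) := h.symm.continuousAt hb
        have hc' : Tendsto (fun b' => ι (h.symm b')) (𝓝 b) (𝓝 (ι (h.symm b))) :=
          (hιc _).tendsto.comp hc
        filter_upwards [hc.eventually hpe, hc'.eventually (p.open_source.mem_nhds hxp),
          h.open_target.mem_nhds hb] with b' h1 h2 h3
        rw [h.right_inv h3] at h1
        rw [← h1, p.left_inv h2]
      refine ⟨(h'.symm.trans φ).trans h.symm, hpre.comp_mem _ hφ _ (hP.symm_mem _ hh') _ hh2, ?_⟩
      simp only [OpenPartialHomeomorph.trans_symm_eq_symm_trans_symm,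
        OpenPartialHomeomorph.symm_symm, OpenPartialHomeomorph.trans_assoc]
    · intro b
      exact ⟨ι, ⟨ι.symm, hsymmΦ, rfl⟩, hmem b⟩
    · rintro _ ⟨φ, hφ, rfl⟩ _ ⟨φ', hφ', rfl⟩
      refine hP.mem_of_locally fun x hx => ?_
      have hx1 : x ∈ φ.source := hx.1
      have hx2 : φ x ∈ φ'.target := hx.2
      obtain ⟨p, hp, hxp, hpe⟩ := hφ _ hx1
      obtain ⟨p', hp', hxp', hpe'⟩ := hφ' _ (φ'.map_target hx2)
      have h0 : ι (φ x) = p' (φ'.symm (φ x)) := by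
        simpa [φ'.right_inv hx2] using hpe'.self_of_nhds
      refine ⟨p.trans p'.symm, hP.comp_mem _ hp _ (hP.symm_mem _ hp'), ⟨hxp, ?_⟩, ?_⟩
      · simpa [← hpe.self_of_nhds, h0] using p'.map_source hxp'
      · have hc : Tendsto (fun y => φ'.symm (φ y)) (𝓝 x) (𝓝 (φ'.symm (φ x))) :=
          (φ'.symm.continuousAt hx2).tendsto.comp (φ.continuousAt hx1)
        filter_upwards [hc.eventually hpe', hpe, hc.eventually (p'.open_source.mem_nhds hxp'),
          (φ.continuousAt hx1).eventually (φ'.open_target.mem_nhds hx2)] with y h1 h2 h3 h4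
        rw [φ'.right_inv h4] at h1
        simp [← h2, h1, p'.left_inv h3]
  refine ⟨Φ, ⟨hpre, fun Ψ hΨ hle ψ hψ x hx => ?_⟩, hpre', fun Ψ hΨ hle ψ hψ => ?_⟩
  -- Maximality: near `x` a competitor ψ is (ψφ⁻¹)φ with φ in Φ, and ψφ⁻¹ lies in `P'`, hence is
  -- given by an element of `P` when read through `ι`.
  · obtain ⟨φ, hφ, hxφ⟩ := hcover x
    obtain ⟨p, hp, hxp, hpe⟩ := hφ x hxφ
    obtain ⟨q, hq, hxq, hqe⟩ := (hP' _).1 (hΨ.mem_target φ (hle hφ) ψ hψ) (φ x)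
      ⟨φ.map_source hxφ, by simpa [φ.left_inv hxφ] using hx⟩
    refine ⟨p.trans q, hP.comp_mem _ hp _ hq, ⟨hxp, ?_⟩, ?_⟩
    · simpa [← hpe.self_of_nhds] using hxq
    · filter_upwards [hpe, (φ.continuousAt hxφ).eventually hqe, φ.open_source.mem_nhds hxφ]
        with y h1 h2 h3
      simp only [OpenPartialHomeomorph.trans_apply, φ.left_inv h3] at h2
      simp [← h1, h2]
  -- For the inverse family, comparison with `ι` alone suffices: ψι⁻¹ lies in `P`, hence so does its
  -- inverse ιψ⁻¹.
  · refine ⟨ψ.symm, fun x hx => ?_, rfl⟩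
    have hx' : x ∈ ψ.target := hx
    have hq := hΨ.mem_target ι (hle ⟨ι.symm, hsymmΦ, rfl⟩) ψ hψ
    set b := ψ.symm x with hb
    have hbs : b ∈ ψ.source := ψ.map_target hx'
    have hbx : ψ b = x := ψ.right_inv hx'
    refine ⟨(ι.symm.trans ψ).symm, hP.symm_mem _ hq, ⟨hx', hmem _⟩, ?_⟩
    filter_upwards with y
    simp

end Pseudogroups

end Molino

namespace Molino
open Filter

/-! ### Finite generation on relatively compact open subsets -/

section Chains

variable {T : Type u} [TopologicalSpace T]

theorem exists_finite_subcover_of_eventually {α : Type*} {Z : Set T} (hZ : IsCompact Z)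
    {A : Set α} {P : α → T → Prop} (h : ∀ q ∈ Z, ∃ a ∈ A, ∀ᶠ x in 𝓝 q, P a x) :
    ∃ F ⊆ A, F.Finite ∧ ∀ x ∈ Z, ∃ a ∈ F, P a x := by
  rcases Z.eq_empty_or_nonempty with rfl | ⟨q₀, hq₀⟩
  · exact ⟨∅, empty_subset _, finite_empty, by simp⟩
  have : Nonempty α := ⟨(h q₀ hq₀).choose⟩
  choose! a ha hP using h
  obtain ⟨t, htZ, ht⟩ := hZ.elim_nhds_subcover (fun q => {x | P (a q) x}) hP
  refine ⟨a '' t, ?_, t.finite_toSet.image a, fun x hx => ?_⟩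
  · rintro _ ⟨q, hq, rfl⟩
    exact ha q (htZ q hq)
  · obtain ⟨q, hq, hxq⟩ := mem_iUnion₂.1 (ht hx)
    exact ⟨a q, mem_image_of_mem a hq, hxq⟩

/-- An element of `S` together with a compact subset of its domain. -/
def IsStep (S : Set (Loct T)) (p : Loct T × Set T) : Prop :=
  p.1 ∈ S ∧ IsCompact p.2 ∧ p.2 ⊆ p.1.source

/-- The inverse of a local transformation, with the image of the compact set. -/
def stepInv (p : Loct T × Set T) : Loct T × Set T := (p.1.symm, p.1 '' p.2)

/-- The composite of local transformations, with the part of the compact set that is mapped to the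
second compact set. -/
def stepComp (p q : Loct T × Set T) : Loct T × Set T := (p.1.trans q.1, p.2 ∩ p.1 ⁻¹' q.2)

theorem IsStep.inv {S : Set (Loct T)} (hS : IsLocalPseudoStarGroup S) {p : Loct T × Set T}
    (hp : IsStep S p) : IsStep S (stepInv p) := by
  refine ⟨hS.symm_mem _ hp.1, hp.2.1.image_of_continuousOn (p.1.continuousOn.mono hp.2.2), ?_⟩
  rintro _ ⟨x, hx, rfl⟩
  exact p.1.map_source (hp.2.2 hx)

theorem IsStep.comp [T2Space T] {S : Set (Loct T)} (hS : IsLocalPseudoStarGroup S)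
    {p q : Loct T × Set T} (hp : IsStep S p) (hq : IsStep S q) : IsStep S (stepComp p q) := by
  refine ⟨hS.comp_mem _ hp.1 _ hq.1, ?_, fun x hx => ⟨hp.2.2 hx.1, hq.2.2 hx.2⟩⟩
  exact hp.2.1.of_isClosed_subset ((p.1.continuousOn.mono hp.2.2).preimage_isClosed_of_isClosed
    hp.2.1.isClosed hq.2.1.isClosed) inter_subset_left

theorem exists_isStep [LocallyCompactSpace T] {S : Set (Loct T)} {s : Loct T} (hs : s ∈ S) {q : T}
    (hq : q ∈ s.source) : ∃ C ∈ 𝓝 q, IsStep S (s, C) := by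
  obtain ⟨C, hC, hCs, hCc⟩ := local_compact_nhds (s.open_source.mem_nhds hq)
  exact ⟨C, hC, hs, hCc, hCs⟩

/-- Composites of steps in `D`, starting at `x`, whose intermediate points belong to `V`. -/
inductive Chain (D : Set (Loct T × Set T)) (V : Set T) (x : T) : Loct T → Prop
  | refl : Chain D V x (OpenPartialHomeomorph.refl T)
  | step (g : Loct T) (p : Loct T × Set T) : Chain D V x g → p ∈ D → g x ∈ p.2 →
      p.1 (g x) ∈ V → Chain D V x (g.trans p.1)

theorem Chain.single {D : Set (Loct T × Set T)} {V : Set T} {x : T} {p : Loct T × Set T}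
    (hp : p ∈ D) (hx : x ∈ p.2) (hpx : p.1 x ∈ V) : Chain D V x p.1 := by
  simpa using Chain.step _ p (Chain.refl (D := D) (V := V) (x := x)) hp hx hpx

theorem Chain.mem {D : Set (Loct T × Set T)} {V : Set T} {x : T} {g : Loct T}
    (hg : Chain D V x g) (hx : x ∈ V) : g x ∈ V := by
  cases hg with
  | refl => exact hx
  | step g p _ _ _ h => exact h

theorem Chain.mem_source {D : Set (Loct T × Set T)} (hD : ∀ p ∈ D, p.2 ⊆ p.1.source) {V : Set T}
    {x : T} {g : Loct T} (hg : Chain D V x g) : x ∈ g.source := by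
  induction hg with
  | refl => exact mem_univ x
  | step g p _ hp hx _ ih => exact ⟨ih, hD p hp hx⟩

theorem Chain.mono {D D' : Set (Loct T × Set T)} (hD : D ⊆ D') {V V' : Set T} (hV : V ⊆ V')
    {x : T} {g : Loct T} (hg : Chain D V x g) : Chain D' V' x g := by
  induction hg with
  | refl => exact Chain.refl
  | step g p _ hp hx h ih => exact Chain.step g p ih (hD hp) hx (hV h)

theorem Chain.trans {D : Set (Loct T × Set T)} {V : Set T} {x : T} {g g' : Loct T}
    (hg : Chain D V x g) (hg' : Chain D V (g x) g') : Chain D V x (g.trans g') := by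
  induction hg' with
  | refl => simpa using hg
  | step g' p _ hp hx h ih =>
    rw [← OpenPartialHomeomorph.trans_assoc]
    exact Chain.step _ p ih hp hx h

/-- Every germ of an element of `S` between points of `V` is a composite of steps in `D`. -/
def GeneratesGerms (S : Set (Loct T)) (D : Set (Loct T × Set T)) (V : Set T) : Prop :=
  ∀ s ∈ S, ∀ x ∈ s.source, x ∈ V → s x ∈ V → ∃ g, Chain D V x g ∧ g =ᶠ[𝓝 x] s

/-- The finite families obtained here serve to move points into a prescribed open set; conjugating
by them transfers finite generation from one open set to another. -/
theorem exists_steps_into [LocallyCompactSpace T] {S : Set (Loct T)} {Z U : Set T}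
    (hZ : IsCompact Z) (hU : IsOpen U) (h : ∀ x ∈ Z, ∃ s ∈ S, x ∈ s.source ∧ s x ∈ U) :
    ∃ N : Set (Loct T × Set T), N.Finite ∧ (∀ p ∈ N, IsStep S p) ∧
      ∀ x ∈ Z, ∃ p ∈ N, x ∈ p.2 ∧ p.1 x ∈ U := by
  obtain ⟨N, hN, hfin, hcov⟩ := exists_finite_subcover_of_eventually hZ (A := {p | IsStep S p})
    (P := fun p x => x ∈ p.2 ∧ p.1 x ∈ U) (by
      intro q hq
      obtain ⟨s, hs, hqs, hsU⟩ := h q hq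
      obtain ⟨C, hC, hst⟩ := exists_isStep hs hqs
      exact ⟨(s, C), hst, (eventually_mem_set.2 hC).and
        ((s.continuousAt hqs).eventually (hU.mem_nhds hsU))⟩)
  exact ⟨N, hfin, hN, hcov⟩

/-- Choose `p` and `q` in a finite family that bring the source and the target of the germ `s` into
`U`. Then `q s p⁻¹` joins points of `U`, hence is a chain, and `s = q⁻¹ (q s p⁻¹) p`. -/
theorem GeneratesGerms.enlarge [LocallyCompactSpace T] {S : Set (Loct T)}
    (hS : IsLocalPseudoStarGroup S) {D : Set (Loct T × Set T)} (hD : D.Finite)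
    (hDS : ∀ p ∈ D, IsStep S p) {U U' : Set T} (hU : IsOpen U) (hUU' : U ⊆ U')
    (hU' : IsCompact (closure U'))
    (h : ∀ x ∈ closure U', ∃ s ∈ S, x ∈ s.source ∧ s x ∈ U) (hg : GeneratesGerms S D U) :
    ∃ D' : Set (Loct T × Set T), D'.Finite ∧ (∀ p ∈ D', IsStep S p) ∧
      GeneratesGerms S D' U' := by
  obtain ⟨N, hN, hNS, hcov⟩ := exists_steps_into hU' hU h
  refine ⟨D ∪ N ∪ stepInv '' N, (hD.union hN).union (hN.image _), ?_, ?_⟩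
  · rintro p ((hp | hp) | ⟨p, hp, rfl⟩)
    exacts [hDS p hp, hNS p hp, (hNS p hp).inv hS]
  · intro s hs x hxs hx hsx
    obtain ⟨p, hp, hxp, hpx⟩ := hcov x (subset_closure hx)
    obtain ⟨q, hq, hsq, hqx⟩ := hcov _ (subset_closure hsx)
    have hxp' := (hNS p hp).2.2 hxp
    have hsq' := (hNS q hq).2.2 hsq
    have h1 : p.1.symm (p.1 x) = x := p.1.left_inv hxp'
    obtain ⟨g, hgc, hge⟩ := hg ((p.1.symm.trans s).trans q.1)
      (hS.comp_mem _ (hS.comp_mem _ (hS.symm_mem _ (hNS p hp).1) _ hs) _ (hNS q hq).1) (p.1 x)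
      ⟨⟨p.1.map_source hxp', by simpa [h1] using hxs⟩, by simpa [h1] using hsq'⟩ hpx
      (by simpa [h1] using hqx)
    have hgx : g (p.1 x) = q.1 (s x) := by simpa [h1] using hge.eq_of_nhds
    have hc1 : Chain (D ∪ N ∪ stepInv '' N) U' x p.1 :=
      Chain.single (Or.inl (Or.inr hp)) hxp (hUU' hpx)
    have hc2 : Chain (D ∪ N ∪ stepInv '' N) U' x (p.1.trans g) :=
      hc1.trans (hgc.mono (fun _ h => Or.inl (Or.inl h)) hUU')
    refine ⟨_, Chain.step _ (stepInv q) hc2 (Or.inr (mem_image_of_mem _ hq)) ?_ ?_, ?_⟩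
    · simp only [OpenPartialHomeomorph.trans_apply, hgx]
      exact mem_image_of_mem _ hsq
    · simp only [OpenPartialHomeomorph.trans_apply, hgx, stepInv]
      rwa [q.1.left_inv hsq']
    · filter_upwards [(p.1.continuousAt hxp').eventually hge, p.1.open_source.mem_nhds hxp',
        (s.continuousAt hxs).eventually (q.1.open_source.mem_nhds hsq')] with y h1 h2 h3
      simp only [OpenPartialHomeomorph.trans_apply, p.1.left_inv h2] at h1
      simp only [OpenPartialHomeomorph.trans_apply, h1, stepInv]
      exact q.1.left_inv h3

/-- A chain between points of `V` may leave `V` on the way. Inserting `q⁻¹ q` at each intermediate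
point, with `q` in a finite family that moves this point into `V`, turns it into a product of
composites `p d q⁻¹` between points of `V`, and there are finitely many of these. -/
theorem GeneratesGerms.shrink [LocallyCompactSpace T] [T2Space T] {S : Set (Loct T)}
    (hS : IsLocalPseudoStarGroup S) {D : Set (Loct T × Set T)} (hD : D.Finite)
    (hDS : ∀ p ∈ D, IsStep S p) {U V : Set T} (hU : IsCompact (closure U)) (hV : IsOpen V)
    (hVU : V ⊆ U) (h : ∀ x ∈ closure U, ∃ s ∈ S, x ∈ s.source ∧ s x ∈ V)
    (hg : GeneratesGerms S D U) :
    ∃ D' : Set (Loct T × Set T), D'.Finite ∧ (∀ p ∈ D', IsStep S p) ∧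
      GeneratesGerms S D' V := by
  obtain ⟨N, hN, hNS, hcov⟩ := exists_steps_into hU hV h
  obtain ⟨M, hMfin, hMS, hM⟩ : ∃ M : Set (Loct T × Set T), M.Finite ∧ (∀ p ∈ M, IsStep S p) ∧
      ∀ p ∈ N, ∀ d ∈ D, ∀ q ∈ N, stepComp (stepComp (stepInv p) d) q ∈ M := by
    refine ⟨⋃ p ∈ N, ⋃ d ∈ D, stepComp (stepComp (stepInv p) d) '' N,
      hN.biUnion fun p _ => hD.biUnion fun d _ => hN.image _, ?_, fun p hp d hd q hq =>
      mem_biUnion hp (mem_biUnion hd (mem_image_of_mem _ hq))⟩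
    intro m hm
    simp only [mem_iUnion, exists_prop] at hm
    obtain ⟨p, hp, d, hd, q, hq, rfl⟩ := hm
    exact (((hNS p hp).inv hS).comp hS (hDS _ hd)).comp hS (hNS _ hq)
  refine ⟨N ∪ stepInv '' N ∪ M, (hN.union (hN.image _)).union hMfin, ?_, ?_⟩
  · rintro p ((hp | ⟨p, hp, rfl⟩) | hp)
    exacts [hNS p hp, (hNS p hp).inv hS, hMS p hp]
  -- The statement is for every `p` that moves the end point into `V`, so that the induction closes:
  -- the shorter chain is followed by some `q`, and then `p d q⁻¹` is a single step from `M`.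
  · have key : ∀ x ∈ V, ∀ g, Chain D U x g → ∀ p ∈ N, g x ∈ p.2 → p.1 (g x) ∈ V →
        ∃ g', Chain (N ∪ stepInv '' N ∪ M) V x g' ∧ g' =ᶠ[𝓝 x] g.trans p.1 := by
      intro x hx g hgc
      induction hgc with
      | refl =>
        intro p hp hxp hpx
        exact ⟨p.1, Chain.single (Or.inl (Or.inl hp)) hxp hpx, by simp⟩
      | step g d hgc hd hgd hdU ih =>
        intro p hp hxp hpx
        obtain ⟨q, hq, hxq, hqx⟩ := hcov (g x) (subset_closure (hgc.mem (hVU hx)))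
        obtain ⟨g', hgc', hge'⟩ := ih q hq hxq hqx
        have hxq' := (hNS q hq).2.2 hxq
        have hg'x : g' x = q.1 (g x) := hge'.eq_of_nhds
        have h1 : q.1.symm (q.1 (g x)) = g x := q.1.left_inv hxq'
        refine ⟨_, Chain.step g' (stepComp (stepComp (stepInv q) d) p) hgc'
          (Or.inr (hM q hq d hd p hp)) ?_ ?_, ?_⟩
        · rw [hg'x]
          refine ⟨⟨mem_image_of_mem _ hxq, ?_⟩, ?_⟩
          · simpa [stepInv, h1] using hgd
          · simpa [stepInv, stepComp, h1] using hxp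
        · rw [hg'x]
          simpa [stepInv, stepComp, h1] using hpx
        · have hxg : x ∈ g.source := hgc.mem_source fun p hp => (hDS p hp).2.2
          filter_upwards [hge', (g.continuousAt hxg).eventually (q.1.open_source.mem_nhds hxq')]
            with y h2 h3
          have h3' : q.1.symm (q.1 (g y)) = g y := q.1.left_inv h3
          simp only [OpenPartialHomeomorph.trans_apply] at h2
          simp [stepInv, stepComp, h2, h3']
    intro s hs x hxs hx hsx
    obtain ⟨g, hgc, hge⟩ := hg s hs x hxs (hVU hx) (hVU hsx)
    have hgx : g x = s x := hge.eq_of_nhds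
    obtain ⟨p, hp, hxp, hpx⟩ := hcov (s x) (subset_closure (hVU hsx))
    obtain ⟨g', hgc', hge'⟩ := key x hx g hgc p hp (hgx ▸ hxp) (hgx ▸ hpx)
    have hxp' := (hNS p hp).2.2 hxp
    have hg'x : g' x = p.1 (s x) := by rw [← hgx]; exact hge'.eq_of_nhds
    refine ⟨_, Chain.step g' (stepInv p) hgc' (Or.inl (Or.inr (mem_image_of_mem _ hp))) ?_ ?_, ?_⟩
    · rw [hg'x]
      exact mem_image_of_mem _ hxp
    · rw [hg'x]
      simpa [stepInv, p.1.left_inv hxp'] using hsx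
    · filter_upwards [hge', hge, (s.continuousAt hxs).eventually (p.1.open_source.mem_nhds hxp')]
        with y h2 h3 h4
      simp only [OpenPartialHomeomorph.trans_apply] at h2
      simp [stepInv, h2, h3, p.1.left_inv h4]

/-- The given generators of the restriction to `U` only belong to `H`, but locally they are elements
of `S`, and finitely many steps replace them. To pass from `U` to an arbitrary relatively compact
`V`, enlarge to `U ∪ V` and then shrink. -/
theorem exists_generatesGerms_of_isCompactlyGenerated [LocallyCompactSpace T] [T2Space T]
    {H S : Set (Loct T)} (hmin : IsMinimal H) (hcg : IsCompactlyGenerated H)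
    (hS : IsLocalPseudoStarGroup S) (hgen : generated S = H) (hcov : ∀ x, ∃ h ∈ S, x ∈ h.source)
    {V : Set T} (hV : IsOpen V) (hVne : V.Nonempty) (hVc : IsCompact (closure V)) :
    ∃ D : Set (Loct T × Set T), D.Finite ∧ (∀ p ∈ D, IsStep S p) ∧ GeneratesGerms S D V := by
  have hmem : ∀ h : Loct T, h ∈ H ↔ ∀ x ∈ h.source, ∃ e ∈ S, x ∈ e.source ∧ h =ᶠ[𝓝 x] e :=
    fun h => hgen ▸ mem_generated_iff hS.comp_mem hS.symm_mem hcov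
  have hSH : S ⊆ H := hgen ▸ subset_generatedOn _ _
  obtain ⟨U, hUc, hUorb, E, hE, hEH, hEgen, hEext⟩ := hcg
  have into : ∀ x, ∀ W : Set T, (orbit H x ∩ W).Nonempty → ∃ s ∈ S, x ∈ s.source ∧ s x ∈ W := by
    rintro x W ⟨_, ⟨h, hh, hxh, rfl⟩, hW⟩
    obtain ⟨s, hs, hxs, hse⟩ := (hmem h).1 hh x hxh
    exact ⟨s, hs, hxs, hse.eq_of_nhds ▸ hW⟩
  have intoU : ∀ x, ∃ s ∈ S, x ∈ s.source ∧ s x ∈ (U : Set T) := fun x => into x _ (hUorb x)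
  have intoV : ∀ x, ∃ s ∈ S, x ∈ s.source ∧ s x ∈ V := fun x =>
    into x _ ((inter_comm V _) ▸ (hmin x).inter_open_nonempty V hV hVne)
  -- Here the extension `k` of `h` is essential: the compact closure of the domain of `h` lies in
  -- the domain of `k`, so finitely many germs of `S` cover it.
  have hN : ∀ h ∈ E, ∃ N : Set (Loct T × Set T), N.Finite ∧ (∀ p ∈ N, IsStep S p) ∧
      ∀ x ∈ h.source, ∃ p ∈ N, x ∈ p.2 ∧ p.1 =ᶠ[𝓝 x] h := by
    intro h hh
    obtain ⟨k, hk, hks, hke⟩ := hEext h hh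
    have hc : IsCompact (closure h.source) :=
      hUc.of_isClosed_subset isClosed_closure
        (closure_mono (subset_union_left.trans (hEH hh).2))
    obtain ⟨N, hN, hfin, hNcov⟩ := exists_finite_subcover_of_eventually hc
      (A := {p | IsStep S p}) (P := fun p x => x ∈ p.2 ∧ p.1 =ᶠ[𝓝 x] k) (by
        intro q hq
        obtain ⟨s, hs, hqs, hse⟩ := (hmem k).1 hk q (hks hq)
        obtain ⟨C, hC, hst⟩ := exists_isStep hs hqs
        exact ⟨(s, C), hst, (eventually_mem_set.2 hC).and hse.symm.eventuallyEq_nhds⟩)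
    refine ⟨N, hfin, hN, fun x hx => ?_⟩
    obtain ⟨p, hp, hxp, hpe⟩ := hNcov x (subset_closure hx)
    exact ⟨p, hp, hxp, hpe.trans (eventuallyEq_of_eqOn h.open_source hx hke).symm⟩
  choose! N hNfin hNS hNcov using hN
  set D₀ := ⋃ h ∈ E, N h with hD₀
  have hD₀S : ∀ p ∈ D₀, IsStep S p := by
    intro p hp
    obtain ⟨h, hh, hp⟩ := mem_iUnion₂.1 hp
    exact hNS h hh p hp
  set D := D₀ ∪ stepInv '' D₀ with hD
  have hDS : ∀ p ∈ D, IsStep S p := by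
    rintro p (hp | ⟨p, hp, rfl⟩)
    exacts [hD₀S p hp, (hD₀S p hp).inv hS]
  have hDfin : D.Finite := by
    have : D₀.Finite := hE.biUnion hNfin
    exact this.union (this.image _)
  have hDU : GeneratesGerms S D U := by
    have hDsub : ∀ p ∈ D, p.2 ⊆ p.1.source := fun p hp => (hDS p hp).2.2
    -- Chains can be reversed because `D` contains the inverses of its steps, with the images of the
    -- compact sets.
    have hDinv : ∀ x ∈ U, ∀ g, Chain D U x g → ∃ g', Chain D U (g x) g' ∧
        g' =ᶠ[𝓝 (g x)] g.symm := by
      intro x hx g hg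
      induction hg with
      | refl => exact ⟨_, Chain.refl, EventuallyEq.rfl⟩
      | step g p hg hp hgx hpU ih =>
        obtain ⟨g', hgc', hge'⟩ := ih
        have hgp : g x ∈ p.1.source := hDsub p hp hgx
        have h1 : p.1.symm (p.1 (g x)) = g x := p.1.left_inv hgp
        have hxg := hg.mem_source hDsub
        have hinv : ∃ q ∈ D, p.1 (g x) ∈ q.2 ∧ q.1 = p.1.symm := by
          rcases hp with hp | ⟨q, hq, rfl⟩
          · exact ⟨stepInv p, Or.inr (mem_image_of_mem _ hp), mem_image_of_mem _ hgx, rfl⟩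
          · obtain ⟨y, hy, hyx⟩ := hgx
            refine ⟨q, Or.inl hq, ?_, rfl⟩
            rw [← hyx]
            simpa [stepInv, q.1.left_inv ((hD₀S q hq).2.2 hy)] using hy
        obtain ⟨q, hq, hgq, hqe⟩ := hinv
        have hc : Chain D U (p.1 (g x)) q.1 :=
          Chain.single hq hgq (by rw [hqe, h1]; exact hg.mem hx)
        refine ⟨q.1.trans g', hc.trans (by rw [hqe, h1]; exact hgc'), ?_⟩
        rw [OpenPartialHomeomorph.trans_symm_eq_symm_trans_symm, hqe]
        refine eventuallyEq_trans (p.1.map_source hgp) EventuallyEq.rfl ?_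
        rw [OpenPartialHomeomorph.trans_apply, h1]
        exact hge'
    have hR : IsGermRel U (fun h x => x ∈ U ∧ ∃ g, Chain D U x g ∧ g =ᶠ[𝓝 x] h) := by
      refine ⟨?_, ?_, ?_, ?_⟩
      · rintro h h' x - - hhh' ⟨hx, g, hgc, hge⟩
        exact ⟨hx, g, hgc, hge.trans hhh'⟩
      · exact fun x hx => ⟨hx, _, Chain.refl, EventuallyEq.rfl⟩
      · rintro h h' x hx - ⟨hxU, g, hgc, hge⟩ ⟨-, g', hgc', hge'⟩
        have hgx := hge.eq_of_nhds
        rw [← hgx] at hgc' hge'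
        exact ⟨hxU, g.trans g', hgc.trans hgc',
          eventuallyEq_trans (hgc.mem_source hDsub) hge hge'⟩
      · rintro h x hx ⟨hxU, g, hgc, hge⟩
        have hgx := hge.eq_of_nhds
        obtain ⟨g', hgc', hge'⟩ := hDinv x hxU g hgc
        rw [← hgx]
        exact ⟨hgc.mem hxU, g', hgc',
          hge'.trans (eventuallyEq_symm (hgc.mem_source hDsub) hx hge)⟩
    intro s hs x hxs hx hsx
    -- Cutting `s` down to the points of `U` that it maps into `U` puts it in the restriction of `H`
    -- to `U`, where the generators apply.
    have hO : IsOpen (U ∩ (s.source ∩ s ⁻¹' U) : Set T) :=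
      U.isOpen.inter (s.isOpen_inter_preimage U.isOpen)
    have hmemr : s.restrOpen _ hO ∈ restriction H U := by
      refine ⟨hSH (hS.restr_mem s hs _ hO), union_subset (fun y hy => hy.2.1) fun y hy => ?_⟩
      have h2 : s (s.symm y) ∈ U := hy.2.2.2
      rwa [s.right_inv hy.1] at h2
    rw [← hEgen] at hmemr
    refine ((hmemr _ ⟨hR.isPseudogroupOn, fun h hh => ⟨⟨subset_union_left.trans (hEH hh).2,
      subset_union_right.trans (hEH hh).2⟩, fun y hy => ?_⟩⟩).2 x ⟨hxs, hx, hxs, hsx⟩).2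
    obtain ⟨p, hp, hyp, hpe⟩ := hNcov h hh y hy
    refine ⟨(hEH hh).2 (Or.inl hy), p.1, Chain.single
      (Or.inl (mem_iUnion₂.2 ⟨h, hh, hp⟩)) hyp ?_, hpe⟩
    rw [hpe.eq_of_nhds]
    exact (hEH hh).2 (Or.inr (h.map_source hy))
  have hUVc : IsCompact (closure ((U : Set T) ∪ V)) := by
    rw [closure_union]
    exact hUc.union hVc
  obtain ⟨D', hD', hDS', hDU'⟩ := hDU.enlarge hS hDfin hDS U.isOpen
    (subset_union_left (t := V)) hUVc (fun x _ => intoU x)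
  exact hDU'.shrink hS hD' hDS' hUVc hV subset_union_right (fun x _ => intoV x)

end Chains

end Molino

namespace Molino
open Filter

/-! ### Equicontinuity and extension around a point -/

section MetricReduction

/-- A compact Hausdorff space has only one uniformity compatible with its topology, so the two
metrics are uniformly equivalent on `K`. -/
theorem exists_dist_comparison {M T : Type*} [MetricSpace M] [MetricSpace T] {j : M → T}
    (hj : IsEmbedding j) {K : Set M} (hK : IsCompact K) :
    (∀ ε > 0, ∃ δ > 0, ∀ x ∈ K, ∀ y ∈ K, dist x y < δ → dist (j x) (j y) < ε) ∧
      ∀ ε > 0, ∃ δ > 0, ∀ x ∈ K, ∀ y ∈ K, dist (j x) (j y) < δ → dist x y < ε := by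
  have : CompactSpace K := isCompact_iff_compactSpace.1 hK
  have hf : IsEmbedding (fun x : K => j x) := hj.comp IsEmbedding.subtypeVal
  have hu : IsUniformInducing (fun x : K => j x) := by
    refine ⟨?_⟩
    have h1 : UniformSpace.comap (fun x : K => j x) inferInstance =
        (inferInstance : UniformSpace K) :=
      unique_uniformity_of_compact (t := instTopologicalSpaceSubtype) hf.eq_induced.symm rfl
    exact congrArg (fun u : UniformSpace K => u.uniformity) h1
  rw [Metric.isUniformInducing_iff, Metric.uniformContinuous_iff] at hu
  refine ⟨fun ε hε => ?_, fun ε hε => ?_⟩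
  · obtain ⟨δ, hδ, h⟩ := hu.1 ε hε
    exact ⟨δ, hδ, fun x hx y hy hxy => h (a := ⟨x, hx⟩) (b := ⟨y, hy⟩) hxy⟩
  · obtain ⟨δ, hδ, h⟩ := hu.2 ε hε
    exact ⟨δ, hδ, fun x hx y hy hxy => h (a := ⟨x, hx⟩) (b := ⟨y, hy⟩) hxy⟩

variable {T : Type u} [MetricSpace T]

/-- Uniform equicontinuity of the elements of `S`, as maps between parts of `K`. -/
def UniformEquicontinuousIn (S : Set (Loct T)) (K : Set T) : Prop :=
  ∀ ε > 0, ∃ δ > 0, ∀ h ∈ S, ∀ x ∈ h.source, ∀ y ∈ h.source, x ∈ K → y ∈ K → h x ∈ K → h y ∈ K →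
    dist x y < δ → dist (h x) (h y) < ε

/-- A small closed ball is compact and contained in a single member of the cover; there the metric
of this member is uniformly equivalent to the metric of `T`, and equicontinuity is needed only from
this member to itself. -/
theorem EquicontinuousWith.exists_closedBall [LocallyCompactSpace T] {S : Set (Loct T)}
    {Q : QuasiLocalMetricCover T} (hequi : EquicontinuousWith Q S) (x₀ : T) :
    ∃ R > 0, IsCompact (Metric.closedBall x₀ R) ∧
      UniformEquicontinuousIn S (Metric.closedBall x₀ R) := by
  obtain ⟨i, hi⟩ : ∃ i, x₀ ∈ Q.dom i := by
    have : x₀ ∈ ⋃ i, Q.dom i := Q.cover ▸ mem_univ x₀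
    simpa using this
  obtain ⟨C, hC, hCi, hCc⟩ := local_compact_nhds ((Q.isOpen_dom i).mem_nhds hi)
  obtain ⟨R, hR, hRC⟩ := Metric.nhds_basis_closedBall.mem_iff.1 hC
  have hKc : IsCompact (Metric.closedBall x₀ R) :=
    hCc.of_isClosed_subset Metric.isClosed_closedBall hRC
  have hKi : Metric.closedBall x₀ R ⊆ Q.dom i := hRC.trans hCi
  refine ⟨R, hR, hKc, ?_⟩
  have hK' : IsCompact (Subtype.val ⁻¹' Metric.closedBall x₀ R : Set (Q.dom i)) :=
    IsInducing.subtypeVal.isCompact_preimage_iff (by simpa using hKi) |>.2 hKc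
  have hemb : @IsEmbedding (Q.dom i) T
      (Q.metric i).toPseudoMetricSpace.toUniformSpace.toTopologicalSpace _ Subtype.val := by
    rw [Q.topology_eq i]
    exact IsEmbedding.subtypeVal
  have hK'' : @IsCompact (Q.dom i)
      (Q.metric i).toPseudoMetricSpace.toUniformSpace.toTopologicalSpace
      (Subtype.val ⁻¹' Metric.closedBall x₀ R) := by
    rw [Q.topology_eq i]
    exact hK'
  obtain ⟨h1, h2⟩ := @exists_dist_comparison (Q.dom i) T (Q.metric i) _ _ hemb _ hK''
  intro ε hε
  obtain ⟨η, hη, h1⟩ := h1 ε hε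
  obtain ⟨δ, hδ, h3⟩ := hequi η hη
  obtain ⟨δ', hδ', h2⟩ := h2 δ hδ
  refine ⟨δ', hδ', fun h hh x hx y hy hxK hyK hhx hhy hxy => ?_⟩
  exact h1 ⟨h x, hKi hhx⟩ hhx ⟨h y, hKi hhy⟩ hhy (h3 h hh i i x hx y hy (hKi hxK) (hKi hyK)
    (hKi hhx) (hKi hhy) (h2 ⟨x, hKi hxK⟩ hxK ⟨y, hKi hyK⟩ hyK hxy))

/-- Write a germ as a chain and extend it step by step on a ball of fixed radius δ. Each composite
so far belongs to `S`, so equicontinuity keeps the image of the ball within ε of the orbit of its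
center, and ε is chosen so that the next step is defined there. -/
theorem GeneratesGerms.exists_extension {S : Set (Loct T)} (hS : IsLocalPseudoStarGroup S)
    (hcov : ∀ x, ∃ h ∈ S, x ∈ h.source) {x₀ : T} {R : ℝ} (hR : 0 < R)
    (hK : IsCompact (Metric.closedBall x₀ R))
    (hequi : UniformEquicontinuousIn S (Metric.closedBall x₀ R)) {D : Set (Loct T × Set T)}
    (hD : D.Finite) (hDS : ∀ p ∈ D, IsStep S p)
    (hg : GeneratesGerms S D (Metric.ball x₀ (R / 2))) :
    ∃ ρ > 0, ρ ≤ R / 2 ∧ ∀ s ∈ S, ∀ x ∈ s.source, x ∈ Metric.ball x₀ ρ → s x ∈ Metric.ball x₀ ρ →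
      ∃ s' ∈ S, s'.source = Metric.ball x₀ ρ ∧
        MapsTo s' (Metric.ball x₀ ρ) (Metric.closedBall x₀ R) ∧ s' =ᶠ[𝓝 x] s := by
  set L := Metric.closedBall x₀ (R / 2) with hL
  have hLc : IsCompact L := hK.of_isClosed_subset Metric.isClosed_closedBall
    (Metric.closedBall_subset_closedBall (by linarith))
  -- The room around a step: the points of `p.2` that `p` sends into `L` form a compact set, and the
  -- part of this set in `L` has the ε-balls around its points inside the domain of `p`, with values
  -- in the ball of radius `R`. Since `D` is finite, one ε serves all steps.
  obtain ⟨ε, hε, hεR, hεD⟩ : ∃ ε > 0, ε ≤ R / 2 ∧ ∀ p ∈ D, ∀ x ∈ p.2, x ∈ L → p.1 x ∈ L →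
      Metric.ball x ε ⊆ p.1.source ∩ p.1 ⁻¹' Metric.ball x₀ R := by
    have h1 : ∀ p ∈ D, ∀ᶠ ε in 𝓝[>] (0 : ℝ), ∀ x ∈ p.2, x ∈ L → p.1 x ∈ L →
        Metric.ball x ε ⊆ p.1.source ∩ p.1 ⁻¹' Metric.ball x₀ R := by
      intro p hp
      obtain ⟨hps, hpc, hpsub⟩ := hDS p hp
      have hZ : IsCompact (p.2 ∩ p.1 ⁻¹' L) :=
        hpc.of_isClosed_subset ((p.1.continuousOn.mono hpsub).preimage_isClosed_of_isClosed
          hpc.isClosed hLc.isClosed) inter_subset_left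
      obtain ⟨δ, hδ, h⟩ := hZ.exists_thickening_subset_open
        (p.1.isOpen_inter_preimage (Metric.isOpen_ball (x := x₀) (ε := R)))
        (fun x hx => ⟨hpsub hx.1, Metric.closedBall_subset_ball (by linarith) hx.2⟩)
      filter_upwards [Ioo_mem_nhdsGT hδ] with η hη x hx _ hpx
      exact (Metric.ball_subset_ball hη.2.le).trans
        ((Metric.ball_subset_thickening (show x ∈ p.2 ∩ p.1 ⁻¹' L from ⟨hx, hpx⟩) δ).trans h)
    have h2 := (hD.eventually_all (l := 𝓝[>] (0 : ℝ))).2 h1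
    obtain ⟨ε, h3, h4⟩ := (h2.and (Ioo_mem_nhdsGT (show (0 : ℝ) < R / 2 by linarith))).exists
    exact ⟨ε, h4.1, h4.2.le, h3⟩
  -- δ₁ controls the images of balls. The Lebesgue number δ₂ places each ball centered in `L` inside
  -- the domain of one `h` in `S`, so that `h⁻¹h` supplies the identity of the ball as the start of
  -- the chain.
  obtain ⟨δ₁, hδ₁, hδe⟩ := hequi ε hε
  obtain ⟨δ₂, hδ₂, hleb⟩ := lebesgue_number_lemma_of_metric hLc
    (c := fun h : S => h.1.source) (fun h => h.1.open_source) (fun x _ => by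
      obtain ⟨h, hh, hx⟩ := hcov x
      exact mem_iUnion.2 ⟨⟨h, hh⟩, hx⟩)
  set δ := min (min δ₁ δ₂) (min ε (R / 2)) with hδ
  have hδpos : 0 < δ := lt_min (lt_min hδ₁ hδ₂) (lt_min hε (by linarith))
  have hδ1 : δ ≤ δ₁ := (min_le_left _ _).trans (min_le_left _ _)
  have hδ2 : δ ≤ δ₂ := (min_le_left _ _).trans (min_le_right _ _)
  have hδε : δ ≤ ε := (min_le_right _ _).trans (min_le_left _ _)
  have hδR : δ ≤ R / 2 := (min_le_right _ _).trans (min_le_right _ _)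
  have hball : ∀ y ∈ Metric.ball x₀ (R / 2), ∀ η ≤ R / 2,
      Metric.ball y η ⊆ Metric.closedBall x₀ R := by
    intro y hy η hη z hz
    rw [Metric.mem_ball] at hy hz
    rw [Metric.mem_closedBall]
    linarith [dist_triangle z y x₀]
  have hVL : Metric.ball x₀ (R / 2) ⊆ L := Metric.ball_subset_closedBall
  have hDsub : ∀ p ∈ D, p.2 ⊆ p.1.source := fun p hp => (hDS p hp).2.2
  have key : ∀ x ∈ Metric.ball x₀ (R / 2), ∀ g, Chain D (Metric.ball x₀ (R / 2)) x g →
      ∃ g' ∈ S, g'.source = Metric.ball x δ ∧ g' =ᶠ[𝓝 x] g ∧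
        MapsTo g' (Metric.ball x δ) (Metric.ball (g x) ε) := by
    intro x hx g hgc
    have hxδ : x ∈ Metric.ball x δ := Metric.mem_ball_self hδpos
    induction hgc with
    | refl =>
      obtain ⟨⟨h, hh⟩, hsub⟩ := hleb x (hVL hx)
      have hsub' : Metric.ball x δ ⊆ h.source := (Metric.ball_subset_ball hδ2).trans hsub
      refine ⟨(h.trans h.symm).restrOpen (Metric.ball x δ) Metric.isOpen_ball,
        hS.restr_mem _ (hS.comp_mem _ hh _ (hS.symm_mem _ hh)) _ _, ?_, ?_, ?_⟩
      · rw [OpenPartialHomeomorph.restrOpen_source]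
        apply inter_eq_right.2
        intro y hy
        simp [hsub' hy]
      · exact symm_trans_self_eventuallyEq h (hsub' hxδ)
      · intro y hy
        simpa [h.left_inv (hsub' hy)] using Metric.ball_subset_ball hδε hy
    | step g p hgc hp hgp hpg ih =>
      obtain ⟨g', hg'S, hg's, hg'e, hg'm⟩ := ih
      have hgx : g' x = g x := hg'e.eq_of_nhds
      have hsub := hεD p hp (g x) hgp (hVL (hgc.mem hx)) (hVL hpg)
      have hS' : g'.trans p.1 ∈ S := hS.comp_mem _ hg'S _ (hDS p hp).1
      have hsource : (g'.trans p.1).source = Metric.ball x δ := by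
        rw [OpenPartialHomeomorph.trans_source, hg's]
        exact inter_eq_left.2 fun y hy => (hsub (hg'm hy)).1
      have hKmem : ∀ y ∈ Metric.ball x δ, (g'.trans p.1) y ∈ Metric.closedBall x₀ R :=
        fun y hy => Metric.ball_subset_closedBall (hsub (hg'm hy)).2
      refine ⟨g'.trans p.1, hS', hsource,
        eventuallyEq_trans (hg's ▸ hxδ) hg'e EventuallyEq.rfl, fun y hy => ?_⟩
      -- Equicontinuity is applied to the whole composite and not to its last factor; the bound
      -- therefore does not deteriorate with the length of the chain.
      have := hδe _ hS' y (hsource ▸ hy) x (hsource ▸ hxδ) (hball x hx δ hδR hy)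
        (hball x hx δ hδR hxδ) (hKmem y hy) (hKmem x hxδ)
        (lt_of_lt_of_le (Metric.mem_ball.1 hy) hδ1)
      rw [Metric.mem_ball]
      simpa [hgx] using this
  -- With half the radius, the ball around `x₀` is contained in the δ-ball around each of its
  -- points.
  refine ⟨δ / 2, by linarith, by linarith, fun s hs x hxs hx hsx => ?_⟩
  have hsub1 : Metric.ball x₀ (δ / 2) ⊆ Metric.ball x₀ (R / 2) :=
    Metric.ball_subset_ball (by linarith)
  obtain ⟨g, hgc, hge⟩ := hg s hs x hxs (hsub1 hx) (hsub1 hsx)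
  obtain ⟨g', hg'S, hg's, hg'e, hg'm⟩ := key x (hsub1 hx) g hgc
  have hsub2 : Metric.ball x₀ (δ / 2) ⊆ Metric.ball x δ := by
    intro y hy
    rw [Metric.mem_ball] at hx hy ⊢
    linarith [dist_triangle_right y x x₀]
  refine ⟨g'.restrOpen (Metric.ball x₀ (δ / 2)) Metric.isOpen_ball, hS.restr_mem _ hg'S _ _, ?_,
    fun y hy => ?_, hg'e.trans hge⟩
  · rw [OpenPartialHomeomorph.restrOpen_source, hg's]
    exact inter_eq_right.2 hsub2
  · exact hball _ (hgc.mem (hsub1 hx)) ε hεR (hg'm (hsub2 hy))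

end MetricReduction

end Molino

namespace Molino
open Filter Metric

/-! ### Pointwise limits of local transformations with a fixed domain -/

section Limits

theorem subset_starClosure {T : Type u} [TopologicalSpace T] (S : Set (Loct T)) :
    S ⊆ starClosure S :=
  fun s hs => subset_closure ⟨s, hs, rfl, fun _ => rfl⟩

theorem StronglyQuasiAnalyticWith.eq_of_eventuallyEq {T : Type u} [TopologicalSpace T]
    {S : Set (Loct T)} (h : StronglyQuasiAnalyticWith S) {f : Loct T} (hf : f ∈ S) {x : T}
    (hx : x ∈ f.source) (he : f =ᶠ[𝓝 x] id) {z : T} (hz : z ∈ f.source) : f z = z := by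
  obtain ⟨O, hO, hOo, hxO⟩ := mem_nhds_iff.1 (he.and (f.open_source.mem_nhds hx))
  exact h f hf O hOo ⟨x, hxO⟩ (fun y hy => (hO hy).2) (fun y hy => (hO hy).1) hz

variable {T : Type u} [MetricSpace T] {S : Set (Loct T)} {x₀ : T} {R ρ : ℝ}

/-- The germs of the equicontinuous strongly quasi-analytic family `S` between points of the ball
of radius `ρ` extend to this ball. -/
structure IsLocalModel (S : Set (Loct T)) (x₀ : T) (R ρ : ℝ) : Prop where
  star : IsLocalPseudoStarGroup S
  qa : StronglyQuasiAnalyticWith (starClosure S)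
  compact : IsCompact (closedBall x₀ R)
  equi : UniformEquicontinuousIn S (closedBall x₀ R)
  pos : 0 < ρ
  le : ρ ≤ R
  cov : ∃ h ∈ S, x₀ ∈ h.source
  ext : ∀ s ∈ S, ∀ x ∈ s.source, x ∈ ball x₀ ρ → s x ∈ ball x₀ ρ →
    ∃ s' ∈ S, s'.source = ball x₀ ρ ∧ MapsTo s' (ball x₀ ρ) (closedBall x₀ R) ∧ s' =ᶠ[𝓝 x] s

/-- The elements of `S` with domain the ball of radius `ρ`. -/
def ballMaps (S : Set (Loct T)) (x₀ : T) (R ρ : ℝ) : Set (Loct T) :=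
  {s | s ∈ S ∧ s.source = ball x₀ ρ ∧ MapsTo s (ball x₀ ρ) (closedBall x₀ R)}

/-- Pointwise limits, on the ball of radius `ρ`, of elements of `S`. -/
def IsLim (S : Set (Loct T)) (x₀ : T) (R ρ : ℝ) (τ : T → T) : Prop :=
  ∃ l : Ultrafilter (Loct T), ballMaps S x₀ R ρ ∈ l ∧
    ∀ z ∈ ball x₀ ρ, Tendsto (fun s : Loct T => s z) l (𝓝 (τ z))

/-- `τ` and `σ` are mutually inverse wherever it makes sense in `O`. -/
def InverseIn (O : Set T) (τ σ : T → T) : Prop :=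
  (∀ z ∈ O, τ z ∈ O → σ (τ z) = z) ∧ ∀ w ∈ O, σ w ∈ O → τ (σ w) = w

theorem isLim_of_mem {s : Loct T} (hs : s ∈ ballMaps S x₀ R ρ) : IsLim S x₀ R ρ s :=
  ⟨pure s, hs, fun _ _ => tendsto_pure_nhds _ _⟩

namespace IsLocalModel

theorem ball_subset (hM : IsLocalModel S x₀ R ρ) : ball x₀ ρ ⊆ closedBall x₀ R :=
  ball_subset_closedBall.trans (closedBall_subset_closedBall hM.le)

theorem center_mem (hM : IsLocalModel S x₀ R ρ) : x₀ ∈ ball x₀ ρ := mem_ball_self hM.pos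

/-- The values stay in a compact ball, so along an ultrafilter they converge at every point. -/
theorem exists_isLim (hM : IsLocalModel S x₀ R ρ) {α : Type*} (l : Ultrafilter α)
    (F : α → Loct T) (hF : ∀ᶠ a in l, F a ∈ ballMaps S x₀ R ρ) :
    ∃ τ, IsLim S x₀ R ρ τ ∧ ∀ z ∈ ball x₀ ρ, Tendsto (fun a => F a z) l (𝓝 (τ z)) := by
  have h : ∀ z ∈ ball x₀ ρ, ∃ y, Tendsto (fun a => F a z) l (𝓝 y) := by
    intro z hz
    obtain ⟨y, -, hy⟩ := hM.compact.ultrafilter_le_nhds (l.map fun a => F a z)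
      (le_principal_iff.2 (by
        change ∀ᶠ a in l, F a z ∈ closedBall x₀ R
        filter_upwards [hF] with a ha using ha.2.2 hz))
    exact ⟨y, hy⟩
  have : Nonempty T := ⟨x₀⟩
  choose! τ hτ using h
  exact ⟨τ, ⟨l.map F, hF, fun z hz => tendsto_map'_iff.2 (hτ z hz)⟩, hτ⟩

theorem exists_modulus (hM : IsLocalModel S x₀ R ρ) {ε : ℝ} (hε : 0 < ε) :
    ∃ η > 0, ∀ τ, IsLim S x₀ R ρ τ → ∀ y ∈ ball x₀ ρ, ∀ z ∈ ball x₀ ρ, dist y z < η →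
      dist (τ y) (τ z) ≤ ε := by
  obtain ⟨η, hη, h⟩ := hM.equi ε hε
  refine ⟨η, hη, ?_⟩
  rintro τ ⟨l, hl, hτ⟩ y hy z hz hyz
  refine le_of_tendsto ((hτ y hy).dist (hτ z hz)) ?_
  filter_upwards [hl] with s hs
  exact (h s hs.1 y (hs.2.1 ▸ hy) z (hs.2.1 ▸ hz) (hM.ball_subset hy) (hM.ball_subset hz)
    (hs.2.2 hy) (hs.2.2 hz) hyz).le

/-- The common modulus of continuity allows the point of evaluation to move together with the map.
All limits of composites and inverses below rest on this. -/
theorem tendsto_apply (hM : IsLocalModel S x₀ R ρ) {α : Type*} {l : Filter α} {F : α → T → T}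
    (hF : ∀ᶠ i in l, IsLim S x₀ R ρ (F i)) {z y : T} (hz : z ∈ ball x₀ ρ)
    (hy : Tendsto (fun i => F i z) l (𝓝 y)) {w : α → T} (hw : Tendsto w l (𝓝 z)) :
    Tendsto (fun i => F i (w i)) l (𝓝 y) := by
  rw [Metric.tendsto_nhds] at hy ⊢
  intro ε hε
  obtain ⟨η, hη, h⟩ := hM.exists_modulus (half_pos hε)
  filter_upwards [hF, hy (ε / 2) (half_pos hε), hw (ball_mem_nhds z hη),
    hw (isOpen_ball.mem_nhds hz)] with i h1 h2 h3 h4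
  have := h _ h1 _ h4 _ hz h3
  linarith [dist_triangle (F i (w i)) (F i z) y]

theorem continuousOn (hM : IsLocalModel S x₀ R ρ) {τ : T → T} (hτ : IsLim S x₀ R ρ τ) :
    ContinuousOn τ (ball x₀ ρ) := fun _ hz =>
  hM.tendsto_apply (F := fun _ => τ) (Eventually.of_forall fun _ => hτ) hz tendsto_const_nhds
    (tendsto_id.mono_left nhdsWithin_le_nhds)

theorem continuousAt (hM : IsLocalModel S x₀ R ρ) {τ : T → T} (hτ : IsLim S x₀ R ρ τ) {z : T}
    (hz : z ∈ ball x₀ ρ) : ContinuousAt τ z :=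
  (hM.continuousOn hτ).continuousAt (isOpen_ball.mem_nhds hz)

/-- Extend the germ of `s⁻¹` at `s x` to an element `t` on the ball. The composites `ts` and `st`
are the identity near one point, hence on their whole domains by quasi-analyticity. -/
theorem exists_inverse_of_mem (hM : IsLocalModel S x₀ R ρ) {s : Loct T}
    (hs : s ∈ ballMaps S x₀ R ρ) {x : T} (hx : x ∈ ball x₀ ρ) (hsx : s x ∈ ball x₀ ρ) :
    ∃ t ∈ ballMaps S x₀ R ρ, InverseIn (ball x₀ ρ) s t := by
  have hxs : x ∈ s.source := hs.2.1 ▸ hx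
  have h1 : s.symm (s x) = x := s.left_inv hxs
  obtain ⟨t, ht, hts, htm, hte⟩ := hM.ext s.symm (hM.star.symm_mem s hs.1) (s x)
    (s.map_source hxs) hsx (by rwa [h1])
  have htx : t (s x) = x := hte.eq_of_nhds.trans h1
  refine ⟨t, ⟨ht, hts, htm⟩, fun z hz hsz => ?_, fun w hw htw => ?_⟩
  · refine hM.qa.eq_of_eventuallyEq (f := s.trans t)
      (subset_starClosure S (hM.star.comp_mem s hs.1 t ht)) (x := x)
      (mem_trans_source hxs ?_) ?_ (mem_trans_source ?_ ?_)
    · rwa [hts]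
    · filter_upwards [(s.continuousAt hxs).eventually hte, s.open_source.mem_nhds hxs] with y h2 h3
      simpa [s.left_inv h3] using h2
    · rwa [hs.2.1]
    · rwa [hts]
  · refine hM.qa.eq_of_eventuallyEq (f := t.trans s)
      (subset_starClosure S (hM.star.comp_mem t ht s hs.1)) (x := s x)
      (mem_trans_source (hts ▸ hsx) ?_) ?_ (mem_trans_source ?_ ?_)
    · rwa [htx]
    · filter_upwards [hte, s.open_target.mem_nhds (s.map_source hxs)] with y h2 h3
      simp [h2, s.right_inv h3]
    · rwa [hts]
    · rwa [hs.2.1]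

/-- Quasi-analyticity only compares with the identity, so it is applied to `t s'`, where `t` inverts
`s` on the ball. -/
theorem eq_of_eventuallyEq (hM : IsLocalModel S x₀ R ρ) {s s' : Loct T}
    (hs : s ∈ ballMaps S x₀ R ρ) (hs' : s' ∈ S) {x : T} (hx : x ∈ ball x₀ ρ)
    (hxs' : x ∈ s'.source) (hsx : s x ∈ ball x₀ ρ) (he : s =ᶠ[𝓝 x] s') {z : T}
    (hz : z ∈ ball x₀ ρ) (hzs' : z ∈ s'.source) (hsz : s' z ∈ ball x₀ ρ) : s z = s' z := by
  obtain ⟨t, ht, h1, h2⟩ := hM.exists_inverse_of_mem hs hx hsx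
  have hxs : x ∈ s.source := hs.2.1 ▸ hx
  have h3 : t (s' z) = z := by
    refine hM.qa.eq_of_eventuallyEq (f := s'.trans t)
      (subset_starClosure S (hM.star.comp_mem s' hs' t ht.1)) (x := x)
      (mem_trans_source hxs' ?_) ?_ (mem_trans_source hzs' ?_)
    · rwa [← he.eq_of_nhds, ht.2.1]
    · filter_upwards [he, isOpen_ball.mem_nhds hx,
        (s.continuousAt hxs).eventually (isOpen_ball.mem_nhds hsx)] with y h4 h5 h6
      simpa [← h4] using h1 y h5 h6
    · rwa [ht.2.1]
  have h4 := h2 (s' z) hsz (by rwa [h3])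
  rwa [h3] at h4

/-- The approximants of τ are eventually invertible in the sense of `InverseIn`; a limit of their
inverses along the same ultrafilter inverts τ. -/
theorem exists_inverse (hM : IsLocalModel S x₀ R ρ) {τ : T → T} (hτ : IsLim S x₀ R ρ τ) {x : T}
    (hx : x ∈ ball x₀ ρ) (hτx : τ x ∈ ball x₀ ρ) :
    ∃ σ, IsLim S x₀ R ρ σ ∧ InverseIn (ball x₀ ρ) τ σ := by
  obtain ⟨l, hl, hlim⟩ := hτ
  have hex : ∀ s : Loct T, s ∈ ballMaps S x₀ R ρ ∧ s x ∈ ball x₀ ρ →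
      ∃ t ∈ ballMaps S x₀ R ρ, InverseIn (ball x₀ ρ) s t :=
    fun s hs => hM.exists_inverse_of_mem hs.1 hx hs.2
  have : Nonempty (Loct T) := ⟨OpenPartialHomeomorph.refl T⟩
  choose! t ht htinv using hex
  have hev : ∀ᶠ s in (l : Filter (Loct T)), s ∈ ballMaps S x₀ R ρ ∧ s x ∈ ball x₀ ρ :=
    (eventually_mem_set.2 hl).and ((hlim x hx).eventually (isOpen_ball.mem_nhds hτx))
  obtain ⟨σ, hσ, hσlim⟩ := hM.exists_isLim l t (hev.mono ht)
  have hs' : ∀ᶠ s : Loct T in (l : Filter (Loct T)), IsLim S x₀ R ρ s :=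
    hev.mono fun s hs => isLim_of_mem hs.1
  have ht' : ∀ᶠ s in (l : Filter (Loct T)), IsLim S x₀ R ρ (t s) :=
    hev.mono fun s hs => isLim_of_mem (ht s hs)
  refine ⟨σ, hσ, fun z hz hτz => ?_, fun w hw hσw => ?_⟩
  · refine tendsto_nhds_unique
      (hM.tendsto_apply ht' hτz (hσlim _ hτz) (hlim z hz)) (tendsto_const_nhds.congr' ?_)
    filter_upwards [hev, (hlim z hz).eventually (isOpen_ball.mem_nhds hτz)] with s h1 h2
    exact ((htinv s h1).1 z hz h2).symm
  · refine tendsto_nhds_unique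
      (hM.tendsto_apply hs' hσw (hlim _ hσw) (hσlim w hw)) (tendsto_const_nhds.congr' ?_)
    filter_upwards [hev, (hσlim w hw).eventually (isOpen_ball.mem_nhds hσw)] with s h1 h2
    exact ((htinv s h1).2 w hw h2).symm

theorem exists_comp (hM : IsLocalModel S x₀ R ρ) {τ τ' : T → T} (hτ : IsLim S x₀ R ρ τ)
    (hτ' : IsLim S x₀ R ρ τ') {x : T} (hx : x ∈ ball x₀ ρ) (hτx : τ x ∈ ball x₀ ρ)
    (hτ'x : τ' (τ x) ∈ ball x₀ ρ) :
    ∃ υ, IsLim S x₀ R ρ υ ∧ ∀ z ∈ ball x₀ ρ, τ z ∈ ball x₀ ρ → τ' (τ z) ∈ ball x₀ ρ →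
      υ z = τ' (τ z) := by
  obtain ⟨l, hl, hlim⟩ := hτ
  obtain ⟨l', hl', hlim'⟩ := hτ'
  -- An ultrafilter on pairs makes both factors converge and, by compactness, also the extensions of
  -- their composites.
  set m : Ultrafilter (Loct T × Loct T) :=
    Ultrafilter.of ((l : Filter (Loct T)) ×ˢ (l' : Filter (Loct T))) with hm
  have h1 : Tendsto Prod.fst (m : Filter (Loct T × Loct T)) l :=
    tendsto_fst.mono_left (Ultrafilter.of_le _)
  have h2 : Tendsto Prod.snd (m : Filter (Loct T × Loct T)) l' :=
    tendsto_snd.mono_left (Ultrafilter.of_le _)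
  have hm1 : ∀ᶠ p in (m : Filter (Loct T × Loct T)), p.1 ∈ ballMaps S x₀ R ρ :=
    h1.eventually (eventually_mem_set.2 hl)
  have hm2 : ∀ᶠ p in (m : Filter (Loct T × Loct T)), p.2 ∈ ballMaps S x₀ R ρ :=
    h2.eventually (eventually_mem_set.2 hl')
  have hcomp : ∀ z ∈ ball x₀ ρ, τ z ∈ ball x₀ ρ →
      Tendsto (fun p : Loct T × Loct T => p.2 (p.1 z)) m (𝓝 (τ' (τ z))) := fun z hz hτz =>
    hM.tendsto_apply (F := fun p : Loct T × Loct T => p.2) (hm2.mono fun p hp => isLim_of_mem hp)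
      hτz ((hlim' _ hτz).comp h2) ((hlim z hz).comp h1)
  have hex : ∀ p : Loct T × Loct T, p.1 ∈ ballMaps S x₀ R ρ ∧ p.2 ∈ ballMaps S x₀ R ρ ∧
      p.1 x ∈ ball x₀ ρ ∧ p.2 (p.1 x) ∈ ball x₀ ρ → ∃ u ∈ ballMaps S x₀ R ρ,
      ∀ z ∈ ball x₀ ρ, p.1 z ∈ ball x₀ ρ → p.2 (p.1 z) ∈ ball x₀ ρ → u z = p.2 (p.1 z) := by
    rintro ⟨s, s'⟩ ⟨hs, hs', hsx, hs'x⟩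
    have hmem : s.trans s' ∈ S := hM.star.comp_mem s hs.1 s' hs'.1
    have hsrc : ∀ z ∈ ball x₀ ρ, s z ∈ ball x₀ ρ → z ∈ (s.trans s').source :=
      fun z hz hsz => mem_trans_source (by rwa [hs.2.1]) (by rwa [hs'.2.1])
    obtain ⟨u, hu, hus, hum, hue⟩ := hM.ext _ hmem x (hsrc x hx hsx) hx hs'x
    refine ⟨u, ⟨hu, hus, hum⟩, fun z hz hsz hs'z => ?_⟩
    refine hM.eq_of_eventuallyEq ⟨hu, hus, hum⟩ hmem hx (hsrc x hx hsx) ?_ hue hz (hsrc z hz hsz)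
      hs'z
    rw [hue.eq_of_nhds]
    exact hs'x
  have : Nonempty (Loct T) := ⟨OpenPartialHomeomorph.refl T⟩
  choose! u hu huz using hex
  have hev : ∀ᶠ p in (m : Filter (Loct T × Loct T)), p.1 ∈ ballMaps S x₀ R ρ ∧
      p.2 ∈ ballMaps S x₀ R ρ ∧ p.1 x ∈ ball x₀ ρ ∧ p.2 (p.1 x) ∈ ball x₀ ρ := by
    filter_upwards [hm1, hm2, ((hlim x hx).comp h1) (isOpen_ball.mem_nhds hτx),
      hcomp x hx hτx (isOpen_ball.mem_nhds hτ'x)] with p a b c d using ⟨a, b, c, d⟩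
  obtain ⟨υ, hυ, hυlim⟩ := hM.exists_isLim m u (hev.mono hu)
  refine ⟨υ, hυ, fun z hz hτz hτ'z => ?_⟩
  refine tendsto_nhds_unique (hυlim z hz) ((hcomp z hz hτz).congr' ?_)
  filter_upwards [hev, ((hlim z hz).comp h1) (isOpen_ball.mem_nhds hτz),
    hcomp z hz hτz (isOpen_ball.mem_nhds hτ'z)] with p a b c
  exact (huz p a z hz b c).symm

theorem exists_id (hM : IsLocalModel S x₀ R ρ) : ∃ i ∈ ballMaps S x₀ R ρ, EqOn i id (ball x₀ ρ) := by
  obtain ⟨h, hh, hx⟩ := hM.cov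
  have hmem : h.trans h.symm ∈ S := hM.star.comp_mem h hh _ (hM.star.symm_mem h hh)
  have hid := symm_trans_self_eventuallyEq h hx
  obtain ⟨i, hi, his, him, hie⟩ := hM.ext _ hmem x₀ (by simp [hx]) hM.center_mem
    (by simpa [h.left_inv hx] using hM.center_mem)
  refine ⟨i, ⟨hi, his, him⟩, fun z hz => ?_⟩
  exact hM.qa.eq_of_eventuallyEq (subset_starClosure S hi) (his ▸ hM.center_mem) (hie.trans hid)
    (his ▸ hz)

/-- The local transformation given by mutually inverse maps. -/
def _root_.Molino.InverseIn.loct {O : Set T} {τ σ : T → T} (h : InverseIn O τ σ) (hO : IsOpen O)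
    (hτ : ContinuousOn τ O) (hσ : ContinuousOn σ O) : Loct T where
  toFun := τ
  invFun := σ
  source := O ∩ τ ⁻¹' O
  target := O ∩ σ ⁻¹' O
  map_source' z hz := ⟨hz.2, by rw [mem_preimage, h.1 z hz.1 hz.2]; exact hz.1⟩
  map_target' z hz := ⟨hz.2, by rw [mem_preimage, h.2 z hz.1 hz.2]; exact hz.1⟩
  left_inv' z hz := h.1 z hz.1 hz.2
  right_inv' z hz := h.2 z hz.1 hz.2
  open_source := hτ.isOpen_inter_preimage hO hO
  open_target := hσ.isOpen_inter_preimage hO hO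
  continuousOn_toFun := hτ.mono inter_subset_left
  continuousOn_invFun := hσ.mono inter_subset_left

/-- Equicontinuity improves pointwise convergence to locally uniform convergence, hence to
convergence in the compact-open topology. This gives access to the quasi-analyticity hypothesis for
limits. -/
theorem mem_starClosure (hM : IsLocalModel S x₀ R ρ) {τ : T → T} (hτ : IsLim S x₀ R ρ τ)
    {f : Loct T} (hf : f.source ⊆ ball x₀ ρ) (he : EqOn f τ f.source) : f ∈ starClosure S := by
  have hτ' := hτ
  obtain ⟨l, hl, hlim⟩ := hτ
  classical
  -- The value for `s` not defined on all of `f.source` is arbitrary; such `s` do not occur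
  -- eventually.
  let F : Loct T → C(f.source, T) := fun s =>
    if h : f.source ⊆ s.source then ⟨fun x => s x, (s.continuousOn.mono h).domRestrict⟩ else toMap f
  have hFs : ∀ s ∈ ballMaps S x₀ R ρ, ∀ x : f.source, F s x = s x := by
    intro s hs x
    have h : f.source ⊆ s.source := hs.2.1 ▸ hf
    simp only [F, dif_pos h]
    rfl
  refine mem_closure_of_tendsto (f := F) (b := (l : Filter (Loct T))) ?_ ?_
  · refine ContinuousMap.tendsto_of_tendstoLocallyUniformly
      (Metric.tendstoLocallyUniformly_iff.2 fun ε hε x => ?_)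
    obtain ⟨η, hη, h⟩ := hM.exists_modulus (show 0 < ε / 4 by linarith)
    refine ⟨ball x η, ball_mem_nhds x hη, ?_⟩
    filter_upwards [hl, (Metric.tendsto_nhds.1 (hlim x (hf x.2))) (ε / 4) (by linarith)]
      with s hs h1 y hy
    have h2 := h s (isLim_of_mem hs) y (hf y.2) x (hf x.2) hy
    have h3 := h τ hτ' y (hf y.2) x (hf x.2) hy
    have h4 : toMap f y = τ y := he y.2
    rw [hFs s hs, h4]
    have h5 := dist_triangle4 (τ y) (τ x) (s x) (s y)
    rw [dist_comm (τ x), dist_comm (s x) (s y)] at h5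
    linarith
  · filter_upwards [hl] with s hs
    have h : f.source ⊆ s.source := hs.2.1 ▸ hf
    refine ⟨s.restrOpen f.source f.open_source, hM.star.restr_mem s hs.1 _ _, ?_, fun x => ?_⟩
    · rw [OpenPartialHomeomorph.restrOpen_source]
      exact inter_eq_right.2 h
    · simp [hFs s hs]

theorem eq_self_of_eventuallyEq_id (hM : IsLocalModel S x₀ R ρ) {τ : T → T}
    (hτ : IsLim S x₀ R ρ τ) {x : T} (hx : x ∈ ball x₀ ρ) (he : τ =ᶠ[𝓝 x] id) {z : T}
    (hz : z ∈ ball x₀ ρ) (hτz : τ z ∈ ball x₀ ρ) : τ z = z := by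
  have hτx : τ x = x := he.eq_of_nhds
  obtain ⟨σ, hσ, hinv⟩ := hM.exists_inverse hτ hx (hτx.symm ▸ hx)
  exact hM.qa.eq_of_eventuallyEq (f := hinv.loct isOpen_ball (hM.continuousOn hτ)
    (hM.continuousOn hσ)) (hM.mem_starClosure hτ inter_subset_left fun _ _ => rfl)
    (x := x) ⟨hx, by rw [mem_preimage, hτx]; exact hx⟩ he ⟨hz, hτz⟩

/-- `η` is a scale at which limits vary by a fraction of `ε`. -/
def _root_.Molino.IsScale (S : Set (Loct T)) (x₀ : T) (R ρ ε η : ℝ) : Prop :=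
  0 < η ∧ η ≤ ε / 8 ∧ ∀ τ, IsLim S x₀ R ρ τ → ∀ y ∈ ball x₀ ρ, ∀ z ∈ ball x₀ ρ,
    dist y z < 2 * η → dist (τ y) (τ z) ≤ ε / 8

theorem exists_isScale (hM : IsLocalModel S x₀ R ρ) {ε : ℝ} (hε : 0 < ε) :
    ∃ η, IsScale S x₀ R ρ ε η := by
  obtain ⟨η, hη, h⟩ := hM.exists_modulus (show 0 < ε / 8 by linarith)
  -- Halving η allows for two points of a ball of radius η, whose distance is less than twice the
  -- radius.
  refine ⟨min (η / 2) (ε / 8), lt_min (by linarith) (by linarith), min_le_right _ _,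
    fun τ hτ y hy z hz hyz => h τ hτ y hy z hz ?_⟩
  linarith [min_le_left (η / 2) (ε / 8)]

/-- If σ inverts τ, then στ' is the identity near `x`, hence wherever it stays in the ball, by
quasi-analyticity; applying τ gives τ' = τ. The two scales guarantee that it does stay there. -/
theorem eqOn_of_eventuallyEq (hM : IsLocalModel S x₀ R ρ) {r₀ r : ℝ} (hr₀ : IsScale S x₀ R ρ ρ r₀)
    (hr : IsScale S x₀ R ρ r₀ r) {τ τ' : T → T} (hτ : IsLim S x₀ R ρ τ)
    (hτ' : IsLim S x₀ R ρ τ') {x : T} (hx : x ∈ ball x₀ r) (hτx : τ x ∈ ball x₀ (ρ / 2))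
    (he : τ =ᶠ[𝓝 x] τ') : EqOn τ τ' (ball x₀ r) := by
  have hρ := hM.pos
  have h0 := hr₀.1
  have h0' := hr₀.2.1
  have h1 := hr.1
  have h1' := hr.2.1
  have hsub : ball x₀ r ⊆ ball x₀ ρ := ball_subset_ball (by linarith)
  have hsub2 : ball x₀ (ρ / 2) ⊆ ball x₀ ρ := ball_subset_ball (by linarith)
  obtain ⟨σ, hσ, hinv⟩ := hM.exists_inverse hτ (hsub hx) (hsub2 hτx)
  have hx' : τ' x = τ x := he.eq_of_nhds.symm
  have hσx : σ (τ x) = x := hinv.1 x (hsub hx) (hsub2 hτx)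
  obtain ⟨υ, hυ, hυz⟩ := hM.exists_comp hτ' hσ (hsub hx) (hx' ▸ hsub2 hτx)
    (by rw [hx', hσx]; exact hsub hx)
  have hυid : υ =ᶠ[𝓝 x] id := by
    have hc := hM.continuousAt hτ (hsub hx)
    filter_upwards [isOpen_ball.mem_nhds (hsub hx), he, hc (isOpen_ball.mem_nhds (hsub2 hτx))]
      with y h2 h3 h4
    have h5 := hinv.1 y h2 h4
    have := hυz y h2 (by rw [← h3]; exact h4) (by rw [← h3, h5]; exact h2)
    rw [this, ← h3, h5, id]
  -- The scale `r` puts τ' z near τ x, hence in the ball of radius ρ; the scale `r₀` then puts σ(τ'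
  -- z) near σ(τ x) = x.
  intro z hz
  have hxz : dist z x < 2 * r := by
    rw [mem_ball] at hx hz
    linarith [dist_triangle_right z x x₀]
  have h2 := hr.2.2 τ' hτ' z (hsub hz) x (hsub hx) hxz
  rw [hx'] at h2
  have h3 : τ' z ∈ ball x₀ ρ := by
    rw [mem_ball] at hτx ⊢
    linarith [dist_triangle (τ' z) (τ x) x₀]
  have h4 := hr₀.2.2 σ hσ (τ' z) h3 (τ x) (hsub2 hτx) (by linarith)
  rw [hσx] at h4
  have h5 : σ (τ' z) ∈ ball x₀ ρ := by
    rw [mem_ball] at hx ⊢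
    linarith [dist_triangle (σ (τ' z)) x x₀]
  have h6 := hυz z (hsub hz) h3 h5
  have h7 := hM.eq_self_of_eventuallyEq_id hυ (hsub hx) hυid (hsub hz) (h6 ▸ h5)
  rw [h6] at h7
  have h8 := hinv.2 _ h3 h5
  rwa [h7] at h8

end IsLocalModel

end Limits

end Molino

namespace Molino
open Filter Metric

/-! ### The compact space of limits and its partial operations -/

noncomputable section LimSpace

variable {T : Type u} [MetricSpace T] {S : Set (Loct T)} {x₀ : T} {R ρ r : ℝ}

/-- On the ball of radius `r`, limits are determined by any of their germs. -/
structure IsRigidModel (S : Set (Loct T)) (x₀ : T) (R ρ r : ℝ) : Prop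
    extends IsLocalModel S x₀ R ρ where
  r_pos : 0 < r
  r_le : r ≤ ρ / 8
  small : ∀ τ, IsLim S x₀ R ρ τ → ∀ y ∈ ball x₀ r, ∀ z ∈ ball x₀ r, dist (τ y) (τ z) ≤ ρ / 8
  unique : ∀ τ τ', IsLim S x₀ R ρ τ → IsLim S x₀ R ρ τ' → ∀ x ∈ ball x₀ r,
    τ x ∈ ball x₀ (ρ / 2) → τ =ᶠ[𝓝 x] τ' → EqOn τ τ' (ball x₀ r)

theorem IsLocalModel.exists_isRigidModel (hM : IsLocalModel S x₀ R ρ) :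
    ∃ r, IsRigidModel S x₀ R ρ r := by
  obtain ⟨r₀, hr₀⟩ := hM.exists_isScale hM.pos
  obtain ⟨r, hr⟩ := hM.exists_isScale hr₀.1
  have h1 := hr₀.2.1
  have h2 := hr.2.1
  have h3 := hr₀.1
  have h4 := hM.pos
  have hsub : ball x₀ r ⊆ ball x₀ ρ := ball_subset_ball (by linarith)
  refine ⟨r, hM, hr.1, by linarith, fun τ hτ y hy z hz => ?_,
    fun τ τ' hτ hτ' x hx hτx he => hM.eqOn_of_eventuallyEq hr₀ hr hτ hτ' hx hτx he⟩
  have : dist y z < 2 * r := by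
    rw [mem_ball] at hy hz
    linarith [dist_triangle_right y z x₀]
  have := hr.2.2 τ hτ y (hsub hy) z (hsub hz) this
  linarith

/-- The map `τ` on the ball of radius `r`, with value `x₀` elsewhere. -/
def normalize (x₀ : T) (r : ℝ) (τ : T → T) : T → T :=
  open Classical in fun z => if z ∈ ball x₀ r then τ z else x₀

theorem normalize_of_mem (τ : T → T) {z : T} (hz : z ∈ ball x₀ r) : normalize x₀ r τ z = τ z :=
  if_pos hz

theorem normalize_of_notMem (τ : T → T) {z : T} (hz : z ∉ ball x₀ r) :
    normalize x₀ r τ z = x₀ :=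
  if_neg hz

/-- The space of limits on the ball of radius `r`, with the topology of pointwise convergence. -/
def LimSpace (S : Set (Loct T)) (x₀ : T) (R ρ r : ℝ) : Set (T → T) :=
  {a | ∃ τ, IsLim S x₀ R ρ τ ∧ a = normalize x₀ r τ}

/-- The limit on the ball of radius `r` given by a limit on the ball of radius `ρ`. -/
def LimSpace.mk {τ : T → T} (hτ : IsLim S x₀ R ρ τ) : LimSpace S x₀ R ρ r :=
  ⟨normalize x₀ r τ, τ, hτ, rfl⟩

theorem LimSpace.mk_eqOn {τ : T → T} (hτ : IsLim S x₀ R ρ τ) :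
    EqOn (LimSpace.mk (r := r) hτ).1 τ (ball x₀ r) := fun _ hz => normalize_of_mem τ hz

theorem LimSpace.exists_isLim (a : LimSpace S x₀ R ρ r) :
    ∃ τ, IsLim S x₀ R ρ τ ∧ EqOn a.1 τ (ball x₀ r) := by
  obtain ⟨τ, hτ, h⟩ := a.2
  exact ⟨τ, hτ, fun z hz => h ▸ normalize_of_mem τ hz⟩

theorem LimSpace.ext_of_eqOn {a b : LimSpace S x₀ R ρ r} (h : EqOn a.1 b.1 (ball x₀ r)) :
    a = b := by
  refine Subtype.ext (funext fun z => ?_)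
  by_cases hz : z ∈ ball x₀ r
  · exact h hz
  · obtain ⟨τ, -, ha⟩ := a.2
    obtain ⟨τ', -, hb⟩ := b.2
    rw [ha, hb, normalize_of_notMem τ hz, normalize_of_notMem τ' hz]

theorem IsLim.congr {τ τ' : T → T} (hτ : IsLim S x₀ R ρ τ) (h : EqOn τ τ' (ball x₀ ρ)) :
    IsLim S x₀ R ρ τ' := by
  obtain ⟨l, hl, hlim⟩ := hτ
  exact ⟨l, hl, fun z hz => h hz ▸ hlim z hz⟩

/-- The limits given by elements of `S`. -/
def discretePart (S : Set (Loct T)) (x₀ : T) (R ρ r : ℝ) : Set (LimSpace S x₀ R ρ r) :=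
  {a | ∃ s ∈ ballMaps S x₀ R ρ, EqOn a.1 s (ball x₀ r)}

namespace IsRigidModel

theorem ball_subset_ball (hM : IsRigidModel S x₀ R ρ r) : ball x₀ r ⊆ ball x₀ ρ :=
  Metric.ball_subset_ball (by linarith [hM.r_le, hM.pos])

theorem ball_subset_half (hM : IsRigidModel S x₀ R ρ r) : ball x₀ r ⊆ ball x₀ (ρ / 2) :=
  Metric.ball_subset_ball (by linarith [hM.r_le, hM.pos])

theorem half_subset_ball (hM : IsRigidModel S x₀ R ρ r) : ball x₀ (ρ / 2) ⊆ ball x₀ ρ :=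
  Metric.ball_subset_ball (by linarith [hM.pos])

theorem center_mem_ball (hM : IsRigidModel S x₀ R ρ r) : x₀ ∈ ball x₀ r := mem_ball_self hM.r_pos

/-- The normalized value outside the small ball makes the space of limits a closed subset of a
product of compact balls, so that its compactness follows from Tychonoff's theorem. -/
theorem limSpace_eq_closure (hM : IsRigidModel S x₀ R ρ r) :
    LimSpace S x₀ R ρ r =
      closure {a | ∃ s ∈ ballMaps S x₀ R ρ, a = normalize x₀ r s} := by
  apply Subset.antisymm
  · rintro _ ⟨τ, ⟨l, hl, hlim⟩, rfl⟩
    refine mem_closure_of_tendsto (f := fun s : Loct T => normalize x₀ r s)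
      (b := (l : Filter (Loct T))) (tendsto_pi_nhds.2 fun z => ?_) ?_
    · by_cases hz : z ∈ ball x₀ r
      · simp only [normalize_of_mem _ hz]
        exact hlim z (hM.ball_subset_ball hz)
      · simp only [normalize_of_notMem _ hz]
        exact tendsto_const_nhds
    · filter_upwards [hl] with s hs using ⟨s, hs, rfl⟩
  · intro a ha
    obtain ⟨l, hl, hla⟩ := mem_closure_iff_ultrafilter.1 ha
    have hex : ∀ b ∈ {a | ∃ s ∈ ballMaps S x₀ R ρ, a = normalize x₀ r s},
        ∃ s ∈ ballMaps S x₀ R ρ, b = normalize x₀ r s := fun b hb => hb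
    have : Nonempty (Loct T) := ⟨OpenPartialHomeomorph.refl T⟩
    choose! s hs hbs using hex
    obtain ⟨τ, hτ, hlim⟩ := hM.exists_isLim l s (mem_of_superset hl hs)
    refine ⟨τ, hτ, funext fun z => ?_⟩
    have h1 : Tendsto (fun b : T → T => b z) l (𝓝 (a z)) :=
      ((continuous_apply z).tendsto a).mono_left hla
    refine tendsto_nhds_unique h1 ?_
    by_cases hz : z ∈ ball x₀ r
    · rw [normalize_of_mem τ hz]
      refine (hlim z (hM.ball_subset_ball hz)).congr' ?_
      filter_upwards [hl] with b hb
      conv_rhs => rw [hbs b hb, normalize_of_mem _ hz]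
    · rw [normalize_of_notMem τ hz]
      refine tendsto_const_nhds.congr' ?_
      filter_upwards [hl] with b hb
      rw [hbs b hb, normalize_of_notMem _ hz]

theorem isCompact_limSpace (hM : IsRigidModel S x₀ R ρ r) : IsCompact (LimSpace S x₀ R ρ r) := by
  have hc : IsCompact (Set.pi univ fun _ : T => closedBall x₀ R) :=
    isCompact_univ_pi fun _ => hM.compact
  rw [hM.limSpace_eq_closure]
  refine hc.of_isClosed_subset isClosed_closure (closure_minimal ?_ hc.isClosed)
  rintro _ ⟨s, hs, rfl⟩ z -
  by_cases hz : z ∈ ball x₀ r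
  · simp only [normalize_of_mem _ hz]
    exact hs.2.2 (hM.ball_subset_ball hz)
  · simp only [normalize_of_notMem _ hz]
    exact hM.ball_subset hM.center_mem

theorem compactSpace (hM : IsRigidModel S x₀ R ρ r) : CompactSpace (LimSpace S x₀ R ρ r) :=
  isCompact_iff_compactSpace.1 hM.isCompact_limSpace

theorem dense_discretePart (hM : IsRigidModel S x₀ R ρ r) :
    Dense (discretePart S x₀ R ρ r) := by
  intro a
  rw [closure_subtype]
  refine closure_mono ?_ (hM.limSpace_eq_closure.subset a.2)
  rintro _ ⟨s, hs, rfl⟩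
  exact ⟨LimSpace.mk (isLim_of_mem hs), ⟨s, hs, LimSpace.mk_eqOn _⟩, rfl⟩

/-- Joint continuity, from pointwise convergence and the common modulus of the limits on the ball of
radius ρ. -/
theorem eval_continuousAt (hM : IsRigidModel S x₀ R ρ r) (a : LimSpace S x₀ R ρ r) {z : T}
    (hz : z ∈ ball x₀ r) : ContinuousAt (fun p : LimSpace S x₀ R ρ r × T => p.1.1 p.2) (a, z) := by
  choose τ hτ he using LimSpace.exists_isLim (S := S) (x₀ := x₀) (R := R) (ρ := ρ) (r := r)
  have h1 : Tendsto (fun p : LimSpace S x₀ R ρ r × T => τ p.1 z) (𝓝 (a, z)) (𝓝 (a.1 z)) := by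
    have : (fun p : LimSpace S x₀ R ρ r × T => τ p.1 z) = fun p => p.1.1 z :=
      funext fun p => (he p.1 hz).symm
    rw [this]
    exact ((continuous_apply z).comp (continuous_subtype_val.comp continuous_fst)).tendsto (a, z)
  have h2 := hM.tendsto_apply (Eventually.of_forall fun p : LimSpace S x₀ R ρ r × T => hτ p.1)
    (hM.ball_subset_ball hz) h1 (w := Prod.snd) (continuous_snd.tendsto (a, z))
  refine h2.congr' ?_
  filter_upwards [(continuous_snd.tendsto (a, z)) (isOpen_ball.mem_nhds hz)] with p hp
  exact (he p.1 hp).symm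

theorem continuousAt_apply (hM : IsRigidModel S x₀ R ρ r) (a : LimSpace S x₀ R ρ r) {z : T}
    (hz : z ∈ ball x₀ r) : ContinuousAt a.1 z :=
  (hM.eval_continuousAt a hz).comp (f := fun z : T => (a, z)) (by fun_prop)

theorem continuousOn_apply (hM : IsRigidModel S x₀ R ρ r) (a : LimSpace S x₀ R ρ r) :
    ContinuousOn a.1 (ball x₀ r) := fun _ hz => (hM.continuousAt_apply a hz).continuousWithinAt

theorem _root_.Molino.LimSpace.continuous_eval (z : T) :
    Continuous fun a : LimSpace S x₀ R ρ r => a.1 z :=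
  (continuous_apply z).comp continuous_subtype_val

/-- Evaluation on a countable dense subset of `T` is injective, by continuity on the ball, and
embeds the compact space as a closed subset of a countable power of `T`. -/
theorem polishSpace (hM : IsRigidModel S x₀ R ρ r) [PolishSpace T] :
    PolishSpace (LimSpace S x₀ R ρ r) := by
  have := hM.compactSpace
  obtain ⟨D, hDc, hD⟩ := exists_countable_dense T
  have : Countable D := hDc.to_subtype
  have hcont : Continuous fun (a : LimSpace S x₀ R ρ r) (z : D) => a.1 z :=
    continuous_pi fun z => LimSpace.continuous_eval (z : T)
  refine (hcont.isClosedEmbedding fun a b hab => LimSpace.ext_of_eqOn fun z hz => ?_).polishSpace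
  by_contra hne
  have ho := ((hM.continuousAt_apply a hz).ne_iff_eventually_ne (hM.continuousAt_apply b hz)).1 hne
  obtain ⟨y, hy, hyD⟩ := mem_closure_iff_nhds.1 (hD z) _ ho
  exact hy (congrFun hab ⟨y, hyD⟩)

theorem ext_of_eventuallyEq (hM : IsRigidModel S x₀ R ρ r) {a b : LimSpace S x₀ R ρ r} {x : T}
    (hx : x ∈ ball x₀ r) (hax : a.1 x ∈ ball x₀ (ρ / 2)) (h : a.1 =ᶠ[𝓝 x] b.1) : a = b := by
  obtain ⟨τ, hτ, hτa⟩ := LimSpace.exists_isLim a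
  obtain ⟨τ', hτ', hτb⟩ := LimSpace.exists_isLim b
  have h1 := eventuallyEq_of_eqOn isOpen_ball hx hτa
  have h2 := eventuallyEq_of_eqOn isOpen_ball hx hτb
  have h3 := hM.unique τ τ' hτ hτ' x hx (hτa hx ▸ hax) ((h1.symm.trans h).trans h2)
  exact LimSpace.ext_of_eqOn fun z hz => (hτa hz).trans ((h3 hz).trans (hτb hz).symm)

/-- Pointwise convergence around a point implies convergence. -/
theorem tendsto_of_eventually (hM : IsRigidModel S x₀ R ρ r) {α : Type*} {l : Filter α}
    {F : α → LimSpace S x₀ R ρ r} {c : LimSpace S x₀ R ρ r} {x : T} (hx : x ∈ ball x₀ r)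
    (hcx : c.1 x ∈ ball x₀ (ρ / 2))
    (h : ∀ᶠ z in 𝓝 x, Tendsto (fun i => (F i).1 z) l (𝓝 (c.1 z))) : Tendsto F l (𝓝 c) := by
  have := hM.compactSpace
  rw [tendsto_iff_ultrafilter]
  intro m hm
  -- Compactness provides some limit `c'` along each ultrafilter. It agrees with `c` near `x`, so
  -- rigidity forces `c' = c`.
  obtain ⟨c', -, hc'⟩ := isCompact_univ.ultrafilter_le_nhds (m.map F) (by simp)
  have hc'' : Tendsto F m (𝓝 c') := hc'
  suffices c = c' by rwa [this]
  refine hM.ext_of_eventuallyEq hx hcx ?_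
  filter_upwards [h] with z hz
  exact tendsto_nhds_unique (hz.mono_left hm)
    (((LimSpace.continuous_eval z).tendsto c').comp hc'')

theorem dist_apply_le (hM : IsRigidModel S x₀ R ρ r) (a : LimSpace S x₀ R ρ r) {y z : T}
    (hy : y ∈ ball x₀ r) (hz : z ∈ ball x₀ r) : dist (a.1 y) (a.1 z) ≤ ρ / 8 := by
  obtain ⟨τ, hτ, h⟩ := LimSpace.exists_isLim a
  rw [h hy, h hz]
  exact hM.small τ hτ y hy z hz

/-! ### Unit, product and inverse on the space of limits -/

theorem isLim_id (hM : IsRigidModel S x₀ R ρ r) : IsLim S x₀ R ρ id := by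
  obtain ⟨i, hi, h⟩ := hM.exists_id
  exact (isLim_of_mem hi).congr h

/-- The identity element. -/
def one (hM : IsRigidModel S x₀ R ρ r) : LimSpace S x₀ R ρ r := LimSpace.mk hM.isLim_id

theorem one_apply (hM : IsRigidModel S x₀ R ρ r) {z : T} (hz : z ∈ ball x₀ r) :
    hM.one.1 z = z := normalize_of_mem _ hz

open Classical in
/-- The product: the limit with the germ at `x₀` of the composite. -/
def mul (hM : IsRigidModel S x₀ R ρ r) (a b : LimSpace S x₀ R ρ r) : LimSpace S x₀ R ρ r :=
  if h : ∃ c : LimSpace S x₀ R ρ r, c.1 =ᶠ[𝓝 x₀] a.1 ∘ b.1 then h.choose else hM.one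

open Classical in
/-- The inverse. -/
def inv (hM : IsRigidModel S x₀ R ρ r) (a : LimSpace S x₀ R ρ r) : LimSpace S x₀ R ρ r :=
  if h : ∃ c : LimSpace S x₀ R ρ r, InverseIn (ball x₀ r) a.1 c.1 then h.choose else hM.one

theorem mul_unique (hM : IsRigidModel S x₀ R ρ r) {a b c : LimSpace S x₀ R ρ r}
    (hab : a.1 (b.1 x₀) ∈ ball x₀ (ρ / 2)) (hc : c.1 =ᶠ[𝓝 x₀] a.1 ∘ b.1) : hM.mul a b = c := by
  have h : ∃ c : LimSpace S x₀ R ρ r, c.1 =ᶠ[𝓝 x₀] a.1 ∘ b.1 := ⟨c, hc⟩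
  rw [mul, dif_pos h]
  refine (hM.ext_of_eventuallyEq hM.center_mem_ball ?_ (hc.trans h.choose_spec.symm)).symm
  rw [hc.eq_of_nhds]
  exact hab

/-- The product is defined through its germ at `x₀` only; this recovers it as a composite at every
point of the ball that `b` keeps in the ball. -/
theorem mul_apply (hM : IsRigidModel S x₀ R ρ r) {a b : LimSpace S x₀ R ρ r}
    (hb : b.1 x₀ ∈ ball x₀ r) (hab : a.1 (b.1 x₀) ∈ ball x₀ (ρ / 2)) {z : T}
    (hz : z ∈ ball x₀ r) (hbz : b.1 z ∈ ball x₀ r) : (hM.mul a b).1 z = a.1 (b.1 z) := by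
  obtain ⟨τ, hτ, hτa⟩ := LimSpace.exists_isLim a
  obtain ⟨σ, hσ, hσb⟩ := LimSpace.exists_isLim b
  have hx₀ := hM.center_mem_ball
  have hsub := hM.ball_subset_ball
  obtain ⟨υ, hυ, h⟩ := hM.exists_comp hσ hτ (hsub hx₀) (hσb hx₀ ▸ hsub hb)
    (by rw [← hσb hx₀, ← hτa hb]; exact hM.half_subset_ball hab)
  have key : ∀ y ∈ ball x₀ r, b.1 y ∈ ball x₀ r →
      (LimSpace.mk (r := r) hυ).1 y = a.1 (b.1 y) := by
    intro y hy hby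
    rw [LimSpace.mk_eqOn hυ hy, hσb hy, hτa (hσb hy ▸ hby)]
    refine h y (hsub hy) (hσb hy ▸ hsub hby) ?_
    rw [← hσb hy, ← hτa hby]
    -- The gap between ρ/2 and ρ absorbs the variation of `a` on the small ball, which is at most
    -- ρ/8.
    have := hM.dist_apply_le a hby hb
    rw [mem_ball] at hab ⊢
    linarith [dist_triangle (a.1 (b.1 y)) (a.1 (b.1 x₀)) x₀, hM.pos]
  rw [hM.mul_unique (c := LimSpace.mk hυ) hab, key z hz hbz]
  filter_upwards [isOpen_ball.mem_nhds hx₀,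
    (hM.continuousAt_apply b hx₀) (isOpen_ball.mem_nhds hb)] with y hy hby using key y hy hby

theorem mul_apply_center (hM : IsRigidModel S x₀ R ρ r) {a b : LimSpace S x₀ R ρ r}
    (hb : b.1 x₀ ∈ ball x₀ r) (hab : a.1 (b.1 x₀) ∈ ball x₀ (ρ / 2)) :
    (hM.mul a b).1 x₀ = a.1 (b.1 x₀) := hM.mul_apply hb hab hM.center_mem_ball hb

theorem mul_eventuallyEq (hM : IsRigidModel S x₀ R ρ r) {a b : LimSpace S x₀ R ρ r}
    (hb : b.1 x₀ ∈ ball x₀ r) (hab : a.1 (b.1 x₀) ∈ ball x₀ (ρ / 2)) :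
    (hM.mul a b).1 =ᶠ[𝓝 x₀] a.1 ∘ b.1 := by
  filter_upwards [isOpen_ball.mem_nhds hM.center_mem_ball,
    (hM.continuousAt_apply b hM.center_mem_ball) (isOpen_ball.mem_nhds hb)] with y hy hby
  exact hM.mul_apply hb hab hy hby

theorem inverseIn_inv (hM : IsRigidModel S x₀ R ρ r) {a : LimSpace S x₀ R ρ r}
    (ha : a.1 x₀ ∈ ball x₀ r) : InverseIn (ball x₀ r) a.1 (hM.inv a).1 := by
  have h : ∃ c : LimSpace S x₀ R ρ r, InverseIn (ball x₀ r) a.1 c.1 := by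
    obtain ⟨τ, hτ, hτa⟩ := LimSpace.exists_isLim a
    have hx₀ := hM.center_mem_ball
    have hsub := hM.ball_subset_ball
    obtain ⟨σ, hσ, hinv⟩ := hM.exists_inverse hτ (hsub hx₀) (hτa hx₀ ▸ hsub ha)
    refine ⟨LimSpace.mk hσ, fun z hz haz => ?_, fun w hw hcw => ?_⟩
    · rw [LimSpace.mk_eqOn hσ haz, hτa hz]
      exact hinv.1 z (hsub hz) (hτa hz ▸ hsub haz)
    · rw [hτa hcw]
      rw [LimSpace.mk_eqOn hσ hw] at hcw ⊢
      exact hinv.2 w (hsub hw) (hsub hcw)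
  rw [inv, dif_pos h]
  exact h.choose_spec

theorem inv_apply (hM : IsRigidModel S x₀ R ρ r) {a : LimSpace S x₀ R ρ r}
    (ha : a.1 x₀ ∈ ball x₀ r) {z : T} (hz : z ∈ ball x₀ r) (haz : a.1 z ∈ ball x₀ r) :
    (hM.inv a).1 (a.1 z) = z := (hM.inverseIn_inv ha).1 z hz haz

theorem inv_apply_center (hM : IsRigidModel S x₀ R ρ r) {a : LimSpace S x₀ R ρ r}
    (ha : a.1 x₀ ∈ ball x₀ r) : (hM.inv a).1 (a.1 x₀) = x₀ :=
  hM.inv_apply ha hM.center_mem_ball ha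

theorem apply_inv (hM : IsRigidModel S x₀ R ρ r) {a : LimSpace S x₀ R ρ r}
    (ha : a.1 x₀ ∈ ball x₀ r) {w : T} (hw : w ∈ ball x₀ r)
    (haw : (hM.inv a).1 w ∈ ball x₀ r) : a.1 ((hM.inv a).1 w) = w :=
  (hM.inverseIn_inv ha).2 w hw haw

theorem eventually_inv_mem (hM : IsRigidModel S x₀ R ρ r) {a : LimSpace S x₀ R ρ r}
    (ha : a.1 x₀ ∈ ball x₀ r) : ∀ᶠ w in 𝓝 (a.1 x₀), (hM.inv a).1 w ∈ ball x₀ r := by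
  refine (hM.continuousAt_apply _ ha) (isOpen_ball.mem_nhds ?_)
  rw [hM.inv_apply_center ha]
  exact hM.center_mem_ball

theorem inv_unique (hM : IsRigidModel S x₀ R ρ r) {a c : LimSpace S x₀ R ρ r}
    (ha : a.1 x₀ ∈ ball x₀ r) (hc : InverseIn (ball x₀ r) a.1 c.1) : hM.inv a = c := by
  refine hM.ext_of_eventuallyEq ha ?_ ?_
  · rw [hM.inv_apply_center ha]
    exact mem_ball_self (by linarith [hM.pos])
  · filter_upwards [isOpen_ball.mem_nhds ha, hM.eventually_inv_mem ha] with w hw hw'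
    have h1 := hM.apply_inv ha hw hw'
    have h2 := hc.1 _ hw' (by rwa [h1])
    rw [h1] at h2
    exact h2.symm

theorem inv_inv (hM : IsRigidModel S x₀ R ρ r) {a : LimSpace S x₀ R ρ r}
    (ha : a.1 x₀ ∈ ball x₀ r) (ha' : (hM.inv a).1 x₀ ∈ ball x₀ r) : hM.inv (hM.inv a) = a :=
  hM.inv_unique ha' ⟨(hM.inverseIn_inv ha).2, (hM.inverseIn_inv ha).1⟩

/-- By rigidity it suffices to check pointwise convergence near `x₀`, where the product is the
composite and evaluation is jointly continuous. -/
theorem continuousAt_mul (hM : IsRigidModel S x₀ R ρ r) {a b : LimSpace S x₀ R ρ r}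
    (hb : b.1 x₀ ∈ ball x₀ r) (hab : a.1 (b.1 x₀) ∈ ball x₀ (ρ / 2)) :
    ContinuousAt (fun p : LimSpace S x₀ R ρ r × LimSpace S x₀ R ρ r => hM.mul p.1 p.2) (a, b) := by
  have hx₀ := hM.center_mem_ball
  have hcomp : ∀ z, b.1 z ∈ ball x₀ r →
      Tendsto (fun p : LimSpace S x₀ R ρ r × LimSpace S x₀ R ρ r => p.1.1 (p.2.1 z)) (𝓝 (a, b))
        (𝓝 (a.1 (b.1 z))) := by
    intro z hz
    have h1 : Tendsto (fun p : LimSpace S x₀ R ρ r × LimSpace S x₀ R ρ r => (p.1, p.2.1 z))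
        (𝓝 (a, b)) (𝓝 (a, b.1 z)) :=
      (continuous_fst.prodMk ((LimSpace.continuous_eval z).comp continuous_snd)).tendsto (a, b)
    exact (hM.eval_continuousAt a hz).tendsto.comp h1
  have hsnd : ∀ z, Tendsto (fun p : LimSpace S x₀ R ρ r × LimSpace S x₀ R ρ r => p.2.1 z)
      (𝓝 (a, b)) (𝓝 (b.1 z)) := fun z =>
    ((LimSpace.continuous_eval z).comp continuous_snd).tendsto (a, b)
  refine hM.tendsto_of_eventually hx₀ ?_ ?_
  · rw [hM.mul_apply_center hb hab]
    exact hab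
  · filter_upwards [isOpen_ball.mem_nhds hx₀,
      (hM.continuousAt_apply b hx₀) (isOpen_ball.mem_nhds hb)] with z hz hbz
    rw [hM.mul_apply hb hab hz hbz]
    refine (hcomp z hbz).congr' ?_
    filter_upwards [hsnd x₀ (isOpen_ball.mem_nhds hb), hcomp x₀ hb (isOpen_ball.mem_nhds hab),
      hsnd z (isOpen_ball.mem_nhds hbz)] with p h1 h2 h3
    exact (hM.mul_apply h1 h2 hz h3).symm

/-- Convergence is checked near `a x₀`. For `w = a z` and `b` close to `a`, the point `b z` is close
to `w`, so `b⁻¹ w` is close to `b⁻¹ (b z) = z = a⁻¹ w` by the common modulus. -/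
theorem continuousAt_inv (hM : IsRigidModel S x₀ R ρ r) {a : LimSpace S x₀ R ρ r}
    (ha : a.1 x₀ ∈ ball x₀ r) : ContinuousAt hM.inv a := by
  have hev : ∀ z, Tendsto (fun b : LimSpace S x₀ R ρ r => b.1 z) (𝓝 a) (𝓝 (a.1 z)) := fun z =>
    (LimSpace.continuous_eval z).tendsto a
  refine hM.tendsto_of_eventually ha ?_ ?_
  · rw [hM.inv_apply_center ha]
    exact mem_ball_self (by linarith [hM.pos])
  · filter_upwards [isOpen_ball.mem_nhds ha, hM.eventually_inv_mem ha] with w hw hw'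
    set z := (hM.inv a).1 w with hz
    have haz : a.1 z = w := hM.apply_inv ha hw hw'
    rw [Metric.tendsto_nhds]
    intro ε hε
    obtain ⟨η, hη, h⟩ := hM.exists_modulus (half_pos hε)
    have h0 := hev z
    rw [haz] at h0
    filter_upwards [hev x₀ (isOpen_ball.mem_nhds ha), h0 (isOpen_ball.mem_nhds hw),
      h0 (ball_mem_nhds w hη)] with b h1 h2 h3
    obtain ⟨τ, hτ, hτb⟩ := LimSpace.exists_isLim (hM.inv b)
    have h4 := h τ hτ w (hM.ball_subset_ball hw) (b.1 z) (hM.ball_subset_ball h2)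
      (by rw [dist_comm]; exact h3)
    rw [← hτb hw, ← hτb h2, hM.inv_apply h1 hw' h2] at h4
    linarith

theorem one_mul (hM : IsRigidModel S x₀ R ρ r) {a : LimSpace S x₀ R ρ r}
    (ha : a.1 x₀ ∈ ball x₀ r) : hM.mul hM.one a = a := by
  refine hM.mul_unique ?_ ?_
  · rw [hM.one_apply ha]
    exact hM.ball_subset_half ha
  · filter_upwards [(hM.continuousAt_apply a hM.center_mem_ball) (isOpen_ball.mem_nhds ha)]
      with z hz
    exact (hM.one_apply hz).symm

theorem mul_one (hM : IsRigidModel S x₀ R ρ r) {a : LimSpace S x₀ R ρ r}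
    (ha : a.1 x₀ ∈ ball x₀ r) : hM.mul a hM.one = a := by
  refine hM.mul_unique ?_ ?_
  · rw [hM.one_apply hM.center_mem_ball]
    exact hM.ball_subset_half ha
  · filter_upwards [isOpen_ball.mem_nhds hM.center_mem_ball] with z hz
    rw [Function.comp_apply, hM.one_apply hz]

theorem inv_one (hM : IsRigidModel S x₀ R ρ r) : hM.inv hM.one = hM.one := by
  refine hM.inv_unique ?_ ⟨fun z hz h => ?_, fun z hz h => ?_⟩
  · rw [hM.one_apply hM.center_mem_ball]
    exact hM.center_mem_ball
  all_goals rw [hM.one_apply h, hM.one_apply hz]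

/-- `a⁻¹ (a b) = b`. -/
theorem inv_mul_cancel_left (hM : IsRigidModel S x₀ R ρ r) {a b : LimSpace S x₀ R ρ r}
    (ha : a.1 x₀ ∈ ball x₀ r) (hb : b.1 x₀ ∈ ball x₀ r) (hab : a.1 (b.1 x₀) ∈ ball x₀ r) :
    hM.mul (hM.inv a) (hM.mul a b) = b := by
  have hab' := hM.ball_subset_half hab
  have hc := hM.mul_apply_center hb hab'
  refine hM.mul_unique ?_ ?_
  · rw [hc, hM.inv_apply ha hb hab]
    exact hM.ball_subset_half hb
  · filter_upwards [hM.mul_eventuallyEq hb hab',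
      (hM.continuousAt_apply b hM.center_mem_ball) (isOpen_ball.mem_nhds hb),
      (hM.continuousAt_apply (hM.mul a b) hM.center_mem_ball)
        (isOpen_ball.mem_nhds (by rw [hc]; exact hab))] with z h1 h2 h3
    rw [mem_preimage, h1] at h3
    rw [Function.comp_apply, h1, Function.comp_apply, hM.inv_apply ha h2 h3]

theorem inv_mul_self (hM : IsRigidModel S x₀ R ρ r) {a : LimSpace S x₀ R ρ r}
    (ha : a.1 x₀ ∈ ball x₀ r) : hM.mul (hM.inv a) a = hM.one := by
  have h1 : hM.one.1 x₀ = x₀ := hM.one_apply hM.center_mem_ball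
  have := hM.inv_mul_cancel_left (b := hM.one) ha (h1.symm ▸ hM.center_mem_ball) (h1.symm ▸ ha)
  rwa [hM.mul_one ha] at this

theorem mul_inv_self (hM : IsRigidModel S x₀ R ρ r) {a : LimSpace S x₀ R ρ r}
    (ha : a.1 x₀ ∈ ball x₀ r) (ha' : (hM.inv a).1 x₀ ∈ ball x₀ r) :
    hM.mul a (hM.inv a) = hM.one := by
  have := hM.inv_mul_self ha'
  rwa [hM.inv_inv ha ha'] at this

theorem mul_assoc (hM : IsRigidModel S x₀ R ρ r) {a b c : LimSpace S x₀ R ρ r}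
    (hb : b.1 x₀ ∈ ball x₀ r) (hab : a.1 (b.1 x₀) ∈ ball x₀ r) (hc : c.1 x₀ ∈ ball x₀ r)
    (hbc : b.1 (c.1 x₀) ∈ ball x₀ r) (habc : a.1 (b.1 (c.1 x₀)) ∈ ball x₀ r) :
    hM.mul (hM.mul a b) c = hM.mul a (hM.mul b c) := by
  have hx₀ := hM.center_mem_ball
  have hsub := hM.ball_subset_half
  have h1 : (hM.mul a b).1 (c.1 x₀) = a.1 (b.1 (c.1 x₀)) := hM.mul_apply hb (hsub hab) hc hbc
  have h2 : (hM.mul b c).1 x₀ = b.1 (c.1 x₀) := hM.mul_apply_center hc (hsub hbc)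
  refine hM.mul_unique (h1 ▸ hsub habc) ?_
  refine (hM.mul_eventuallyEq (h2.symm ▸ hbc) (h2.symm ▸ hsub habc)).trans ?_
  have hcc := hM.continuousAt_apply c hx₀
  filter_upwards [hM.mul_eventuallyEq hc (hsub hbc), hcc (isOpen_ball.mem_nhds hc),
    ((hM.continuousAt_apply b hc).comp hcc) (isOpen_ball.mem_nhds hbc)] with z h3 h4 h5
  rw [Function.comp_apply, h3, Function.comp_apply, Function.comp_apply,
    hM.mul_apply hb (hsub hab) h4 h5]

theorem one_mem_discretePart (hM : IsRigidModel S x₀ R ρ r) :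
    hM.one ∈ discretePart S x₀ R ρ r := by
  obtain ⟨i, hi, h⟩ := hM.exists_id
  exact ⟨i, hi, fun z hz => (hM.one_apply hz).trans (h (hM.ball_subset_ball hz)).symm⟩

theorem inv_mem_discretePart (hM : IsRigidModel S x₀ R ρ r) {a : LimSpace S x₀ R ρ r}
    (ha : a.1 x₀ ∈ ball x₀ r) (h : a ∈ discretePart S x₀ R ρ r) :
    hM.inv a ∈ discretePart S x₀ R ρ r := by
  obtain ⟨s, hs, hsa⟩ := h
  have hx₀ := hM.center_mem_ball
  have hsub := hM.ball_subset_ball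
  obtain ⟨t, ht, hst⟩ := hM.exists_inverse_of_mem hs (hsub hx₀) (hsa hx₀ ▸ hsub ha)
  refine ⟨t, ht, ?_⟩
  rw [hM.inv_unique (c := LimSpace.mk (isLim_of_mem ht)) ha ⟨fun z hz haz => ?_, fun w hw htw => ?_⟩]
  · exact LimSpace.mk_eqOn _
  · rw [LimSpace.mk_eqOn _ haz, hsa hz]
    exact hst.1 z (hsub hz) (hsa hz ▸ hsub haz)
  · rw [hsa htw]
    rw [LimSpace.mk_eqOn _ hw] at htw ⊢
    exact hst.2 w (hsub hw) (hsub htw)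

/-- A germ of an element of `S` at a point of the ball is the germ of a limit given by `S`. -/
theorem exists_mem_discretePart (hM : IsRigidModel S x₀ R ρ r) {s : Loct T} (hs : s ∈ S) {x : T}
    (hx : x ∈ ball x₀ r) (hxs : x ∈ s.source) (hsx : s x ∈ ball x₀ ρ) :
    ∃ a ∈ discretePart S x₀ R ρ r, a.1 =ᶠ[𝓝 x] s := by
  obtain ⟨s', hs', h1, h2, h3⟩ := hM.ext s hs x hxs (hM.ball_subset_ball hx) hsx
  have h4 : IsLim S x₀ R ρ s' := isLim_of_mem ⟨hs', h1, h2⟩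
  refine ⟨LimSpace.mk h4, ⟨s', ⟨hs', h1, h2⟩, LimSpace.mk_eqOn h4⟩, ?_⟩
  exact (eventuallyEq_of_eqOn isOpen_ball hx (LimSpace.mk_eqOn h4)).trans h3

theorem mul_mem_discretePart (hM : IsRigidModel S x₀ R ρ r) {a b : LimSpace S x₀ R ρ r}
    (hb : b.1 x₀ ∈ ball x₀ r) (hab : a.1 (b.1 x₀) ∈ ball x₀ (ρ / 2))
    (ha' : a ∈ discretePart S x₀ R ρ r) (hb' : b ∈ discretePart S x₀ R ρ r) :
    hM.mul a b ∈ discretePart S x₀ R ρ r := by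
  obtain ⟨s, hs, hsa⟩ := ha'
  obtain ⟨t, ht, htb⟩ := hb'
  have hx₀ := hM.center_mem_ball
  have hsub := hM.ball_subset_ball
  have h1 : t x₀ ∈ ball x₀ r := htb hx₀ ▸ hb
  obtain ⟨c, hc, hce⟩ := hM.exists_mem_discretePart (hM.star.comp_mem t ht.1 s hs.1) hx₀
    (mem_trans_source (ht.2.1 ▸ hsub hx₀) (hs.2.1 ▸ hsub h1))
    (by
      rw [OpenPartialHomeomorph.trans_apply, ← htb hx₀, ← hsa hb]
      exact hM.half_subset_ball hab)
  rwa [hM.mul_unique (c := c) hab]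
  refine hce.trans ?_
  filter_upwards [isOpen_ball.mem_nhds hx₀,
    (hM.continuousAt_apply b hx₀) (isOpen_ball.mem_nhds hb)] with z hz hbz
  rw [OpenPartialHomeomorph.trans_apply, Function.comp_apply, ← htb hz, ← hsa hbz]

end IsRigidModel

end LimSpace

end Molino

namespace Molino
open Filter Metric

/-! ### The local group -/

section LocalGroups

variable {G : Type u} [TopologicalSpace G]

theorem LocalGroupOps.ActsByLeftTranslations.exists_isPsi {L : LocalGroupOps G}
    (hL : L.ActsByLeftTranslations) (hinv : ∀ a, L.inv (L.inv a) = a) : ∃ O, L.IsPsi O := by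
  obtain ⟨u, v, hu, hv, heu, hev, huv⟩ := isOpen_prod_iff.1 hL.isOpen_mulDom L.e L.e (hL.e_mul _).1
  have hinve : L.inv L.e = L.e := by
    rw [← (hL.mul_e (L.inv L.e)).2]
    exact (hL.inv_mul L.e).2
  -- Products of points of `O'` are defined; intersecting with the preimage under inversion makes
  -- the neighborhood symmetric.
  set O' := u ∩ v with hO'
  set O := O' ∩ L.inv ⁻¹' O' with hO
  have hO'o : IsOpen O' := hu.inter hv
  have hprod : O ×ˢ O ⊆ L.mulDom := fun p hp => huv ⟨hp.1.1.1, hp.2.1.2⟩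
  have heO' : L.e ∈ O' := ⟨heu, hev⟩
  exact ⟨O,
    { isOpen := hO'o.inter (hO'o.preimage hL.continuous_inv)
      e_mem := ⟨heO', by rw [mem_preimage, hinve]; exact heO'⟩
      prod_subset := hprod
      subset_invDom := fun a _ => hL.mem_invDom a
      assoc := fun a ha b hb c hc hab hbc => hL.assoc a b c (hprod ⟨ha, hb⟩) (hprod ⟨hab, hc⟩)
        (hprod ⟨hb, hc⟩) (hprod ⟨ha, hbc⟩)
      inv_mem := fun a ha => ⟨ha.2, by rw [mem_preimage, hinv]; exact ha.1⟩
      mul_e := fun a _ => (hL.mul_e a).2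
      e_mul := fun a _ => (hL.e_mul a).2
      inv_mul := fun a _ => (hL.inv_mul a).2
      mul_inv := fun a _ => (hL.mul_inv a).2
      continuousOn_mul := hL.continuousOn_mul.mono hprod
      continuousOn_inv := hL.continuous_inv.continuousOn }⟩

/-- A subset that is closed under the operations is a sub-local group. -/
theorem LocalGroupOps.IsLocalGroup.isSubLocalGroup {L : LocalGroupOps G} (hL : L.IsLocalGroup)
    {Γ : Set G} (he : L.e ∈ Γ) (hmul : ∀ a ∈ Γ, ∀ b ∈ Γ, (a, b) ∈ L.mulDom → L.mul a b ∈ Γ)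
    (hinv : ∀ a ∈ Γ, L.inv a ∈ Γ) : L.IsSubLocalGroup Γ := by
  obtain ⟨O, hO⟩ := hL.exists_psi
  have hm : ∀ a b : Γ, (a : G) ∈ O → (b : G) ∈ O → L.mul a b ∈ Γ := fun a b ha hb =>
    hmul a a.2 b b.2 (hO.prod_subset ⟨ha, hb⟩)
  have hcm : ∀ a b : Γ, (a : G) ∈ O → (b : G) ∈ O →
      (((L.induced Γ he).mul a b : Γ) : G) = L.mul a b := fun a b ha hb => by
    simp only [LocalGroupOps.induced, dif_pos (hm a b ha hb)]
  have hci : ∀ a : Γ, (((L.induced Γ he).inv a : Γ) : G) = L.inv a := fun a => by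
    simp only [LocalGroupOps.induced, dif_pos (hinv a a.2)]
  have hce : (((L.induced Γ he).e : Γ) : G) = L.e := rfl
  refine ⟨he, ⟨Subtype.val ⁻¹' O, ?_⟩, ?_⟩
  · refine
      { isOpen := hO.isOpen.preimage continuous_subtype_val
        e_mem := hO.e_mem
        prod_subset := fun p hp => ⟨hO.prod_subset ⟨hp.1, hp.2⟩, hm _ _ hp.1 hp.2⟩
        subset_invDom := fun a ha => ⟨hO.subset_invDom ha, hinv a a.2⟩
        assoc := fun a ha b hb c hc hab hbc => Subtype.ext ?_
        inv_mem := fun a ha => ?_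
        mul_e := fun a ha => Subtype.ext ?_
        e_mul := fun a ha => Subtype.ext ?_
        inv_mul := fun a ha => Subtype.ext ?_
        mul_inv := fun a ha => Subtype.ext ?_
        continuousOn_mul := ?_
        continuousOn_inv := ?_ }
    · rw [hcm _ _ hab hc, hcm _ _ ha hbc, hcm _ _ ha hb, hcm _ _ hb hc]
      rw [mem_preimage, hcm _ _ ha hb] at hab
      rw [mem_preimage, hcm _ _ hb hc] at hbc
      exact hO.assoc a ha b hb c hc hab hbc
    · rw [mem_preimage, hci]
      exact hO.inv_mem a ha
    · rw [hcm _ _ ha hO.e_mem]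
      exact hO.mul_e a ha
    · rw [hcm _ _ hO.e_mem ha]
      exact hO.e_mul a ha
    · rw [hcm _ _ (by rw [hci]; exact hO.inv_mem a ha) ha, hci]
      exact hO.inv_mul a ha
    · rw [hcm _ _ ha (by rw [hci]; exact hO.inv_mem a ha), hci]
      exact hO.mul_inv a ha
    · rw [IsInducing.subtypeVal.continuousOn_iff]
      have h1 : ContinuousOn (fun p : Γ × Γ => L.mul p.1 p.2)
          ((Subtype.val ⁻¹' O) ×ˢ (Subtype.val ⁻¹' O)) :=
        hO.continuousOn_mul.comp (f := fun p : Γ × Γ => ((p.1 : G), (p.2 : G)))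
          (by fun_prop) (fun p hp => ⟨hp.1, hp.2⟩)
      exact h1.congr fun p hp => hcm _ _ hp.1 hp.2
    · rw [IsInducing.subtypeVal.continuousOn_iff]
      have h1 : ContinuousOn (fun a : Γ => L.inv a) (Subtype.val ⁻¹' O) :=
        hO.continuousOn_inv.comp continuous_subtype_val.continuousOn (fun a ha => ha)
      exact h1.congr fun a _ => hci a
  · have := hL.isClosed_e.preimage (continuous_subtype_val (p := fun x => x ∈ Γ))
    convert this using 1
    ext a
    simp only [mem_singleton_iff, mem_preimage, Subtype.ext_iff, hce]

end LocalGroups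

/-! ### The underlying space of the local group and its dense part -/

noncomputable section Carrier

variable {T : Type u} [MetricSpace T] {S : Set (Loct T)} {x₀ : T} {R ρ r : ℝ}

/-- The conditions on the set of admissible pairs `(a x₀, a⁻¹ x₀)`. -/
structure IsGauge (x₀ : T) (r : ℝ) (Ω : Set (T × T)) : Prop where
  isOpen : IsOpen Ω
  subset : Ω ⊆ ball x₀ r ×ˢ ball x₀ r
  center : (x₀, x₀) ∈ Ω
  swap : ∀ p q, (p, q) ∈ Ω → (q, p) ∈ Ω

namespace IsRigidModel

variable {Ω : Set (T × T)}

/-- The elements `a` with admissible pair `(a x₀, a⁻¹ x₀)`. -/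
def carrier (hM : IsRigidModel S x₀ R ρ r) (Ω : Set (T × T)) : Set (LimSpace S x₀ R ρ r) :=
  {a | (a.1 x₀, (hM.inv a).1 x₀) ∈ Ω}

theorem apply_mem (hM : IsRigidModel S x₀ R ρ r) (hΩ : IsGauge x₀ r Ω)
    {a : LimSpace S x₀ R ρ r} (ha : a ∈ hM.carrier Ω) : a.1 x₀ ∈ ball x₀ r := (hΩ.subset ha).1

theorem inv_apply_mem (hM : IsRigidModel S x₀ R ρ r) (hΩ : IsGauge x₀ r Ω)
    {a : LimSpace S x₀ R ρ r} (ha : a ∈ hM.carrier Ω) : (hM.inv a).1 x₀ ∈ ball x₀ r :=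
  (hΩ.subset ha).2

/-- The displacement is less than ρ/8 + r ≤ ρ/4. Hence the product of any two elements of the
carrier is a genuine composite, even if it is not in the carrier. -/
theorem apply_apply_mem (hM : IsRigidModel S x₀ R ρ r) (hΩ : IsGauge x₀ r Ω)
    {a b : LimSpace S x₀ R ρ r} (ha : a ∈ hM.carrier Ω) (hb : b.1 x₀ ∈ ball x₀ r) :
    a.1 (b.1 x₀) ∈ ball x₀ (ρ / 2) := by
  have h1 := hM.dist_apply_le a hb hM.center_mem_ball
  have h2 := hM.apply_mem hΩ ha
  rw [mem_ball] at h2 ⊢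
  linarith [dist_triangle (a.1 (b.1 x₀)) (a.1 x₀) x₀, hM.r_le, hM.pos]

theorem isOpen_carrier (hM : IsRigidModel S x₀ R ρ r) (hΩ : IsGauge x₀ r Ω) :
    IsOpen (hM.carrier Ω) := by
  rw [isOpen_iff_mem_nhds]
  intro a ha
  have h1 : ContinuousAt (fun b : LimSpace S x₀ R ρ r => (b.1 x₀, (hM.inv b).1 x₀)) a :=
    (LimSpace.continuous_eval x₀).continuousAt.prodMk
      ((LimSpace.continuous_eval x₀).continuousAt.comp (hM.continuousAt_inv (hM.apply_mem hΩ ha)))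
  exact h1 (hΩ.isOpen.mem_nhds ha)

theorem one_mem_carrier (hM : IsRigidModel S x₀ R ρ r) (hΩ : IsGauge x₀ r Ω) :
    hM.one ∈ hM.carrier Ω := by
  change (hM.one.1 x₀, (hM.inv hM.one).1 x₀) ∈ Ω
  rw [hM.inv_one, hM.one_apply hM.center_mem_ball]
  exact hΩ.center

theorem inv_mem_carrier (hM : IsRigidModel S x₀ R ρ r) (hΩ : IsGauge x₀ r Ω)
    {a : LimSpace S x₀ R ρ r} (ha : a ∈ hM.carrier Ω) : hM.inv a ∈ hM.carrier Ω := by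
  change ((hM.inv a).1 x₀, (hM.inv (hM.inv a)).1 x₀) ∈ Ω
  rw [hM.inv_inv (hM.apply_mem hΩ ha) (hM.inv_apply_mem hΩ ha)]
  exact hΩ.swap _ _ ha

open Classical in
/-- The local group operations on the carrier. -/
def ops (hM : IsRigidModel S x₀ R ρ r) (hΩ : IsGauge x₀ r Ω) : LocalGroupOps (hM.carrier Ω) where
  e := ⟨hM.one, hM.one_mem_carrier hΩ⟩
  mulDom := {p | hM.mul p.1.1 p.2.1 ∈ hM.carrier Ω}
  mul a b := if h : hM.mul a.1 b.1 ∈ hM.carrier Ω then ⟨_, h⟩ else ⟨hM.one, hM.one_mem_carrier hΩ⟩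
  invDom := univ
  inv a := ⟨hM.inv a.1, hM.inv_mem_carrier hΩ a.2⟩

theorem ops_mul (hM : IsRigidModel S x₀ R ρ r) (hΩ : IsGauge x₀ r Ω) {a b : hM.carrier Ω}
    (h : (a, b) ∈ (hM.ops hΩ).mulDom) : ((hM.ops hΩ).mul a b).1 = hM.mul a.1 b.1 := by
  have h' : hM.mul a.1 b.1 ∈ hM.carrier Ω := h
  simp only [ops, dif_pos h']

theorem apply_apply_mem_of_mul_mem (hM : IsRigidModel S x₀ R ρ r) (hΩ : IsGauge x₀ r Ω)
    {a b : LimSpace S x₀ R ρ r} (ha : a ∈ hM.carrier Ω) (hb : b ∈ hM.carrier Ω)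
    (hab : hM.mul a b ∈ hM.carrier Ω) : a.1 (b.1 x₀) ∈ ball x₀ r := by
  have := hM.apply_mem hΩ hab
  rwa [hM.mul_apply_center (hM.apply_mem hΩ hb)
    (hM.apply_apply_mem hΩ ha (hM.apply_mem hΩ hb))] at this

/-- Composition is continuous on all pairs of elements of the carrier, and a product is undefined
only when it leaves the carrier. So the domain of the product is the preimage of an open set, and
the laws reduce to identities of germs at `x₀`. -/
theorem actsByLeftTranslations (hM : IsRigidModel S x₀ R ρ r) (hΩ : IsGauge x₀ r Ω) :
    (hM.ops hΩ).ActsByLeftTranslations := by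
  have hmem : ∀ a : hM.carrier Ω, a.1.1 x₀ ∈ ball x₀ r := fun a => hM.apply_mem hΩ a.2
  have hmem' : ∀ a : hM.carrier Ω, (hM.inv a.1).1 x₀ ∈ ball x₀ r := fun a =>
    hM.inv_apply_mem hΩ a.2
  have hcont : Continuous fun p : hM.carrier Ω × hM.carrier Ω => hM.mul p.1.1 p.2.1 := by
    rw [continuous_iff_continuousAt]
    intro p
    exact (hM.continuousAt_mul (hmem p.2) (hM.apply_apply_mem hΩ p.1.2 (hmem p.2))).comp
      (f := fun p : hM.carrier Ω × hM.carrier Ω => (p.1.1, p.2.1)) (by fun_prop)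
  have hcancel : ∀ a b : hM.carrier Ω, (a, b) ∈ (hM.ops hΩ).mulDom →
      hM.mul (hM.inv a.1) (hM.mul a.1 b.1) = b.1 := fun a b hab =>
    hM.inv_mul_cancel_left (hmem a) (hmem b) (hM.apply_apply_mem_of_mul_mem hΩ a.2 b.2 hab)
  have of_eq : ∀ a b c : hM.carrier Ω, hM.mul a.1 b.1 = c.1 →
      (a, b) ∈ (hM.ops hΩ).mulDom ∧ (hM.ops hΩ).mul a b = c := by
    intro a b c h
    have h1 : (a, b) ∈ (hM.ops hΩ).mulDom := by
      change hM.mul a.1 b.1 ∈ hM.carrier Ω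
      rw [h]
      exact c.2
    exact ⟨h1, Subtype.ext ((hM.ops_mul hΩ h1).trans h)⟩
  refine
    { isOpen_mulDom := (hM.isOpen_carrier hΩ).preimage hcont
      continuousOn_mul := ?_
      e_mul := fun a => of_eq _ _ _ (hM.one_mul (hmem a))
      mul_e := fun a => of_eq _ _ _ (hM.mul_one (hmem a))
      assoc := fun a b c hab habc hbc habc' => Subtype.ext ?_
      mem_invDom := fun a => mem_univ a
      continuous_inv := ?_
      inv_mul := fun a => of_eq _ _ _ (hM.inv_mul_self (hmem a))
      mul_inv := fun a => of_eq _ _ _ (hM.mul_inv_self (hmem a) (hmem' a))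
      inv_mul_mem := fun a b hab => (of_eq _ _ b ?_).1 }
  · rw [IsInducing.subtypeVal.continuousOn_iff]
    exact hcont.continuousOn.congr fun p hp => hM.ops_mul hΩ hp
  · rw [hM.ops_mul hΩ habc, hM.ops_mul hΩ habc', hM.ops_mul hΩ hab, hM.ops_mul hΩ hbc]
    have h1 := hM.apply_apply_mem_of_mul_mem hΩ a.2 b.2 hab
    have h2 := hM.apply_apply_mem_of_mul_mem hΩ b.2 c.2 hbc
    refine hM.mul_assoc (hmem b) h1 (hmem c) h2 ?_
    have h3 := hM.apply_apply_mem_of_mul_mem hΩ a.2 ((hM.ops hΩ).mul b c).2 habc'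
    rwa [hM.ops_mul hΩ hbc, hM.mul_apply_center (hmem c) (hM.ball_subset_half h2)] at h3
  · refine Continuous.subtype_mk (continuous_iff_continuousAt.2 fun a => ?_) _
    exact (hM.continuousAt_inv (hmem a)).comp continuous_subtype_val.continuousAt
  · rw [hM.ops_mul hΩ hab]
    exact hcancel a b hab

theorem isLocalGroup (hM : IsRigidModel S x₀ R ρ r) (hΩ : IsGauge x₀ r Ω) :
    (hM.ops hΩ).IsLocalGroup :=
  ⟨(hM.actsByLeftTranslations hΩ).exists_isPsi fun a =>
    Subtype.ext (hM.inv_inv (hM.apply_mem hΩ a.2) (hM.inv_apply_mem hΩ a.2)), isClosed_singleton⟩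

/-- The elements of the carrier given by elements of `S`. -/
def gamma (hM : IsRigidModel S x₀ R ρ r) (Ω : Set (T × T)) : Set (hM.carrier Ω) :=
  Subtype.val ⁻¹' discretePart S x₀ R ρ r

theorem dense_gamma (hM : IsRigidModel S x₀ R ρ r) (hΩ : IsGauge x₀ r Ω) :
    Dense (hM.gamma Ω) :=
  hM.dense_discretePart.preimage (hM.isOpen_carrier hΩ).isOpenMap_subtype_val

theorem mul_mem_gamma (hM : IsRigidModel S x₀ R ρ r) (hΩ : IsGauge x₀ r Ω) {a b : hM.carrier Ω}
    (ha : a ∈ hM.gamma Ω) (hb : b ∈ hM.gamma Ω) (hab : (a, b) ∈ (hM.ops hΩ).mulDom) :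
    (hM.ops hΩ).mul a b ∈ hM.gamma Ω := by
  change ((hM.ops hΩ).mul a b).1 ∈ discretePart S x₀ R ρ r
  rw [hM.ops_mul hΩ hab]
  exact hM.mul_mem_discretePart (hM.apply_mem hΩ b.2)
    (hM.apply_apply_mem hΩ a.2 (hM.apply_mem hΩ b.2)) ha hb

theorem inv_mem_gamma (hM : IsRigidModel S x₀ R ρ r) (hΩ : IsGauge x₀ r Ω) {a : hM.carrier Ω}
    (ha : a ∈ hM.gamma Ω) : (hM.ops hΩ).inv a ∈ hM.gamma Ω :=
  hM.inv_mem_discretePart (hM.apply_mem hΩ a.2) ha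

theorem isSubLocalGroup_gamma (hM : IsRigidModel S x₀ R ρ r) (hΩ : IsGauge x₀ r Ω) :
    (hM.ops hΩ).IsSubLocalGroup (hM.gamma Ω) :=
  (hM.isLocalGroup hΩ).isSubLocalGroup hM.one_mem_discretePart
    (fun _ ha _ hb hab => hM.mul_mem_gamma hΩ ha hb hab) (fun _ ha => hM.inv_mem_gamma hΩ ha)

theorem locallyCompactSpace_carrier (hM : IsRigidModel S x₀ R ρ r) (hΩ : IsGauge x₀ r Ω) :
    LocallyCompactSpace (hM.carrier Ω) := by
  have := hM.compactSpace
  exact (hM.isOpen_carrier hΩ).locallyCompactSpace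

theorem polishSpace_carrier [PolishSpace T] (hM : IsRigidModel S x₀ R ρ r)
    (hΩ : IsGauge x₀ r Ω) : PolishSpace (hM.carrier Ω) := by
  have := hM.polishSpace
  exact (hM.isOpen_carrier hΩ).polishSpace

end IsRigidModel

end Carrier

end Molino

namespace Molino
open Filter

/-! ### The topology of the space of germs and the maps induced on it -/

noncomputable section Hats

variable {T : Type u} [TopologicalSpace T] {S : Set (Loct T)} {x₀ : T}

theorem germ_eq_germ_iff {f g : Loct T} {x y : T} {hx : x ∈ f.source} {hy : y ∈ g.source} :
    germ f x hx = germ g y hy ↔ x = y ∧ f =ᶠ[𝓝 x] g :=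
  Quotient.eq (r := germSetoid T)

theorem germ_congr {f g : Loct T} {x : T} (hx : x ∈ f.source) (hx' : x ∈ g.source)
    (h : f =ᶠ[𝓝 x] g) : germ f x hx = germ g x hx' := germ_eq_germ_iff.2 ⟨rfl, h⟩

theorem exists_eq_germ (γ : LoctGerm T) : ∃ (g : Loct T) (x : T) (hx : x ∈ g.source),
    γ = germ g x hx := by
  induction γ using Quotient.inductionOn with
  | h p => exact ⟨p.1.1, p.1.2, p.2, rfl⟩

open Classical in
/-- The germ of `g h⁻¹` at `h x`, for the germ of `g` at `x ∈ dom h`; other germs are fixed. -/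
def LoctGerm.pre (h : Loct T) : LoctGerm T → LoctGerm T :=
  Quotient.lift (fun p : Pointed T => if hp : p.1.2 ∈ h.source then
    germ (h.symm.trans p.1.1) (h p.1.2)
      (mem_trans_source (h.map_source hp) (by rw [h.left_inv hp]; exact p.2))
    else germ p.1.1 p.1.2 p.2) (by
      rintro ⟨⟨f, x⟩, hx⟩ ⟨⟨g, y⟩, hy⟩ ⟨hxy, hfg⟩
      simp only at hxy hfg hx hy ⊢
      subst hxy
      by_cases hxh : x ∈ h.source
      · rw [dif_pos hxh, dif_pos hxh]
        refine germ_congr _ _ (eventuallyEq_trans (h.map_source hxh) EventuallyEq.rfl ?_)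
        rwa [h.left_inv hxh]
      · rw [dif_neg hxh, dif_neg hxh]
        exact germ_congr _ _ hfg)

theorem pre_germ {h g : Loct T} {x : T} (hg : x ∈ g.source) (hh : x ∈ h.source) :
    (germ g x hg).pre h = germ (h.symm.trans g) (h x)
      (mem_trans_source (h.map_source hh) (by rw [h.left_inv hh]; exact hg)) :=
  dif_pos hh

theorem pre_of_notMem {h : Loct T} {γ : LoctGerm T} (hγ : γ.src ∉ h.source) : γ.pre h = γ := by
  obtain ⟨g, x, hx, rfl⟩ := exists_eq_germ γ
  exact dif_neg hγ

theorem src_pre {h : Loct T} {γ : LoctGerm T} (hγ : γ.src ∈ h.source) :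
    (γ.pre h).src = h γ.src := by
  obtain ⟨g, x, hx, rfl⟩ := exists_eq_germ γ
  rw [pre_germ hx hγ]
  rfl

theorem tgt_pre (h : Loct T) (γ : LoctGerm T) : (γ.pre h).tgt = γ.tgt := by
  by_cases hγ : γ.src ∈ h.source
  · obtain ⟨g, x, hx, rfl⟩ := exists_eq_germ γ
    rw [pre_germ hx hγ]
    change g (h.symm (h x)) = g x
    have hxh : x ∈ h.source := hγ
    rw [h.left_inv hxh]
  · rw [pre_of_notMem hγ]

theorem pre_symm_pre {h : Loct T} {γ : LoctGerm T} (hγ : γ.src ∈ h.source) :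
    (γ.pre h).pre h.symm = γ := by
  obtain ⟨g, x, hx, rfl⟩ := exists_eq_germ γ
  have hxh : x ∈ h.source := hγ
  rw [pre_germ hx hxh, pre_germ _ (h.map_source hxh), germ_eq_germ_iff]
  refine ⟨h.left_inv hxh, ?_⟩
  rw [h.left_inv hxh]
  filter_upwards [h.open_source.mem_nhds hxh] with y hy
  simp [h.left_inv hy]

theorem pre_trans {h k : Loct T} {γ : LoctGerm T} (hγ : γ.src ∈ h.source)
    (hγ' : h γ.src ∈ k.source) : γ.pre (h.trans k) = (γ.pre h).pre k := by
  obtain ⟨g, x, hx, rfl⟩ := exists_eq_germ γ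
  have hxh : x ∈ h.source := hγ
  have hxk : h x ∈ k.source := hγ'
  rw [pre_germ hx (mem_trans_source hxh hxk), pre_germ hx hxh, pre_germ _ hxk]
  exact germ_congr _ _ EventuallyEq.rfl

/-- Composition with the fixed map `h` on the right is continuous for the compact-open topology and
preserves `S`. -/
theorem trans_mem_starClosure (hS : IsLocalPseudoStarGroup S) {h g : Loct T} (hh : h ∈ S)
    (hg : g ∈ starClosure S) : h.trans g ∈ starClosure S := by
  let j : C((h.trans g).source, g.source) :=
    ⟨fun x => ⟨h x, x.2.2⟩, ((h.continuousOn.mono fun x hx => hx.1).domRestrict).subtype_mk _⟩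
  refine map_mem_closure (ContinuousMap.continuous_precomp j) hg ?_
  rintro k ⟨s, hs, hsg, hks⟩
  refine ⟨h.trans s, hS.comp_mem h hh s hs, ?_, fun x => hks (j x)⟩
  rw [OpenPartialHomeomorph.trans_source, OpenPartialHomeomorph.trans_source, hsg]

theorem HatT.exists_starProd (γ : HatT S) : ∃ p : StarProd S, germMap S p = γ := by
  obtain ⟨γ, f, hf, x, hx, rfl⟩ := γ
  obtain ⟨O, hO, hxO, hOf, hmem⟩ := hf x hx
  exact ⟨⟨(f.restrOpen O hO, x), hmem, ⟨hx, hxO⟩⟩,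
    Subtype.ext (germ_congr _ _ EventuallyEq.rfl)⟩

/-- The composite of a pointed local transformation with the inverse of an element of `S`. -/
def StarProd.pre (hS : IsLocalPseudoStarGroup S) {h : Loct T} (hh : h ∈ S) (p : StarProd S)
    (hp : p.1.2 ∈ h.source) : StarProd S :=
  ⟨(h.symm.trans p.1.1, h p.1.2), trans_mem_starClosure hS (hS.symm_mem h hh) p.2.1,
    mem_trans_source (h.map_source hp) (by rw [h.left_inv hp]; exact p.2.2)⟩

theorem germMap_pre (hS : IsLocalPseudoStarGroup S) {h : Loct T} (hh : h ∈ S) (p : StarProd S)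
    (hp : p.1.2 ∈ h.source) : (germMap S (p.pre hS hh hp)).1 = (germMap S p).1.pre h :=
  (pre_germ p.2.2 hp).symm

theorem tendsto_starProd {α : Type*} {l : Filter α} {F : α → StarProd S} {p : StarProd S}
    (h1 : ∀ K O : Set T, IsCompact K → IsOpen O → K ⊆ p.1.1.source → MapsTo p.1.1 K O →
      ∀ᶠ i in l, K ⊆ (F i).1.1.source ∧ MapsTo (F i).1.1 K O)
    (h2 : Tendsto (fun i => (F i).1.2) l (𝓝 p.1.2)) : Tendsto F l (𝓝 p) := by
  let _ : TopologicalSpace (Loct T) := compactOpen T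
  have h3 : Tendsto (fun i => (F i).1.1) l (𝓝 p.1.1) := by
    rw [tendsto_nhds_generateFrom_iff]
    rintro _ ⟨K, O, hK, hO, rfl⟩ hp
    filter_upwards [h1 K O hK hO hp.1 (mapsTo_iff_image_subset.2 hp.2)] with i hi
    exact ⟨hi.1, mapsTo_iff_image_subset.1 hi.2⟩
  have h4 : Tendsto (fun i => (F i).1) l (𝓝 p.1) := h3.prodMk_nhds h2
  rw [nhds_induced, tendsto_comap_iff]
  exact h4

theorem eventually_starProd {p : StarProd S} {K O : Set T} (hK : IsCompact K) (hO : IsOpen O)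
    (hKp : K ⊆ p.1.1.source) (hKO : MapsTo p.1.1 K O) :
    ∀ᶠ p' in 𝓝 p, K ⊆ p'.1.1.source ∧ MapsTo p'.1.1 K O := by
  let _ : TopologicalSpace (Loct T) := compactOpen T
  have h1 : Continuous fun p : StarProd S => p.1 := continuous_induced_dom
  have h2 : Continuous fun p : StarProd S => p.1.1 := continuous_fst.comp h1
  have h3 : IsOpen {h : Loct T | K ⊆ h.source ∧ h '' K ⊆ O} :=
    isOpen_generateFrom_of_mem ⟨K, O, hK, hO, rfl⟩
  filter_upwards [(h3.preimage h2).mem_nhds ⟨hKp, mapsTo_iff_image_subset.1 hKO⟩] with p' hp'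
  exact ⟨hp'.1, mapsTo_iff_image_subset.2 hp'.2⟩

theorem continuous_starProd_snd : Continuous fun p : StarProd S => p.1.2 := by
  let _ : TopologicalSpace (Loct T) := compactOpen T
  have h1 : Continuous fun p : StarProd S => p.1 := continuous_induced_dom
  exact continuous_snd.comp h1

theorem tendsto_starProd_apply {p : StarProd S} {z : T} (hz : z ∈ p.1.1.source) :
    Tendsto (fun p' : StarProd S => p'.1.1 z) (𝓝 p) (𝓝 (p.1.1 z)) := by
  intro O hO
  obtain ⟨O', hO', hO'o, hzO⟩ := mem_nhds_iff.1 hO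
  rw [mem_map]
  filter_upwards [eventually_starProd (isCompact_singleton (x := z)) hO'o
    (singleton_subset_iff.2 hz) (by simpa [MapsTo] using hzO)] with p' hp'
  exact hO' (hp'.2 rfl)

theorem eventually_mem_source {p : StarProd S} {z : T} (hz : z ∈ p.1.1.source) :
    ∀ᶠ p' : StarProd S in 𝓝 p, z ∈ p'.1.1.source := by
  filter_upwards [eventually_starProd (isCompact_singleton (x := z)) isOpen_univ
    (singleton_subset_iff.2 hz) (mapsTo_univ _ _)] with p' hp'
  exact hp'.1 rfl

theorem continuous_starProd_tgt [LocallyCompactSpace T] :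
    Continuous fun p : StarProd S => p.1.1 p.1.2 := by
  rw [continuous_iff_continuousAt]
  intro p O hO
  obtain ⟨O', hO', hO'o, hpO⟩ := mem_nhds_iff.1 hO
  have hN : p.1.1.source ∩ p.1.1 ⁻¹' O' ∈ 𝓝 p.1.2 :=
    (p.1.1.isOpen_inter_preimage hO'o).mem_nhds ⟨p.2.2, hpO⟩
  obtain ⟨C, hC, hCN, hCc⟩ := local_compact_nhds hN
  rw [mem_map]
  filter_upwards [eventually_starProd hCc hO'o (fun y hy => (hCN hy).1) (fun y hy => (hCN hy).2),
    continuous_starProd_snd.tendsto p hC] with p' h1 h2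
  exact hO' (h1.2 h2)

theorem continuous_germMap : Continuous (germMap S) := continuous_coinduced_rng

/-- The universal property of the quotient topology, over an open set: continuity can be tested on
representatives. -/
theorem continuousOn_hatT {Y : Type*} [TopologicalSpace Y] {U : Set (HatT S)} (hU : IsOpen U)
    {F : HatT S → Y} (h : ∀ p, germMap S p ∈ U → ContinuousAt (F ∘ germMap S) p) :
    ContinuousOn F U := by
  rw [continuousOn_open_iff hU]
  intro t ht
  refine isOpen_coinduced.2 (isOpen_iff_mem_nhds.2 fun p hp => ?_)
  filter_upwards [(hU.preimage continuous_germMap).mem_nhds hp.1, h p hp.1 (ht.mem_nhds hp.2)]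
    with p' h1 h2
  exact ⟨h1, h2⟩

theorem continuous_src : Continuous fun γ : HatT S => γ.1.src :=
  continuous_coinduced_dom.2 continuous_starProd_snd

theorem continuous_tgt [LocallyCompactSpace T] : Continuous fun γ : HatT S => γ.1.tgt :=
  continuous_coinduced_dom.2 continuous_starProd_tgt

theorem continuous_hatProj : Continuous (hatProj S x₀) :=
  continuous_src.comp continuous_subtype_val

/-- The map `γ(g, x) ↦ γ(g h⁻¹, h x)` for `h ∈ S`. -/
def HatT.pre (hS : IsLocalPseudoStarGroup S) {h : Loct T} (hh : h ∈ S) (γ : HatT S) : HatT S :=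
  ⟨γ.1.pre h, by
    obtain ⟨p, rfl⟩ := γ.exists_starProd
    by_cases hp : p.1.2 ∈ h.source
    · rw [← germMap_pre hS hh p hp]
      exact (germMap S _).2
    · rw [pre_of_notMem hp]
      exact (germMap S p).2⟩

theorem continuousOn_pre (hS : IsLocalPseudoStarGroup S) {h : Loct T} (hh : h ∈ S) :
    ContinuousOn (HatT.pre hS hh) {γ | γ.1.src ∈ h.source} := by
  refine continuousOn_hatT (h.open_source.preimage continuous_src) fun p hp => ?_
  have hp' : p.1.2 ∈ h.source := hp
  classical
  -- A lift of the map to representatives; it is left unchanged where the base point is outside the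
  -- domain of `h`, as for germs.
  let F : StarProd S → StarProd S := fun p =>
    if hp : p.1.2 ∈ h.source then p.pre hS hh hp else p
  have hF : ∀ p : StarProd S, germMap S (F p) = HatT.pre hS hh (germMap S p) := by
    intro p
    apply Subtype.ext
    by_cases hp : p.1.2 ∈ h.source
    · simp only [F, dif_pos hp]
      exact germMap_pre hS hh p hp
    · simp only [F, dif_neg hp]
      exact (pre_of_notMem hp).symm
  have hev : ∀ᶠ p' in 𝓝 p, p'.1.2 ∈ h.source :=
    continuous_starProd_snd.tendsto p (h.open_source.mem_nhds hp')
  have hFp : F p = p.pre hS hh hp' := dif_pos hp'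
  have hcF : ContinuousAt F p := by
    refine tendsto_starProd (fun K O hK hO hKs hKO => ?_) ?_
    · rw [hFp] at hKs hKO
      have hKh : K ⊆ h.target := fun y hy => (hKs hy).1
      -- For `K` in the image of `h`, the condition on `g h⁻¹` and `K` is the condition on `g` and
      -- the compact set `h⁻¹(K)`.
      have hK' : IsCompact (h.symm '' K) :=
        hK.image_of_continuousOn (h.continuousOn_symm.mono hKh)
      filter_upwards [hev, eventually_starProd (p := p) hK' hO
        (by rintro _ ⟨y, hy, rfl⟩; exact (hKs hy).2)
        (by rintro _ ⟨y, hy, rfl⟩; exact hKO hy)] with p' h1 h2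
      simp only [F, dif_pos h1]
      exact ⟨fun y hy => ⟨hKh hy, h2.1 (mem_image_of_mem _ hy)⟩,
        fun y hy => h2.2 (mem_image_of_mem _ hy)⟩
    · rw [hFp]
      have h3 : Tendsto (fun p' : StarProd S => h p'.1.2) (𝓝 p) (𝓝 (h p.1.2)) :=
        (h.continuousAt hp').tendsto.comp (continuous_starProd_snd.tendsto p)
      refine h3.congr' ?_
      filter_upwards [hev] with p' h1
      simp only [F, dif_pos h1]
      rfl
  have := continuous_germMap.continuousAt.comp hcF
  exact this.congr (Eventually.of_forall hF)

/-- The local transformation `ĥ`, for `h ∈ S`. -/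
def hatMap (hS : IsLocalPseudoStarGroup S) (x₀ : T) {h : Loct T} (hh : h ∈ S) :
    Loct (HatT₀ S x₀) where
  toFun γ := ⟨HatT.pre hS hh γ.1, (tgt_pre h γ.1.1).trans γ.2⟩
  invFun γ := ⟨HatT.pre hS (hS.symm_mem h hh) γ.1, (tgt_pre h.symm γ.1.1).trans γ.2⟩
  source := hatProj S x₀ ⁻¹' h.source
  target := hatProj S x₀ ⁻¹' h.target
  map_source' γ hγ := by
    change (γ.1.1.pre h).src ∈ h.target
    rw [src_pre hγ]
    exact h.map_source hγ
  map_target' γ hγ := by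
    change (γ.1.1.pre h.symm).src ∈ h.source
    rw [src_pre (h := h.symm) hγ]
    exact h.map_target hγ
  left_inv' γ hγ := Subtype.ext (Subtype.ext (pre_symm_pre hγ))
  right_inv' γ hγ := Subtype.ext (Subtype.ext (pre_symm_pre (h := h.symm) hγ))
  open_source := h.open_source.preimage continuous_hatProj
  open_target := h.open_target.preimage continuous_hatProj
  continuousOn_toFun := by
    refine IsInducing.subtypeVal.continuousOn_iff.2 ?_
    exact (continuousOn_pre hS hh).comp continuous_subtype_val.continuousOn fun γ hγ => hγ
  continuousOn_invFun := by
    refine IsInducing.subtypeVal.continuousOn_iff.2 ?_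
    exact (continuousOn_pre hS (hS.symm_mem h hh)).comp continuous_subtype_val.continuousOn
      fun γ hγ => hγ

theorem isHat_iff {h : Loct T} {φ : Loct (HatT₀ S x₀)} :
    IsHat S x₀ h φ ↔ φ.source = hatProj S x₀ ⁻¹' h.source ∧
      φ.target = hatProj S x₀ ⁻¹' h.target ∧
      ∀ γ ∈ φ.source, (φ γ).1.1 = γ.1.1.pre h := by
  refine and_congr_right fun h1 => and_congr_right fun _ => ⟨fun hφ γ hγ => ?_,
    fun hφ γ g x hg hh hγ => ?_⟩
  · obtain ⟨g, x, hx, hgx⟩ := exists_eq_germ γ.1.1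
    have hxh : x ∈ h.source := by
      have : γ.1.1.src ∈ h.source := (h1 ▸ hγ : γ ∈ hatProj S x₀ ⁻¹' h.source)
      rwa [hgx] at this
    rw [hφ γ g x hx hxh hgx, hgx, pre_germ hx hxh]
  · have hs : γ ∈ φ.source := by
      rw [h1]
      change γ.1.1.src ∈ h.source
      rw [hγ]
      exact hh
    rw [hφ γ hs, hγ, pre_germ hg hh]

theorem isHat_hatMap (hS : IsLocalPseudoStarGroup S) {h : Loct T} (hh : h ∈ S) :
    IsHat S x₀ h (hatMap hS x₀ hh) := isHat_iff.2 ⟨rfl, rfl, fun _ _ => rfl⟩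

theorem IsHat.symm {h : Loct T} {φ : Loct (HatT₀ S x₀)} (hφ : IsHat S x₀ h φ) :
    IsHat S x₀ h.symm φ.symm := by
  rw [isHat_iff] at hφ ⊢
  refine ⟨hφ.2.1, hφ.1, fun γ hγ => ?_⟩
  have h1 : φ.symm γ ∈ φ.source := φ.map_target hγ
  have h2 := hφ.2.2 _ h1
  rw [φ.right_inv hγ] at h2
  rw [h2, pre_symm_pre]
  rw [hφ.1] at h1
  exact h1

theorem IsHat.trans {h k : Loct T} {φ ψ : Loct (HatT₀ S x₀)} (hφ : IsHat S x₀ h φ)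
    (hψ : IsHat S x₀ k ψ) : IsHat S x₀ (h.trans k) (φ.trans ψ) := by
  -- Stated for all pairs because the condition on the target is the same fact for the inverses.
  have key : ∀ (h k : Loct T) (φ ψ : Loct (HatT₀ S x₀)), IsHat S x₀ h φ → IsHat S x₀ k ψ →
      (φ.trans ψ).source = hatProj S x₀ ⁻¹' (h.trans k).source := by
    intro h k φ ψ hφ hψ
    rw [isHat_iff] at hφ hψ
    ext γ
    have h0 : γ ∈ φ.source ↔ γ.1.1.src ∈ h.source := by rw [hφ.1]; rfl
    have h0' : φ γ ∈ ψ.source ↔ (φ γ).1.1.src ∈ k.source := by rw [hψ.1]; rfl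
    change (γ ∈ φ.source ∧ φ γ ∈ ψ.source) ↔ (γ.1.1.src ∈ h.source ∧ h γ.1.1.src ∈ k.source)
    rw [h0, h0']
    refine and_congr_right fun h1 => ?_
    rw [hφ.2.2 γ (h0.2 h1), src_pre h1]
  refine isHat_iff.2 ⟨key _ _ _ _ hφ hψ, key _ _ _ _ hψ.symm hφ.symm, fun γ hγ => ?_⟩
  have h1 : γ.1.1.src ∈ (h.trans k).source := (key _ _ _ _ hφ hψ ▸ hγ :
    γ ∈ hatProj S x₀ ⁻¹' (h.trans k).source)
  rw [isHat_iff] at hφ hψ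
  rw [pre_trans h1.1 h1.2, ← hφ.2.2 γ hγ.1]
  exact hψ.2.2 _ hγ.2

/-- The elements of `Ĥ₀` are the local transformations that are given by elements of `S` around
every point of their domains. -/
theorem mem_hatH₀_iff (hS : IsLocalPseudoStarGroup S) (hcov : ∀ x, ∃ h ∈ S, x ∈ h.source)
    {φ : Loct (HatT₀ S x₀)} : φ ∈ hatH₀ S x₀ ↔ ∀ γ ∈ φ.source, ∃ h ∈ S, γ.1.1.src ∈ h.source ∧
      ∀ᶠ γ' in 𝓝 γ, (φ γ').1.1 = γ'.1.1.pre h := by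
  rw [hatH₀, mem_generated_iff]
  · refine forall₂_congr fun γ hγ => ⟨?_, ?_⟩
    · rintro ⟨ψ, ⟨h, hh, hψ⟩, hγψ, he⟩
      rw [isHat_iff] at hψ
      refine ⟨h, hh, (hψ.1 ▸ hγψ : γ ∈ hatProj S x₀ ⁻¹' h.source), ?_⟩
      filter_upwards [he, ψ.open_source.mem_nhds hγψ] with γ' h1 h2
      rw [h1, hψ.2.2 γ' h2]
    · rintro ⟨h, hh, hγh, he⟩
      refine ⟨hatMap hS x₀ hh, ⟨h, hh, isHat_hatMap hS hh⟩, hγh, ?_⟩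
      filter_upwards [he] with γ' h1
      exact Subtype.ext (Subtype.ext h1)
  · rintro φ ⟨h, hh, hφ⟩ ψ ⟨k, hk, hψ⟩
    exact ⟨h.trans k, hS.comp_mem h hh k hk, hφ.trans hψ⟩
  · rintro φ ⟨h, hh, hφ⟩
    exact ⟨h.symm, hS.symm_mem h hh, hφ.symm⟩
  · intro γ
    obtain ⟨h, hh, hγ⟩ := hcov γ.1.1.src
    exact ⟨hatMap hS x₀ hh, ⟨h, hh, isHat_hatMap hS hh⟩, hγ⟩

theorem hatMap_mem_hatH₀ (hS : IsLocalPseudoStarGroup S) {h : Loct T} (hh : h ∈ S) :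
    hatMap hS x₀ hh ∈ hatH₀ S x₀ :=
  subset_generatedOn _ _ ⟨h, hh, isHat_hatMap hS hh⟩

end Hats

end Molino

namespace Molino
open Filter Metric

/-! ### The local group as an open subspace of the space of germs -/

noncomputable section Embedding

variable {T : Type u} [MetricSpace T] {S : Set (Loct T)} {x₀ : T} {R ρ r r₁ : ℝ}

/-- Elements of the closure of `S` that map some point of the ball of radius `ρ` into this ball
coincide with a limit. -/
theorem IsLocalModel.exists_isLim_of_mem_starClosure (hM : IsLocalModel S x₀ R ρ) {f : Loct T}
    (hf : f ∈ starClosure S) {x : T} (hxf : x ∈ f.source) (hx : x ∈ ball x₀ ρ)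
    (hfx : f x ∈ ball x₀ ρ) : ∃ τ, IsLim S x₀ R ρ τ ∧
      ∀ z ∈ f.source, z ∈ ball x₀ ρ → f z ∈ ball x₀ ρ → τ z = f z := by
  obtain ⟨l, hl, hlf⟩ := mem_closure_iff_ultrafilter.1 hf
  have hev : ∀ z : f.source, Tendsto (fun g : C(f.source, T) => g z) l (𝓝 (f z)) := fun z =>
    ((continuous_eval_const z).tendsto (toMap f)).mono_left hlf
  -- Each approximant of `f` is replaced by the extension to the ball of its germ at `x`; the limit
  -- of these extensions is the required τ.
  have hex : ∀ g : C(f.source, T),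
      ((∃ s ∈ S, s.source = f.source ∧ ∀ x : f.source, g x = s x) ∧ g ⟨x, hxf⟩ ∈ ball x₀ ρ) →
      ∃ s ∈ S, s.source = f.source ∧ (∀ x : f.source, g x = s x) ∧
        ∃ s' ∈ ballMaps S x₀ R ρ, s' =ᶠ[𝓝 x] s := by
    rintro g ⟨⟨s, hs, hsf, hgs⟩, hgx⟩
    have hsx : s x ∈ ball x₀ ρ := by
      rw [← hgs ⟨x, hxf⟩]
      exact hgx
    obtain ⟨s', hs', h1, h2, h3⟩ := hM.ext s hs x (hsf ▸ hxf) hx hsx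
    exact ⟨s, hs, hsf, hgs, s', ⟨hs', h1, h2⟩, h3⟩
  have : Nonempty (Loct T) := ⟨OpenPartialHomeomorph.refl T⟩
  choose! s hs hsf hgs s' hs' hss' using hex
  have hgood : ∀ᶠ g in (l : Filter C(f.source, T)),
      (∃ s ∈ S, s.source = f.source ∧ ∀ x : f.source, g x = s x) ∧ g ⟨x, hxf⟩ ∈ ball x₀ ρ :=
    (eventually_mem_set.2 hl).and ((hev ⟨x, hxf⟩).eventually (isOpen_ball.mem_nhds hfx))
  obtain ⟨τ, hτ, hlim⟩ := hM.exists_isLim l s' (hgood.mono hs')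
  refine ⟨τ, hτ, fun z hzf hz hfz => tendsto_nhds_unique (hlim z hz) ?_⟩
  refine (hev ⟨z, hzf⟩).congr' ?_
  filter_upwards [hgood, (hev ⟨z, hzf⟩).eventually (isOpen_ball.mem_nhds hfz)] with g hg hgz
  have h1 := hgs g hg
  rw [h1 ⟨z, hzf⟩] at hgz ⊢
  refine (hM.eq_of_eventuallyEq (hs' g hg) (hs g hg) hx ((hsf g hg).symm ▸ hxf) ?_ (hss' g hg) hz
    ((hsf g hg).symm ▸ hzf) hgz).symm
  rw [(hss' g hg).eq_of_nhds, ← h1 ⟨x, hxf⟩]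
  exact hg.2

namespace IsRigidModel

variable {Ω : Set (T × T)}

open Classical in
/-- The limit with a given germ. -/
def extend (hM : IsRigidModel S x₀ R ρ r) (γ : HatT S) : LimSpace S x₀ R ρ r :=
  if h : ∃ c : LimSpace S x₀ R ρ r, ∃ (g : Loct T) (x : T) (hx : x ∈ g.source),
    γ.1 = germ g x hx ∧ c.1 =ᶠ[𝓝 x] g then h.choose else hM.one

theorem extend_eq (hM : IsRigidModel S x₀ R ρ r) {γ : HatT S} {c : LimSpace S x₀ R ρ r}
    {g : Loct T} {x : T} (hxg : x ∈ g.source) (hγ : γ.1 = germ g x hxg) (hc : c.1 =ᶠ[𝓝 x] g)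
    (hx : x ∈ ball x₀ r) (hgx : g x ∈ ball x₀ (ρ / 2)) : hM.extend γ = c := by
  have h : ∃ c : LimSpace S x₀ R ρ r, ∃ (g : Loct T) (x : T) (hx : x ∈ g.source),
    γ.1 = germ g x hx ∧ c.1 =ᶠ[𝓝 x] g := ⟨c, g, x, hxg, hγ, hc⟩
  obtain ⟨g', x', hx', hγ', hc'⟩ := h.choose_spec
  rw [extend, dif_pos h]
  obtain ⟨rfl, hgg'⟩ := germ_eq_germ_iff.1 (hγ.symm.trans hγ')
  exact (hM.ext_of_eventuallyEq hx (hc.eq_of_nhds ▸ hgx)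
    (hc.trans (hgg'.trans hc'.symm))).symm

theorem extend_germMap (hM : IsRigidModel S x₀ R ρ r) {p : StarProd S} (hx : p.1.2 ∈ ball x₀ r)
    (hpx : p.1.1 p.1.2 ∈ ball x₀ (ρ / 2)) {z : T} (hzp : z ∈ p.1.1.source) (hz : z ∈ ball x₀ r)
    (hpz : p.1.1 z ∈ ball x₀ ρ) : (hM.extend (germMap S p)).1 z = p.1.1 z := by
  obtain ⟨τ, hτ, h⟩ := hM.exists_isLim_of_mem_starClosure p.2.1 p.2.2 (hM.ball_subset_ball hx)
    (hM.half_subset_ball hpx)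
  rw [hM.extend_eq (c := LimSpace.mk hτ) p.2.2 rfl _ hx hpx, LimSpace.mk_eqOn hτ hz]
  · exact h z hzp (hM.ball_subset_ball hz) hpz
  · filter_upwards [isOpen_ball.mem_nhds hx, p.1.1.open_source.mem_nhds p.2.2,
      (p.1.1.continuousAt p.2.2) (isOpen_ball.mem_nhds (hM.half_subset_ball hpx))] with y h1 h2 h3
    rw [LimSpace.mk_eqOn hτ h1]
    exact h y h2 (hM.ball_subset_ball h1) h3

theorem extend_eventuallyEq (hM : IsRigidModel S x₀ R ρ r) {p : StarProd S}
    (hx : p.1.2 ∈ ball x₀ r) (hpx : p.1.1 p.1.2 ∈ ball x₀ (ρ / 2)) :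
    (hM.extend (germMap S p)).1 =ᶠ[𝓝 p.1.2] p.1.1 := by
  filter_upwards [isOpen_ball.mem_nhds hx, p.1.1.open_source.mem_nhds p.2.2,
    (p.1.1.continuousAt p.2.2) (isOpen_ball.mem_nhds (hM.half_subset_ball hpx))] with y h1 h2 h3
  exact hM.extend_germMap hx hpx h2 h1 h3

/-- At a fixed point `z` near the source of the germ, the extension takes the value of the
representative, which depends continuously on it in the compact-open topology. Rigidity turns this
into convergence of the extensions. -/
theorem continuousOn_extend [LocallyCompactSpace T] (hM : IsRigidModel S x₀ R ρ r) :
    ContinuousOn hM.extend {γ : HatT S | γ.1.src ∈ ball x₀ r ∧ γ.1.tgt ∈ ball x₀ (ρ / 2)} := by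
  have hopen : IsOpen {γ : HatT S | γ.1.src ∈ ball x₀ r ∧ γ.1.tgt ∈ ball x₀ (ρ / 2)} :=
    (isOpen_ball.preimage continuous_src).inter (isOpen_ball.preimage continuous_tgt)
  refine continuousOn_hatT hopen fun p hp => ?_
  obtain ⟨hx, hpx⟩ : p.1.2 ∈ ball x₀ r ∧ p.1.1 p.1.2 ∈ ball x₀ (ρ / 2) := hp
  refine hM.tendsto_of_eventually hx ?_ ?_
  · rw [Function.comp_apply, (hM.extend_eventuallyEq hx hpx).eq_of_nhds]
    exact hpx
  · filter_upwards [isOpen_ball.mem_nhds hx, p.1.1.open_source.mem_nhds p.2.2,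
      (p.1.1.continuousAt p.2.2) (isOpen_ball.mem_nhds (hM.half_subset_ball hpx))] with z h1 h2 h3
    rw [Function.comp_apply, hM.extend_germMap hx hpx h2 h1 h3]
    refine (tendsto_starProd_apply h2).congr' ?_
    filter_upwards [eventually_mem_source h2,
      (tendsto_starProd_apply h2).eventually (isOpen_ball.mem_nhds h3),
      continuous_starProd_snd.continuousAt.eventually (isOpen_ball.mem_nhds hx),
      continuous_starProd_tgt.continuousAt.eventually (isOpen_ball.mem_nhds hpx)]
      with p' h4 h5 h6 h7
    exact (hM.extend_germMap h6 h7 h4 h1 h5).symm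

/-- An element as a local transformation of the ball of radius `r`. -/
def loct (hM : IsRigidModel S x₀ R ρ r) {a : LimSpace S x₀ R ρ r} (ha : a.1 x₀ ∈ ball x₀ r) :
    Loct T :=
  (hM.inverseIn_inv ha).loct isOpen_ball (hM.continuousOn_apply a) (hM.continuousOn_apply _)

theorem center_mem_loct_source (hM : IsRigidModel S x₀ R ρ r) {a : LimSpace S x₀ R ρ r}
    (ha : a.1 x₀ ∈ ball x₀ r) : x₀ ∈ (hM.loct ha).source := ⟨hM.center_mem_ball, ha⟩

theorem loct_symm_mem_starClosure (hM : IsRigidModel S x₀ R ρ r) {a : LimSpace S x₀ R ρ r}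
    (ha : a.1 x₀ ∈ ball x₀ r) : (hM.loct ha).symm ∈ starClosure S := by
  obtain ⟨τ, hτ, h⟩ := LimSpace.exists_isLim (hM.inv a)
  exact hM.mem_starClosure hτ (inter_subset_left.trans hM.ball_subset_ball)
    (h.mono inter_subset_left)

/-- The inverse of an element, as a pointed local transformation. -/
def starProd (hM : IsRigidModel S x₀ R ρ r) {a : LimSpace S x₀ R ρ r} (ha : a.1 x₀ ∈ ball x₀ r) :
    StarProd S :=
  ⟨((hM.loct ha).symm, a.1 x₀), hM.loct_symm_mem_starClosure ha,
    (hM.loct ha).map_source (hM.center_mem_loct_source ha)⟩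

/-- The germ of the inverse of an element `a` at `a x₀`. -/
def toHat (hM : IsRigidModel S x₀ R ρ r) (hΩ : IsGauge x₀ r Ω) (a : hM.carrier Ω) : HatT₀ S x₀ :=
  ⟨germMap S (hM.starProd (hM.apply_mem hΩ a.2)), hM.inv_apply_center (hM.apply_mem hΩ a.2)⟩

/-- The pair of the inverse of `b` and its base point `b x₀` is continuous in `b` at the level of
representatives: joint continuity of (b, z) ↦ b⁻¹ z gives the compact-open conditions uniformly over
a compact `K`. -/
theorem continuous_toHat (hM : IsRigidModel S x₀ R ρ r) (hΩ : IsGauge x₀ r Ω) :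
    Continuous (hM.toHat hΩ) := by
  refine Continuous.subtype_mk (continuous_germMap.comp (continuous_iff_continuousAt.2 fun a => ?_))
    _
  have ha := hM.apply_mem hΩ a.2
  refine tendsto_starProd (fun K O hK hO hKs hKO => ?_)
    (((LimSpace.continuous_eval x₀).comp continuous_subtype_val).tendsto a)
  have hKb : K ⊆ ball x₀ r := fun z hz => (hKs hz).1
  have hev : ∀ᶠ b : hM.carrier Ω in 𝓝 a, ∀ z ∈ K, (hM.inv b.1).1 z ∈ ball x₀ r ∩ O := by
    refine hK.eventually_forall_of_forall_eventually fun z hz => ?_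
    have h1 : ContinuousAt (fun q : hM.carrier Ω × T => (hM.inv q.1.1, q.2)) (a, z) := by
      refine ContinuousAt.prodMk ?_ continuousAt_snd
      exact ContinuousAt.comp (x := (a, z)) (f := fun q : hM.carrier Ω × T => q.1.1)
        (hM.continuousAt_inv ha) (continuous_subtype_val.comp continuous_fst).continuousAt
    have h2 : ContinuousAt (fun q : hM.carrier Ω × T => (hM.inv q.1.1).1 q.2) (a, z) :=
      ContinuousAt.comp (x := (a, z)) (f := fun q : hM.carrier Ω × T => (hM.inv q.1.1, q.2))
        (hM.eval_continuousAt (hM.inv a.1) (hKb hz)) h1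
    exact h2 ((isOpen_ball.inter hO).mem_nhds ⟨(hKs hz).2, hKO hz⟩)
  filter_upwards [hev] with b hb
  exact ⟨fun z hz => ⟨hKb hz, (hb z hz).1⟩, fun z hz => (hb z hz).2⟩

theorem extend_toHat (hM : IsRigidModel S x₀ R ρ r) (hΩ : IsGauge x₀ r Ω) (a : hM.carrier Ω) :
    hM.extend (hM.toHat hΩ a).1 = hM.inv a.1 := by
  have ha := hM.apply_mem hΩ a.2
  refine hM.extend_eq (g := (hM.loct ha).symm) (x := a.1.1 x₀) _ rfl EventuallyEq.rfl ha ?_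
  change (hM.inv a.1).1 (a.1.1 x₀) ∈ _
  rw [hM.inv_apply_center ha]
  exact hM.ball_subset_half hM.center_mem_ball

/-- The data of a germ with target `x₀` and source near `x₀`. -/
theorem extend_spec (hM : IsRigidModel S x₀ R ρ r) (hr₁ : IsScale S x₀ R ρ r r₁)
    {γ : HatT₀ S x₀} (hγ : γ.1.1.src ∈ ball x₀ r₁) :
    (hM.extend γ.1).1 x₀ ∈ ball x₀ r ∧ (hM.inv (hM.extend γ.1)).1 x₀ = γ.1.1.src ∧
      ∃ (g : Loct T) (hx : γ.1.1.src ∈ g.source), γ.1.1 = germ g γ.1.1.src hx ∧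
        (hM.extend γ.1).1 =ᶠ[𝓝 γ.1.1.src] g ∧ g γ.1.1.src = x₀ := by
  obtain ⟨γ, hγt⟩ := γ
  obtain ⟨p, rfl⟩ := γ.exists_starProd
  have hpx : p.1.1 p.1.2 = x₀ := hγt
  have hx₁ : p.1.2 ∈ ball x₀ r₁ := hγ
  have hx : p.1.2 ∈ ball x₀ r := Metric.ball_subset_ball (by linarith [hr₁.2.1, hM.r_pos]) hx₁
  have hpx' : p.1.1 p.1.2 ∈ ball x₀ (ρ / 2) := by
    rw [hpx]
    exact hM.ball_subset_half hM.center_mem_ball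
  have he := hM.extend_eventuallyEq hx hpx'
  -- The extension sends a point within `r₁` of `x₀` to `x₀`, so the scale bounds the displacement
  -- of `x₀` itself.
  have hb : (hM.extend (germMap S p)).1 x₀ ∈ ball x₀ r := by
    obtain ⟨τ, hτ, h⟩ := LimSpace.exists_isLim (hM.extend (germMap S p))
    have h1 := hr₁.2.2 τ hτ x₀ (hM.ball_subset_ball hM.center_mem_ball) p.1.2
      (hM.ball_subset_ball hx) (by rw [dist_comm]; rw [mem_ball] at hx₁; linarith [hr₁.1])
    rw [← h hM.center_mem_ball, ← h hx, he.eq_of_nhds, hpx] at h1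
    rw [mem_ball]
    linarith [hM.r_pos]
  have hbx : (hM.extend (germMap S p)).1 p.1.2 = x₀ := he.eq_of_nhds.trans hpx
  refine ⟨hb, ?_, p.1.1, p.2.2, rfl, he, hpx⟩
  have h2 := hM.inv_apply hb hx (by rw [hbx]; exact hM.center_mem_ball)
  rw [hbx] at h2
  exact h2

theorem toHat_inv_extend (hM : IsRigidModel S x₀ R ρ r) (hΩ : IsGauge x₀ r Ω)
    (hr₁ : IsScale S x₀ R ρ r r₁) {γ : HatT₀ S x₀} (hγ : γ.1.1.src ∈ ball x₀ r₁)
    (hc : hM.inv (hM.extend γ.1) ∈ hM.carrier Ω) : hM.toHat hΩ ⟨_, hc⟩ = γ := by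
  obtain ⟨hb, hinv, g, hx, hg, he, hgx⟩ := hM.extend_spec hr₁ hγ
  have hsub : ball x₀ r₁ ⊆ ball x₀ r :=
    Metric.ball_subset_ball (by linarith [hr₁.2.1, hM.r_pos])
  have h1 := hM.inv_inv hb (hinv.symm ▸ hsub hγ)
  refine Subtype.ext (Subtype.ext (Eq.trans ?_ hg.symm))
  refine germ_eq_germ_iff.2 ⟨hinv, ?_⟩
  change (hM.inv (hM.inv (hM.extend γ.1))).1 =ᶠ[𝓝 ((hM.inv (hM.extend γ.1)).1 x₀)] g
  rw [h1, hinv]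
  exact he

open Classical in
/-- The carrier as an open subspace of the space of germs with target `x₀`. -/
def embedding [LocallyCompactSpace T] (hM : IsRigidModel S x₀ R ρ r) (hΩ : IsGauge x₀ r Ω)
    (hr₁ : IsScale S x₀ R ρ r r₁) (hΩ₁ : Ω ⊆ ball x₀ r₁ ×ˢ ball x₀ r₁) :
    OpenPartialHomeomorph (hM.carrier Ω) (HatT₀ S x₀) :=
  have hcont : ContinuousOn (fun γ : HatT₀ S x₀ => hM.inv (hM.extend γ.1))
      {γ | γ.1.1.src ∈ ball x₀ r₁} := by
    intro γ hγ
    have h1 := hM.extend_spec hr₁ hγ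
    refine (ContinuousAt.comp (f := fun γ : HatT₀ S x₀ => hM.extend γ.1)
      (hM.continuousAt_inv h1.1) ?_).continuousWithinAt
    have hmem : γ.1 ∈ {γ : HatT S | γ.1.src ∈ ball x₀ r ∧ γ.1.tgt ∈ ball x₀ (ρ / 2)} :=
      ⟨Metric.ball_subset_ball (by linarith [hr₁.2.1, hM.r_pos]) hγ, by
        rw [γ.2]; exact hM.ball_subset_half hM.center_mem_ball⟩
    have hopen : IsOpen {γ : HatT S | γ.1.src ∈ ball x₀ r ∧ γ.1.tgt ∈ ball x₀ (ρ / 2)} :=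
      (isOpen_ball.preimage continuous_src).inter (isOpen_ball.preimage continuous_tgt)
    exact (hM.continuousOn_extend.continuousAt (hopen.mem_nhds hmem)).comp
      continuous_subtype_val.continuousAt
  have hopen : IsOpen {γ : HatT₀ S x₀ | γ.1.1.src ∈ ball x₀ r₁} :=
    isOpen_ball.preimage (continuous_src.comp continuous_subtype_val)
  have hmem : ∀ a : hM.carrier Ω, hM.inv (hM.extend (hM.toHat hΩ a).1) = a.1 := fun a => by
    rw [hM.extend_toHat hΩ, hM.inv_inv (hM.apply_mem hΩ a.2) (hM.inv_apply_mem hΩ a.2)]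
  { toFun := hM.toHat hΩ
    invFun := fun γ => if h : hM.inv (hM.extend γ.1) ∈ hM.carrier Ω then ⟨_, h⟩ else
      ⟨hM.one, hM.one_mem_carrier hΩ⟩
    source := univ
    -- Over the ball of radius `r₁`, extending and inverting is continuous, so the condition that
    -- the result be in the open carrier is open.
    target := {γ | γ.1.1.src ∈ ball x₀ r₁} ∩ (fun γ => hM.inv (hM.extend γ.1)) ⁻¹' hM.carrier Ω
    map_source' := fun a _ => ⟨(hΩ₁ a.2).1, by rw [mem_preimage, hmem]; exact a.2⟩
    map_target' := fun _ _ => mem_univ _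
    left_inv' := fun a _ => by
      rw [dif_pos (by rw [hmem]; exact a.2)]
      exact Subtype.ext (hmem a)
    right_inv' := fun γ hγ => by
      have h : hM.inv (hM.extend γ.1) ∈ hM.carrier Ω := hγ.2
      simp only [dif_pos h]
      exact hM.toHat_inv_extend hΩ hr₁ hγ.1 h
    open_source := isOpen_univ
    open_target := hcont.isOpen_inter_preimage hopen (hM.isOpen_carrier hΩ)
    continuousOn_toFun := (hM.continuous_toHat hΩ).continuousOn
    continuousOn_invFun := by
      rw [IsInducing.subtypeVal.continuousOn_iff]
      refine (hcont.mono inter_subset_left).congr fun γ hγ => ?_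
      have h : hM.inv (hM.extend γ.1) ∈ hM.carrier Ω := hγ.2
      simp only [Function.comp_apply, dif_pos h] }

/-- The germ b⁻¹s⁻¹ is the germ of (sb)⁻¹, and equality of germs of inverses is equality of germs.
This identifies ŝ with composition by `s` on the left. -/
theorem toHat_pre_iff (hM : IsRigidModel S x₀ R ρ r) (hΩ : IsGauge x₀ r Ω) {s : Loct T}
    {b c : hM.carrier Ω} (hbs : b.1.1 x₀ ∈ s.source) :
    (hM.toHat hΩ b).1.1.pre s = (hM.toHat hΩ c).1.1 ↔ c.1.1 =ᶠ[𝓝 x₀] s ∘ b.1.1 := by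
  have hb := hM.apply_mem hΩ b.2
  have hc := hM.apply_mem hΩ c.2
  have hbx := hM.center_mem_loct_source hb
  have hcx := hM.center_mem_loct_source hc
  have hx : x₀ ∈ ((hM.loct hb).trans s).source := mem_trans_source hbx hbs
  have h1 := pre_germ (h := s) (g := (hM.loct hb).symm) ((hM.loct hb).map_source hbx) hbs
  change (germ (hM.loct hb).symm (b.1.1 x₀) _).pre s = germ (hM.loct hc).symm (c.1.1 x₀) _ ↔ _
  refine (Eq.congr_left h1).trans (germ_eq_germ_iff.trans ⟨fun ⟨h2, h3⟩ => ?_, fun h => ?_⟩)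
  · have h4 : ((hM.loct hb).trans s).symm =ᶠ[𝓝 (((hM.loct hb).trans s) x₀)] (hM.loct hc).symm := by
      rw [OpenPartialHomeomorph.trans_symm_eq_symm_trans_symm]
      exact h3
    have h5 := eventuallyEq_symm (e := ((hM.loct hb).trans s).symm) (e' := (hM.loct hc).symm)
      (((hM.loct hb).trans s).map_source hx)
      (by
        have : ((hM.loct hb).trans s) x₀ = hM.loct hc x₀ := h2
        rw [this]
        exact (hM.loct hc).map_source hcx) h4
    rw [((hM.loct hb).trans s).left_inv hx] at h5
    exact h5.symm
  · have h6 : ((hM.loct hb).trans s) =ᶠ[𝓝 x₀] hM.loct hc := h.symm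
    refine ⟨h6.eq_of_nhds, ?_⟩
    have := eventuallyEq_symm hx hcx h6
    rw [OpenPartialHomeomorph.trans_symm_eq_symm_trans_symm] at this
    exact this

end IsRigidModel

end Embedding

end Molino

namespace Molino
open Filter Metric

/-! ### Finite generation -/

section Translations

variable {G : Type u} [TopologicalSpace G]

/-- The local left translation by `a`. -/
def LocalGroupOps.ActsByLeftTranslations.translation {L : LocalGroupOps G}
    (hL : L.ActsByLeftTranslations) (hinv : ∀ a, L.inv (L.inv a) = a) (a : G) : Loct G :=
  have hmap : ∀ a b, (a, b) ∈ L.mulDom → L.mul (L.inv a) (L.mul a b) = b := fun a b hab => by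
    have h1 := hL.inv_mul a
    have h2 := hL.e_mul b
    rw [← hL.assoc (L.inv a) a b h1.1 (h1.2.symm ▸ h2.1) hab (hL.inv_mul_mem a b hab), h1.2, h2.2]
  have hcont : ∀ a, ContinuousOn (L.mul a) {b | (a, b) ∈ L.mulDom} := fun a =>
    hL.continuousOn_mul.comp (f := fun b => (a, b)) (by fun_prop) fun _ hb => hb
  have hopen : ∀ a, IsOpen {b | (a, b) ∈ L.mulDom} := fun a =>
    hL.isOpen_mulDom.preimage (f := fun b => (a, b)) (by fun_prop)
  { toFun := L.mul a
    invFun := L.mul (L.inv a)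
    source := {b | (a, b) ∈ L.mulDom}
    target := {b | (L.inv a, b) ∈ L.mulDom}
    map_source' := fun b hb => hL.inv_mul_mem a b hb
    map_target' := fun b hb => by
      have := hL.inv_mul_mem (L.inv a) b hb
      rwa [hinv] at this
    left_inv' := fun b hb => hmap a b hb
    right_inv' := fun b hb => by
      have := hmap (L.inv a) b hb
      rwa [hinv] at this
    open_source := hopen a
    open_target := hopen _
    continuousOn_toFun := hcont a
    continuousOn_invFun := hcont _ }

theorem LocalGroupOps.ActsByLeftTranslations.translation_mem {L : LocalGroupOps G}
    (hL : L.ActsByLeftTranslations) (hinv : ∀ a, L.inv (L.inv a) = a) {Γ : Set G} {a : G}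
    (ha : a ∈ Γ) : hL.translation hinv a ∈ L.translationPseudogroup Γ :=
  subset_generatedOn _ _ ⟨a, ha, fun _ hb => ⟨hb, rfl⟩⟩

end Translations

/-! ### Frames: finite generating sets at nested scales -/

noncomputable section Frames

variable {T : Type u} [MetricSpace T] {S : Set (Loct T)} {x₀ : T} {R ρ r r₁ r₂ r₃ : ℝ}
  {F : Set (LimSpace S x₀ R ρ r)}

namespace IsRigidModel

/-- The elements given by `S` that map some point of the closed ball of radius `r₂` into this
ball. -/
def nearby (S : Set (Loct T)) (x₀ : T) (R ρ r r₂ : ℝ) : Set (LimSpace S x₀ R ρ r) :=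
  {a | a ∈ discretePart S x₀ R ρ r ∧ ∃ p ∈ closedBall x₀ r₂, a.1 p ∈ closedBall x₀ r₂}

/-- One point that stays near `x₀` controls the displacement of `x₀`: at most ε/8 from the variation
of `a` and at most η ≤ ε/8 from the image of `p`. -/
theorem apply_center_mem_of_isScale (hM : IsRigidModel S x₀ R ρ r) {ε η : ℝ}
    (hε : IsScale S x₀ R ρ ε η) (hεr : ε ≤ r) (a : LimSpace S x₀ R ρ r) {p : T}
    (hp : p ∈ closedBall x₀ η) (hap : a.1 p ∈ closedBall x₀ η) : a.1 x₀ ∈ ball x₀ ε := by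
  obtain ⟨τ, hτ, h⟩ := LimSpace.exists_isLim a
  obtain ⟨h0, h1, h2⟩ := hε
  have hpr : p ∈ ball x₀ r := closedBall_subset_ball (by linarith) hp
  have h3 := h2 τ hτ x₀ (hM.ball_subset_ball hM.center_mem_ball) p (hM.ball_subset_ball hpr)
    (by rw [dist_comm]; rw [mem_closedBall] at hp; linarith)
  rw [← h hM.center_mem_ball, ← h hpr] at h3
  rw [mem_closedBall] at hap
  rw [mem_ball]
  linarith [dist_triangle (a.1 x₀) (a.1 p) x₀]

theorem inv_apply_center_mem_of_isScale (hM : IsRigidModel S x₀ R ρ r) {ε η : ℝ}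
    (hε : IsScale S x₀ R ρ ε η) (hεr : ε ≤ r) (a : LimSpace S x₀ R ρ r) {p : T}
    (hp : p ∈ closedBall x₀ η) (hap : a.1 p ∈ closedBall x₀ η) :
    (hM.inv a).1 x₀ ∈ ball x₀ ε := by
  have ha := Metric.ball_subset_ball hεr (hM.apply_center_mem_of_isScale hε hεr a hp hap)
  have hsub : closedBall x₀ η ⊆ ball x₀ r := closedBall_subset_ball (by linarith [hε.1, hε.2.1])
  refine hM.apply_center_mem_of_isScale hε hεr (hM.inv a) hap ?_
  rwa [hM.inv_apply ha (hsub hp) (hsub hap)]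

/-- A finite symmetric set of elements given by `S`, with domains and images at the scales
`r₁ > r₂ > r₃`, that generates the germs of `S` on the ball of radius `r₃`. -/
structure IsFrame (hM : IsRigidModel S x₀ R ρ r) (r₁ r₂ r₃ : ℝ)
    (F : Set (LimSpace S x₀ R ρ r)) : Prop where
  scale₁ : IsScale S x₀ R ρ r r₁
  scale₂ : IsScale S x₀ R ρ r₁ r₂
  scale₃ : IsScale S x₀ R ρ r₂ r₃
  finite : F.Finite
  subset : F ⊆ discretePart S x₀ R ρ r
  inv_mem : ∀ f ∈ F, hM.inv f ∈ F
  apply_mem : ∀ f ∈ F, f.1 x₀ ∈ ball x₀ r₁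
  into : ∀ p ∈ ball x₀ r₂, ∃ f ∈ F, f.1 p ∈ ball x₀ r₃
  gen : ∃ D : Set (Loct T × Set T), (∀ p ∈ D, IsStep S p ∧ ∀ x ∈ p.2, x ∈ ball x₀ r₃ →
    p.1 x ∈ ball x₀ r₃ → ∃ f ∈ F, f.1 =ᶠ[𝓝 x] p.1) ∧ GeneratesGerms S D (ball x₀ r₃)

theorem inv_mem_nearby (hM : IsRigidModel S x₀ R ρ r) (hr₁ : IsScale S x₀ R ρ r r₁)
    (hr₂ : IsScale S x₀ R ρ r₁ r₂) {a : LimSpace S x₀ R ρ r} (ha : a ∈ nearby S x₀ R ρ r r₂) :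
    hM.inv a ∈ nearby S x₀ R ρ r r₂ ∧ hM.inv (hM.inv a) = a ∧ a.1 x₀ ∈ ball x₀ r₁ := by
  obtain ⟨hd, p, hp, hap⟩ := ha
  have hle : r₁ ≤ r := by linarith [hr₁.2.1, hM.r_pos]
  have h1 := hM.apply_center_mem_of_isScale hr₂ hle a hp hap
  have h2 := hM.inv_apply_center_mem_of_isScale hr₂ hle a hp hap
  have hsub := Metric.ball_subset_ball hle (x := x₀)
  have hsub' : closedBall x₀ r₂ ⊆ ball x₀ r :=
    closedBall_subset_ball (by linarith [hr₂.1, hr₂.2.1])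
  refine ⟨⟨hM.inv_mem_discretePart (hsub h1) hd, a.1 p, hap, ?_⟩, hM.inv_inv (hsub h1) (hsub h2),
    h1⟩
  rwa [hM.inv_apply (hsub h1) (hsub' hp) (hsub' hap)]

/-- Two compactness arguments supply `F`: elements moving the closed ball of radius `r₂` into the
ball of radius `r₃`, and elements with the germs of the steps in `D`. All lie in `nearby`, which is
stable under inversion, so `F` can be made symmetric. -/
theorem exists_isFrame (hM : IsRigidModel S x₀ R ρ r) (hr₁ : IsScale S x₀ R ρ r r₁)
    (hr₂ : IsScale S x₀ R ρ r₁ r₂) (hr₃ : IsScale S x₀ R ρ r₂ r₃)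
    (hinto : ∀ x, ∃ s ∈ S, x ∈ s.source ∧ s x ∈ ball x₀ r₃) {D : Set (Loct T × Set T)}
    (hD : D.Finite) (hDS : ∀ p ∈ D, IsStep S p) (hg : GeneratesGerms S D (ball x₀ r₃)) :
    ∃ F, hM.IsFrame r₁ r₂ r₃ F := by
  have hr := hM.r_pos
  have hrρ := hM.r_le
  have h11 := hr₁.1
  have h12 := hr₁.2.1
  have h21 := hr₂.1
  have h22 := hr₂.2.1
  have h31 := hr₃.1
  have h32 := hr₃.2.1
  have hρR := hM.le
  have h2r : closedBall x₀ r₂ ⊆ ball x₀ r := closedBall_subset_ball (by linarith)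
  have h32' : closedBall x₀ r₃ ⊆ closedBall x₀ r₂ := closedBall_subset_closedBall (by linarith)
  have hball : ball x₀ r₃ ⊆ closedBall x₀ r₃ := ball_subset_closedBall
  obtain ⟨F₁, hF₁, hF₁f, hF₁i⟩ := exists_finite_subcover_of_eventually
    (Z := closedBall x₀ r₂) (A := nearby S x₀ R ρ r r₂) (P := fun a x => a.1 x ∈ ball x₀ r₃)
    (hM.compact.of_isClosed_subset isClosed_closedBall
      (closedBall_subset_closedBall (by linarith))) (by
    intro q hq
    obtain ⟨s, hs, hqs, hsq⟩ := hinto q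
    have hsq' := hM.ball_subset_ball (h2r (h32' (hball hsq)))
    obtain ⟨a, ha, hae⟩ := hM.exists_mem_discretePart hs (h2r hq) hqs hsq'
    have haq : a.1 q ∈ ball x₀ r₃ := hae.eq_of_nhds ▸ hsq
    exact ⟨a, ⟨ha, q, hq, h32' (hball haq)⟩,
      (hM.continuousAt_apply a (h2r hq)) (isOpen_ball.mem_nhds haq)⟩)
  have hstep : ∀ p ∈ D, ∃ F₂ ⊆ nearby S x₀ R ρ r r₂, F₂.Finite ∧
      ∀ x ∈ p.2 ∩ p.1 ⁻¹' closedBall x₀ r₃ ∩ closedBall x₀ r₃, ∃ f ∈ F₂, f.1 =ᶠ[𝓝 x] p.1 := by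
    intro p hp
    obtain ⟨hpS, hpc, hps⟩ := hDS p hp
    have hc : IsCompact (p.2 ∩ p.1 ⁻¹' closedBall x₀ r₃) :=
      hpc.of_isClosed_subset ((p.1.continuousOn.mono hps).preimage_isClosed_of_isClosed
        hpc.isClosed isClosed_closedBall) inter_subset_left
    refine exists_finite_subcover_of_eventually (hc.inter_right isClosed_closedBall)
      fun q hq => ?_
    have hq1 : q ∈ closedBall x₀ r₂ := h32' hq.2
    have hq2 : p.1 q ∈ closedBall x₀ r₂ := h32' hq.1.2
    obtain ⟨a, ha, hae⟩ := hM.exists_mem_discretePart hpS (h2r hq1) (hps hq.1.1)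
      (hM.ball_subset_ball (h2r hq2))
    exact ⟨a, ⟨ha, q, hq1, hae.eq_of_nhds ▸ hq2⟩, eventually_eventually_nhds.2 hae⟩
  choose! F₂ hF₂ hF₂f hF₂i using hstep
  set F₀ := F₁ ∪ ⋃ p ∈ D, F₂ p with hF₀
  have hF₀f : F₀.Finite := hF₁f.union (hD.biUnion hF₂f)
  have hF₀n : F₀ ⊆ nearby S x₀ R ρ r r₂ := union_subset hF₁ (iUnion₂_subset hF₂)
  have hn : F₀ ∪ hM.inv '' F₀ ⊆ nearby S x₀ R ρ r r₂ := by
    refine union_subset hF₀n ?_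
    rintro _ ⟨a, ha, rfl⟩
    exact (hM.inv_mem_nearby hr₁ hr₂ (hF₀n ha)).1
  refine ⟨F₀ ∪ hM.inv '' F₀, hr₁, hr₂, hr₃, hF₀f.union (hF₀f.image _), fun a ha => (hn ha).1, ?_,
    fun a ha => (hM.inv_mem_nearby hr₁ hr₂ (hn ha)).2.2, fun p hp => ?_,
    D, fun p hp => ⟨hDS p hp, fun x hx hx' hpx => ?_⟩, hg⟩
  · rintro _ (ha | ⟨a, ha, rfl⟩)
    · exact Or.inr (mem_image_of_mem _ ha)
    · rw [(hM.inv_mem_nearby hr₁ hr₂ (hF₀n ha)).2.1]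
      exact Or.inl ha
  · obtain ⟨f, hf, hfp⟩ := hF₁i p (ball_subset_closedBall hp)
    exact ⟨f, Or.inl (Or.inl hf), hfp⟩
  · obtain ⟨f, hf, hfx⟩ := hF₂i p hp x ⟨⟨hx, hball hpx⟩, hball hx'⟩
    exact ⟨f, Or.inl (Or.inr (mem_iUnion₂.2 ⟨p, hp, hf⟩)), hfx⟩

/-- The admissible pairs of a frame. -/
def gauge (hM : IsRigidModel S x₀ R ρ r) (r₁ r₃ : ℝ) (F : Set (LimSpace S x₀ R ρ r)) :
    Set (T × T) :=
  {w | w ∈ ball x₀ r₁ ×ˢ ball x₀ r₁ ∧ (w.1 ∈ ball x₀ r₃ ∨ w.2 ∈ ball x₀ r₃ ∨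
    ∃ f ∈ F, (hM.inv f).1 w.1 ∈ ball x₀ r₃ ∧ f.1 w.2 ∈ ball x₀ r₃)}

namespace IsFrame

variable {hM : IsRigidModel S x₀ R ρ r}

theorem ball_subset_ball (hF : hM.IsFrame r₁ r₂ r₃ F) : ball x₀ r₁ ⊆ ball x₀ r :=
  Metric.ball_subset_ball (by linarith [hF.scale₁.2.1, hM.r_pos])

theorem small_subset_ball (hF : hM.IsFrame r₁ r₂ r₃ F) : ball x₀ r₃ ⊆ ball x₀ r₁ :=
  Metric.ball_subset_ball
    (by linarith [hF.scale₂.2.1, hF.scale₃.2.1, hF.scale₁.1, hF.scale₂.1])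

theorem small_subset_medium (hF : hM.IsFrame r₁ r₂ r₃ F) : ball x₀ r₃ ⊆ ball x₀ r₂ :=
  Metric.ball_subset_ball (by linarith [hF.scale₃.2.1, hF.scale₂.1])

theorem center_mem (hF : hM.IsFrame r₁ r₂ r₃ F) : x₀ ∈ ball x₀ r₃ := mem_ball_self hF.scale₃.1

theorem inv_inv (hF : hM.IsFrame r₁ r₂ r₃ F) {f : LimSpace S x₀ R ρ r} (hf : f ∈ F) :
    hM.inv (hM.inv f) = f :=
  hM.inv_inv (hF.ball_subset_ball (hF.apply_mem f hf))
    (hF.ball_subset_ball (hF.apply_mem _ (hF.inv_mem f hf)))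

/-- Of the three alternatives in `gauge`, the first admits the elements that move `x₀` only
slightly, the second their inverses, and the third the elements of `F`. The third is symmetric
because `F` is closed under inversion. -/
theorem isGauge (hF : hM.IsFrame r₁ r₂ r₃ F) : IsGauge x₀ r (hM.gauge r₁ r₃ F) where
  isOpen := by
    rw [isOpen_iff_mem_nhds]
    rintro w ⟨hw, hw'⟩
    have h1 : ∀ᶠ w' in 𝓝 w, w' ∈ ball x₀ r₁ ×ˢ ball x₀ r₁ :=
      (isOpen_ball.prod isOpen_ball).mem_nhds hw
    rcases hw' with h | h | ⟨f, hf, hf1, hf2⟩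
    · filter_upwards [h1, continuousAt_fst (isOpen_ball.mem_nhds h)] with w' h2 h3
      exact ⟨h2, Or.inl h3⟩
    · filter_upwards [h1, continuousAt_snd (isOpen_ball.mem_nhds h)] with w' h2 h3
      exact ⟨h2, Or.inr (Or.inl h3)⟩
    · have h4 : ContinuousAt (fun w : T × T => (hM.inv f).1 w.1) w :=
        (hM.continuousAt_apply _ (hF.ball_subset_ball hw.1)).comp continuousAt_fst
      have h5 : ContinuousAt (fun w : T × T => f.1 w.2) w :=
        (hM.continuousAt_apply _ (hF.ball_subset_ball hw.2)).comp continuousAt_snd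
      filter_upwards [h1, h4 (isOpen_ball.mem_nhds hf1), h5 (isOpen_ball.mem_nhds hf2)]
        with w' h2 h6 h7
      exact ⟨h2, Or.inr (Or.inr ⟨f, hf, h6, h7⟩)⟩
  subset w hw := ⟨hF.ball_subset_ball hw.1.1, hF.ball_subset_ball hw.1.2⟩
  center := ⟨⟨hF.small_subset_ball hF.center_mem, hF.small_subset_ball hF.center_mem⟩,
    Or.inl hF.center_mem⟩
  swap := by
    rintro p q ⟨hw, hw'⟩
    refine ⟨⟨hw.2, hw.1⟩, ?_⟩
    rcases hw' with h | h | ⟨f, hf, hf1, hf2⟩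
    · exact Or.inr (Or.inl h)
    · exact Or.inl h
    · exact Or.inr (Or.inr ⟨hM.inv f, hF.inv_mem f hf, by rwa [hF.inv_inv hf], hf1⟩)

/-- The third alternative of the gauge holds with `f` itself, since both points to be tested are
then `x₀`. -/
theorem mem_carrier (hF : hM.IsFrame r₁ r₂ r₃ F) {f : LimSpace S x₀ R ρ r} (hf : f ∈ F) :
    f ∈ hM.carrier (hM.gauge r₁ r₃ F) := by
  have h1 := hF.apply_mem f hf
  have h2 := hF.apply_mem _ (hF.inv_mem f hf)
  refine ⟨⟨h1, h2⟩, Or.inr (Or.inr ⟨f, hf, ?_, ?_⟩)⟩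
  · rw [hM.inv_apply_center (hF.ball_subset_ball h1)]
    exact hF.center_mem
  · rw [hM.apply_inv (hF.ball_subset_ball h1) hM.center_mem_ball (hF.ball_subset_ball h2)]
    exact hF.center_mem

theorem mem_carrier_of_apply_mem (hF : hM.IsFrame r₁ r₂ r₃ F) {a : LimSpace S x₀ R ρ r}
    (ha : a.1 x₀ ∈ ball x₀ r₃) : a ∈ hM.carrier (hM.gauge r₁ r₃ F) := by
  refine ⟨⟨hF.small_subset_ball ha, ?_⟩, Or.inl ha⟩
  exact hM.inv_apply_center_mem_of_isScale hF.scale₂ (by linarith [hF.scale₁.2.1, hM.r_pos]) a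
    (mem_closedBall_self hF.scale₂.1.le) (ball_subset_closedBall (hF.small_subset_medium ha))

/-- Every element is mapped into the small ball by an element of the frame. -/
theorem exists_apply_mem (hF : hM.IsFrame r₁ r₂ r₃ F)
    (b : hM.carrier (hM.gauge r₁ r₃ F)) : ∃ f ∈ F, f.1 (b.1.1 x₀) ∈ ball x₀ r₃ := by
  obtain ⟨b, hw, hb⟩ := b
  rcases hb with h | h | ⟨f, hf, hf1, -⟩
  · exact hF.into _ (hF.small_subset_medium h)
  · have h1 := hF.ball_subset_ball hw.1
    have h2 := hM.apply_inv h1 hM.center_mem_ball (hF.ball_subset_ball hw.2)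
    -- `b` maps the point b⁻¹ x₀, which is within `r₃` of `x₀`, to `x₀`; the scale `r₃` then puts `b
    -- x₀` within `r₂`, where `F` takes over.
    refine hF.into _ (hM.apply_center_mem_of_isScale hF.scale₃ ?_ b (ball_subset_closedBall h) ?_)
    · linarith [hF.scale₁.2.1, hM.r_pos, hF.scale₂.2.1, hF.scale₁.1]
    · change b.1 ((hM.inv b).1 x₀) ∈ _
      rw [h2]
      exact mem_closedBall_self hF.scale₃.1.le
  · exact ⟨hM.inv f, hF.inv_mem f hf, hf1⟩

theorem mul_mem (hF : hM.IsFrame r₁ r₂ r₃ F) {f : LimSpace S x₀ R ρ r}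
    {b : hM.carrier (hM.gauge r₁ r₃ F)} (hfb : f.1 (b.1.1 x₀) ∈ ball x₀ r₃) :
    (hM.mul f b.1).1 x₀ = f.1 (b.1.1 x₀) ∧ hM.mul f b.1 ∈ hM.carrier (hM.gauge r₁ r₃ F) := by
  have h1 := hM.mul_apply_center (hM.apply_mem hF.isGauge b.2)
    (hM.ball_subset_half (hF.ball_subset_ball (hF.small_subset_ball hfb)))
  exact ⟨h1, hF.mem_carrier_of_apply_mem (h1.symm ▸ hfb)⟩

/-- The elements of the local group that belong to the frame. -/
abbrev generators (_ : hM.IsFrame r₁ r₂ r₃ F) : Set (hM.carrier (hM.gauge r₁ r₃ F)) :=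
  Subtype.val ⁻¹' F

/-- Since the chain stays in the ball of radius `r₃`, every partial product belongs to the carrier,
and all products in the word are defined. -/
theorem exists_isWord_of_chain (hF : hM.IsFrame r₁ r₂ r₃ F) {D : Set (Loct T × Set T)}
    (hD : ∀ p ∈ D, IsStep S p ∧ ∀ x ∈ p.2, x ∈ ball x₀ r₃ → p.1 x ∈ ball x₀ r₃ →
      ∃ f ∈ F, f.1 =ᶠ[𝓝 x] p.1) {g : Loct T} (hg : Chain D (ball x₀ r₃) x₀ g) :
    ∃ c, (hM.ops hF.isGauge).IsWord hF.generators c ∧ c.1.1 =ᶠ[𝓝 x₀] g := by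
  induction hg with
  | refl =>
    refine ⟨_, LocalGroupOps.IsWord.one, ?_⟩
    filter_upwards [isOpen_ball.mem_nhds hM.center_mem_ball] with z hz
    exact hM.one_apply hz
  | step g p hg hp hx h ih =>
    obtain ⟨c, hc, hce⟩ := ih
    obtain ⟨f, hf, hfe⟩ := (hD p hp).2 _ hx (hg.mem hF.center_mem) h
    have hc0 : c.1.1 x₀ = g x₀ := hce.eq_of_nhds
    have hfc : f.1 (c.1.1 x₀) ∈ ball x₀ r₃ := by rwa [hc0, hfe.eq_of_nhds]
    have hmul := hF.mul_mem hfc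
    have hdom : (⟨f, hF.mem_carrier hf⟩, c) ∈ (hM.ops hF.isGauge).mulDom := hmul.2
    refine ⟨_, LocalGroupOps.IsWord.mul ⟨f, hF.mem_carrier hf⟩ c hf hdom hc, ?_⟩
    rw [hM.ops_mul hF.isGauge hdom]
    refine (hM.mul_eventuallyEq (hM.apply_mem hF.isGauge c.2) (hM.ball_subset_half
      (hF.ball_subset_ball (hF.small_subset_ball hfc)))).trans ?_
    have h3 : Tendsto c.1.1 (𝓝 x₀) (𝓝 (g x₀)) := by
      have := hM.continuousAt_apply c.1 hM.center_mem_ball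
      rwa [ContinuousAt, hc0] at this
    filter_upwards [hce, h3.eventually hfe] with z h1 h2
    rw [Function.comp_apply, h2, h1, OpenPartialHomeomorph.trans_apply]

/-- An element `f` of `F` moves `a x₀` into the ball of radius `r₃`. The germ of `f a` at `x₀` is
then a chain between points of this ball, so `f a` is a word, and so is `a = f⁻¹ (f a)`. -/
theorem gamma_eq (hF : hM.IsFrame r₁ r₂ r₃ F) :
    hM.gamma (hM.gauge r₁ r₃ F) = {a | (hM.ops hF.isGauge).IsWord hF.generators a} := by
  have hΩ := hF.isGauge
  apply Subset.antisymm
  · intro a ha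
    obtain ⟨f, hf, hfa⟩ := hF.exists_apply_mem a
    obtain ⟨hmul0, hmul⟩ := hF.mul_mem hfa
    have hdisc : hM.mul f a.1 ∈ discretePart S x₀ R ρ r :=
      hM.mul_mem_discretePart (hM.apply_mem hΩ a.2)
        (hM.ball_subset_half (hF.ball_subset_ball (hF.small_subset_ball hfa))) (hF.subset hf) ha
    obtain ⟨s, hs, hse⟩ := hdisc
    have hs0 : s x₀ ∈ ball x₀ r₃ := by
      rw [← hse hM.center_mem_ball, hmul0]
      exact hfa
    obtain ⟨D, hD, hgen⟩ := hF.gen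
    obtain ⟨g, hg, hgs⟩ := hgen s hs.1 x₀ (hs.2.1 ▸ hM.center_mem) hF.center_mem hs0
    obtain ⟨c, hc, hce⟩ := hF.exists_isWord_of_chain hD hg
    have hcm : c.1 = hM.mul f a.1 := by
      refine (hM.ext_of_eventuallyEq hM.center_mem_ball ?_ ?_).symm
      · rw [hmul0]
        exact hM.ball_subset_half (hF.ball_subset_ball (hF.small_subset_ball hfa))
      · exact (eventuallyEq_of_eqOn isOpen_ball hM.center_mem_ball hse).trans
          (hce.trans hgs).symm
    have hcancel : hM.mul (hM.inv f) c.1 = a.1 := by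
      rw [hcm]
      exact hM.inv_mul_cancel_left (hF.ball_subset_ball (hF.apply_mem f hf))
        (hM.apply_mem hΩ a.2) (hF.ball_subset_ball (hF.small_subset_ball hfa))
    have hif := hF.inv_mem f hf
    have hdom : (⟨hM.inv f, hF.mem_carrier hif⟩, c) ∈ (hM.ops hΩ).mulDom := by
      change hM.mul (hM.inv f) c.1 ∈ hM.carrier (hM.gauge r₁ r₃ F)
      rw [hcancel]
      exact a.2
    have hword := LocalGroupOps.IsWord.mul ⟨hM.inv f, hF.mem_carrier hif⟩ c hif hdom hc
    rwa [show (hM.ops hΩ).mul ⟨hM.inv f, hF.mem_carrier hif⟩ c = a from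
      Subtype.ext ((hM.ops_mul hΩ hdom).trans hcancel)] at hword
  · intro a ha
    induction ha with
    | one => exact hM.one_mem_discretePart
    | mul f a hf hdom _ ih => exact hM.mul_mem_gamma hΩ (hF.subset hf) ih hdom
    | inv_mul f a hf _ hdom _ ih =>
      exact hM.mul_mem_gamma hΩ (hM.inv_mem_gamma hΩ (hF.subset hf)) ih hdom

theorem isFinitelyGenerated (hF : hM.IsFrame r₁ r₂ r₃ F) :
    (hM.ops hF.isGauge).IsFinitelyGenerated (hM.gamma (hM.gauge r₁ r₃ F)) :=
  ⟨hF.generators, hF.finite.preimage Subtype.val_injective.injOn, hF.gamma_eq⟩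

end IsFrame

end IsRigidModel

end Frames

end Molino

namespace Molino
open Filter Metric

/-! ### Comparison of the pseudogroups -/

noncomputable section Comparison

variable {T : Type u} [MetricSpace T] {S : Set (Loct T)} {x₀ : T} {R ρ r r₁ r₂ r₃ : ℝ}
  {F : Set (LimSpace S x₀ R ρ r)} {Ω : Set (T × T)}

namespace IsRigidModel

variable {hM : IsRigidModel S x₀ R ρ r}

/-- Around `b`, the local transformation `k` is composition with `s`. -/
def IsInducedBy (hM : IsRigidModel S x₀ R ρ r) {Ω : Set (T × T)} (k : Loct (hM.carrier Ω))
    (b : hM.carrier Ω) (s : Loct T) : Prop :=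
  b.1.1 x₀ ∈ s.source ∧ ∀ᶠ b' in 𝓝 b, (k b').1.1 =ᶠ[𝓝 x₀] s ∘ b'.1.1

theorem continuous_apply_center : Continuous fun b : hM.carrier Ω => b.1.1 x₀ :=
  (LimSpace.continuous_eval x₀).comp continuous_subtype_val

theorem tendsto_apply_center (b : hM.carrier Ω) : Tendsto b.1.1 (𝓝 x₀) (𝓝 (b.1.1 x₀)) :=
  hM.continuousAt_apply b.1 hM.center_mem_ball

namespace IsInducedBy

variable {k k' : Loct (hM.carrier Ω)} {b : hM.carrier Ω} {s s' : Loct T}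

theorem apply_center (h : hM.IsInducedBy k b s) : (k b).1.1 x₀ = s (b.1.1 x₀) :=
  h.2.self_of_nhds.eq_of_nhds

theorem congr (h : hM.IsInducedBy k b s) (hbs' : b.1.1 x₀ ∈ s'.source)
    (he : s =ᶠ[𝓝 (b.1.1 x₀)] s') : hM.IsInducedBy k b s' := by
  refine ⟨hbs', ?_⟩
  filter_upwards [h.2, continuous_apply_center.continuousAt.eventually
    (eventually_eventually_nhds.2 he)] with b' h1 h2
  exact h1.trans ((tendsto_apply_center b').eventually h2)

theorem trans (hb : b ∈ k.source) (h : hM.IsInducedBy k b s) (h' : hM.IsInducedBy k' (k b) s') :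
    hM.IsInducedBy (k.trans k') b (s.trans s') := by
  refine ⟨mem_trans_source h.1 (h.apply_center ▸ h'.1), ?_⟩
  filter_upwards [h.2, (k.continuousAt hb).eventually h'.2] with b' h1 h2
  exact h2.trans (h1.mono fun z hz => congrArg s' hz)

theorem symm (hb : b ∈ k.source) (h : hM.IsInducedBy k b s) :
    hM.IsInducedBy k.symm (k b) s.symm := by
  refine ⟨h.apply_center ▸ s.map_source h.1, ?_⟩
  filter_upwards [(k.tendsto_symm hb).eventually h.2, k.open_target.mem_nhds (k.map_source hb),
    (k.tendsto_symm hb).eventually (continuous_apply_center.continuousAt.eventually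
      (s.open_source.mem_nhds h.1))] with c h1 h2 h3
  rw [k.right_inv h2] at h1
  filter_upwards [h1, (tendsto_apply_center _).eventually (s.open_source.mem_nhds h3)] with z h4 h5
  rw [Function.comp_apply, h4, Function.comp_apply, s.left_inv h5]

end IsInducedBy

theorem isInducedBy_translation (hΩ : IsGauge x₀ r Ω) {k : Loct (hM.carrier Ω)}
    {a b : hM.carrier Ω} (hb : b ∈ k.source)
    (hk : ∀ b ∈ k.source, (a, b) ∈ (hM.ops hΩ).mulDom ∧ k b = (hM.ops hΩ).mul a b) {s : Loct T}
    (hs : s ∈ ballMaps S x₀ R ρ) (hsa : EqOn a.1.1 s (ball x₀ r)) : hM.IsInducedBy k b s := by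
  refine ⟨hs.2.1 ▸ hM.ball_subset_ball (hM.apply_mem hΩ b.2), ?_⟩
  filter_upwards [k.open_source.mem_nhds hb] with b' hb'
  obtain ⟨hdom, hkb⟩ := hk b' hb'
  rw [hkb, hM.ops_mul hΩ hdom]
  have h1 := hM.apply_mem hΩ b'.2
  refine (hM.mul_eventuallyEq h1 (hM.apply_apply_mem hΩ a.2 h1)).trans ?_
  filter_upwards [(tendsto_apply_center b').eventually (isOpen_ball.mem_nhds h1)] with z hz
  exact hsa hz

/-- Together with `isInducedBy_translation`, this shows that everything generated by translations is
locally composition with elements of `S`. -/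
theorem isGermRel_isInducedBy (hS : IsLocalPseudoStarGroup S)
    (hcov : ∀ x, ∃ h ∈ S, x ∈ h.source) :
    IsGermRel ⊤ fun (k : Loct (hM.carrier Ω)) b => ∃ s ∈ S, hM.IsInducedBy k b s where
  congr := by
    rintro k k' b - - hkk' ⟨s, hs, hbs, he⟩
    refine ⟨s, hs, hbs, ?_⟩
    filter_upwards [he, hkk'] with b' h1 h2
    rwa [← h2]
  id := by
    intro b _
    obtain ⟨h, hh, hbh⟩ := hcov (b.1.1 x₀)
    refine ⟨h.trans h.symm, hS.comp_mem h hh _ (hS.symm_mem h hh), by simp [hbh], ?_⟩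
    filter_upwards [continuous_apply_center.continuousAt.eventually
      (h.open_source.mem_nhds hbh)] with b' hb'
    filter_upwards [(tendsto_apply_center b').eventually (h.open_source.mem_nhds hb')] with z hz
    simp [h.left_inv hz]
  comp := by
    rintro k k' b hb - ⟨s, hs, h⟩ ⟨s', hs', h'⟩
    exact ⟨s.trans s', hS.comp_mem s hs s' hs', h.trans hb h'⟩
  symm := by
    rintro k b hb ⟨s, hs, h⟩
    exact ⟨s.symm, hS.symm_mem s hs, h.symm hb⟩

namespace IsFrame

/-- The pseudogroup generated by the translations. -/
abbrev translations (hF : hM.IsFrame r₁ r₂ r₃ F) : Set (Loct (hM.carrier (hM.gauge r₁ r₃ F))) :=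
  (hM.ops hF.isGauge).translationPseudogroup (hM.gamma (hM.gauge r₁ r₃ F))

theorem isPseudogroup_translations (hF : hM.IsFrame r₁ r₂ r₃ F) :
    IsPseudogroup hF.translations := isPseudogroup_generated _

theorem exists_isInducedBy_of_mem (hF : hM.IsFrame r₁ r₂ r₃ F) {f : LimSpace S x₀ R ρ r}
    (hf : f ∈ F) {b : hM.carrier (hM.gauge r₁ r₃ F)} (hfb : f.1 (b.1.1 x₀) ∈ ball x₀ r₃) :
    ∃ s ∈ S, s =ᶠ[𝓝 (b.1.1 x₀)] f.1 ∧
      ∃ k ∈ hF.translations, b ∈ k.source ∧ hM.IsInducedBy k b s := by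
  have hΩ := hF.isGauge
  obtain ⟨s, hs, hsf⟩ := hF.subset hf
  have hdom : (⟨f, hF.mem_carrier hf⟩, b) ∈ (hM.ops hΩ).mulDom := (hF.mul_mem hfb).2
  refine ⟨s, hs.1, eventuallyEq_of_eqOn isOpen_ball (hM.apply_mem hΩ b.2) hsf.symm,
    (hM.actsByLeftTranslations hΩ).translation (fun a => Subtype.ext
      (hM.inv_inv (hM.apply_mem hΩ a.2) (hM.inv_apply_mem hΩ a.2))) ⟨f, hF.mem_carrier hf⟩,
    LocalGroupOps.ActsByLeftTranslations.translation_mem _ _ (hF.subset hf), hdom, ?_⟩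
  exact isInducedBy_translation hΩ (a := ⟨f, hF.mem_carrier hf⟩) hdom
    (fun b hb => ⟨hb, rfl⟩) hs hsf

/-- Each step is a translation by an element of `F`. The ball of radius `r₃` guarantees that the
next translation is defined at the point reached so far. -/
theorem exists_isInducedBy_of_chain (hF : hM.IsFrame r₁ r₂ r₃ F) {D : Set (Loct T × Set T)}
    (hD : ∀ p ∈ D, IsStep S p ∧ ∀ x ∈ p.2, x ∈ ball x₀ r₃ → p.1 x ∈ ball x₀ r₃ →
      ∃ f ∈ F, f.1 =ᶠ[𝓝 x] p.1) {b : hM.carrier (hM.gauge r₁ r₃ F)}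
    (hb : b.1.1 x₀ ∈ ball x₀ r₃) {g : Loct T} (hg : Chain D (ball x₀ r₃) (b.1.1 x₀) g) :
    ∃ k ∈ hF.translations, b ∈ k.source ∧ hM.IsInducedBy k b g := by
  induction hg with
  | refl =>
    exact ⟨_, hF.isPseudogroup_translations.refl_mem, mem_univ b, mem_univ _,
      Eventually.of_forall fun _ => EventuallyEq.rfl⟩
  | step g p hg hp hx h ih =>
    obtain ⟨k, hk, hbk, hi⟩ := ih
    obtain ⟨f, hf, hfe⟩ := (hD p hp).2 _ hx (hg.mem hb) h
    have hc := hi.apply_center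
    rw [← hc] at hfe h hx
    obtain ⟨s, -, hse, k', hk', hbk', hi'⟩ := hF.exists_isInducedBy_of_mem hf (b := k b)
      (by rwa [hfe.eq_of_nhds])
    exact ⟨k.trans k', hF.isPseudogroup_translations.comp_mem k hk k' hk', ⟨hbk, hbk'⟩,
      hi.trans hbk (hi'.congr ((hD p hp).1.2.2 hx) (hse.trans hfe))⟩

/-- The elements of the pseudogroup generated by the translations are the local transformations
that are given by elements of `S` around every point of their domains. -/
theorem mem_translations_iff (hF : hM.IsFrame r₁ r₂ r₃ F) (hcov : ∀ x, ∃ h ∈ S, x ∈ h.source)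
    {k : Loct (hM.carrier (hM.gauge r₁ r₃ F))} :
    k ∈ hF.translations ↔ ∀ b ∈ k.source, ∃ s ∈ S, hM.IsInducedBy k b s := by
  have hS := hM.star
  have hΩ := hF.isGauge
  have hP := hF.isPseudogroup_translations
  constructor
  · intro hk
    refine (hk _ ⟨(isGermRel_isInducedBy hS hcov).isPseudogroupOn, ?_⟩).2
    rintro k ⟨a, ⟨s, hs, hsa⟩, hka⟩
    exact ⟨⟨by simp, by simp⟩, fun b hb =>
      ⟨s, hs.1, isInducedBy_translation hΩ hb hka hs hsa⟩⟩
  · intro hk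
    refine hP.mem_of_locally fun b hb => ?_
    obtain ⟨s, hs, hi⟩ := hk b hb
    -- Elements of the carrier are determined by their germs at `x₀`, so two local transformations
    -- induced by the same `s` at `b` agree near `b`.
    suffices ∃ k₀ ∈ hF.translations, b ∈ k₀.source ∧ hM.IsInducedBy k₀ b s by
      obtain ⟨k₀, hk₀, hbk₀, hi₀⟩ := this
      refine ⟨k₀, hk₀, hbk₀, ?_⟩
      filter_upwards [hi.2, hi₀.2] with b' h1 h2
      exact Subtype.ext (hM.ext_of_eventuallyEq hM.center_mem_ball
        (hM.ball_subset_half (hM.apply_mem hΩ (k b').2)) (h1.trans h2.symm))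
    -- Move both `b` and `k b` over the small ball. There the conjugate `s₂ s s₁⁻¹` is a chain,
    -- hence induced by some `k₃` generated by translations, and `k₂⁻¹ k₃ k₁` is the candidate.
    obtain ⟨f₁, hf₁, hf₁b⟩ := hF.exists_apply_mem b
    obtain ⟨f₂, hf₂, hf₂c⟩ := hF.exists_apply_mem (k b)
    obtain ⟨s₁, hs₁, hse₁, k₁, hk₁, hbk₁, hi₁⟩ := hF.exists_isInducedBy_of_mem hf₁ hf₁b
    obtain ⟨s₂, hs₂, hse₂, k₂, hk₂, hck₂, hi₂⟩ := hF.exists_isInducedBy_of_mem hf₂ hf₂c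
    have hc := hi.apply_center
    have hb₁ := hi₁.apply_center
    have hs₁b : s₁.symm ((k₁ b).1.1 x₀) = b.1.1 x₀ := by rw [hb₁, s₁.left_inv hi₁.1]
    have hs₂s : s₂.source ∈ 𝓝 (s (b.1.1 x₀)) := s₂.open_source.mem_nhds (hc ▸ hi₂.1)
    obtain ⟨D, hD, hgen⟩ := hF.gen
    have hxV : (k₁ b).1.1 x₀ ∈ ball x₀ r₃ := by
      rw [hb₁, hse₁.eq_of_nhds]
      exact hf₁b
    obtain ⟨g, hg, hge⟩ := hgen ((s₁.symm.trans s).trans s₂)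
      (hS.comp_mem _ (hS.comp_mem _ (hS.symm_mem _ hs₁) _ hs) _ hs₂) ((k₁ b).1.1 x₀)
      (mem_trans_source (mem_trans_source (hb₁ ▸ s₁.map_source hi₁.1)
        (by rw [hs₁b]; exact hi.1))
        (by rw [OpenPartialHomeomorph.trans_apply, hs₁b]; exact mem_of_mem_nhds hs₂s))
      hxV (by
        rw [OpenPartialHomeomorph.trans_apply, OpenPartialHomeomorph.trans_apply, hs₁b, ← hc,
          hse₂.eq_of_nhds]
        exact hf₂c)
    obtain ⟨k₃, hk₃, hbk₃, hi₃⟩ := hF.exists_isInducedBy_of_chain hD hxV hg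
    -- Both sides have the germ of s₂ s b at `x₀`; this is what makes `k₂⁻¹` applicable after `k₃
    -- k₁`.
    have hlast : k₃ (k₁ b) = k₂ (k b) := by
      refine Subtype.ext (hM.ext_of_eventuallyEq hM.center_mem_ball
        (hM.ball_subset_half (hM.apply_mem hΩ (k₃ (k₁ b)).2)) ?_)
      have h1 := hi₃.2.self_of_nhds
      have h2 := hi₂.2.self_of_nhds
      have h3 := hi.2.self_of_nhds
      have h4 := hi₁.2.self_of_nhds
      refine h1.trans (EventuallyEq.trans ?_ h2.symm)
      filter_upwards [(tendsto_apply_center (k₁ b)).eventually hge, h3, h4,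
        (tendsto_apply_center b).eventually (s₁.open_source.mem_nhds hi₁.1)] with z h5 h6 h7 h8
      simp only [Function.comp_apply, OpenPartialHomeomorph.trans_apply] at h5 h6 h7 ⊢
      rw [h5, h6, h7, s₁.left_inv h8]
    have hi₄ := (hi₁.trans hbk₁ hi₃).trans (k := k₁.trans k₃) ⟨hbk₁, hbk₃⟩
      (k' := k₂.symm) (s' := s₂.symm) (by
        rw [OpenPartialHomeomorph.trans_apply, hlast]
        exact hi₂.symm hck₂)
    refine ⟨(k₁.trans k₃).trans k₂.symm, hP.comp_mem _ (hP.comp_mem _ hk₁ _ hk₃) _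
      (hP.symm_mem _ hk₂), ⟨⟨hbk₁, hbk₃⟩, ?_⟩, hi₄.congr hi.1 ?_⟩
    · change k₃ (k₁ b) ∈ k₂.target
      rw [hlast]
      exact k₂.map_source hck₂
    · have h9 : Tendsto s₁ (𝓝 (b.1.1 x₀)) (𝓝 ((k₁ b).1.1 x₀)) := by
        rw [hb₁]
        exact s₁.continuousAt hi₁.1
      filter_upwards [h9.eventually hge, s₁.open_source.mem_nhds hi₁.1,
        (s.continuousAt hi.1) hs₂s] with z h10 h11 h12
      simp only [OpenPartialHomeomorph.trans_apply] at h10 ⊢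
      rw [h10, s₁.left_inv h11, s₂.left_inv h12]

/-- Both pseudogroups are locally given by elements of `S`, and the embedding matches the two
descriptions. The orbit condition holds because some ŝ moves any germ so that its source is in the
ball of radius `r₃`, where the first alternative of the gauge applies. -/
theorem areEquivalent [LocallyCompactSpace T] (hF : hM.IsFrame r₁ r₂ r₃ F)
    (hcov : ∀ x, ∃ h ∈ S, x ∈ h.source)
    (hinto : ∀ x, ∃ s ∈ S, x ∈ s.source ∧ s x ∈ ball x₀ r₃) :
    AreEquivalent (hatH₀ S x₀) hF.translations := by
  have hS := hM.star
  have hΩ := hF.isGauge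
  refine areEquivalent_of_openEmbedding (isPseudogroup_generated _)
    (hM.embedding hΩ hF.scale₁ fun w hw => hw.1) rfl (fun k => ?_) fun γ => ?_
  · rw [hF.mem_translations_iff hcov]
    refine forall₂_congr fun b hb => ⟨?_, ?_⟩
    · rintro ⟨s, hs, hi⟩
      refine ⟨hatMap hS x₀ hs, hatMap_mem_hatH₀ hS hs, hi.1, ?_⟩
      filter_upwards [hi.2, continuous_apply_center.continuousAt.eventually
        (s.open_source.mem_nhds hi.1)] with b' h1 h2
      exact Subtype.ext (Subtype.ext ((hM.toHat_pre_iff hΩ h2).2 h1))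
    · rintro ⟨φ, hφ, hbφ, he⟩
      obtain ⟨s, hs, hbs, hse⟩ := (mem_hatH₀_iff hS hcov).1 hφ _ hbφ
      refine ⟨s, hs, hbs, ?_⟩
      filter_upwards [he, (hM.continuous_toHat hΩ).continuousAt.eventually hse,
        continuous_apply_center.continuousAt.eventually (s.open_source.mem_nhds hbs)]
        with b' h1 h2 h3
      exact (hM.toHat_pre_iff hΩ h3).1 (h2.symm.trans (congrArg (fun γ => γ.1.1) h1))
  · obtain ⟨s, hs, hγs, hsγ⟩ := hinto γ.1.1.src
    refine ⟨hatMap hS x₀ hs, hatMap_mem_hatH₀ hS hs, hγs, ?_⟩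
    have hsrc : (hatMap hS x₀ hs γ).1.1.src ∈ ball x₀ r₃ := by
      change (γ.1.1.pre s).src ∈ _
      rw [src_pre hγs]
      exact hsγ
    refine ⟨hF.small_subset_ball hsrc, hF.mem_carrier_of_apply_mem ?_⟩
    rw [(hM.extend_spec hF.scale₁ (hF.small_subset_ball hsrc)).2.1]
    exact hsrc

end IsFrame

end IsRigidModel

end Comparison

end Molino

open Molino in
theorem mainTheorem4 {T : Type u} [TopologicalSpace T] [LocallyCompactSpace T] [PolishSpace T]
    (H : Set (Loct T)) (hH : IsPseudogroup H) (hmin : IsMinimal H) (hcg : IsCompactlyGenerated H)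
    (S : Set (Loct T)) (hS : IsLocalPseudoStarGroup S) (hgen : generated S = H)
    (hcov : ∀ x, ∃ h ∈ S, x ∈ h.source)
    (Q : QuasiLocalMetricCover T) (hequi : EquicontinuousWith Q S)
    (hqa : StronglyQuasiAnalyticWith (starClosure S)) (x₀ : T) :
    ∃ (G : Type u) (_ : TopologicalSpace G) (L : LocalGroupOps G) (Γ : Set G),
      L.IsLocalGroup ∧ L.ActsByLeftTranslations ∧ LocallyCompactSpace G ∧ PolishSpace G ∧
      L.IsSubLocalGroup Γ ∧ Dense Γ ∧ L.IsFinitelyGenerated Γ ∧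
      AreEquivalent (hatH₀ S x₀) (L.translationPseudogroup Γ) := by
  -- An auxiliary global metric; it is compared with the metrics of `Q` only through the topology,
  -- on a compact ball.
  let _ := metrizableSpaceMetric T
  have hmem : ∀ h : Loct T, h ∈ H ↔ ∀ x ∈ h.source, ∃ e ∈ S, x ∈ e.source ∧ h =ᶠ[𝓝 x] e :=
    fun h => hgen ▸ mem_generated_iff hS.comp_mem hS.symm_mem hcov
  obtain ⟨R, hR, hRc, hRe⟩ := hequi.exists_closedBall x₀
  have hball : ∀ t ≤ R, IsCompact (closure (Metric.ball x₀ t)) := fun t ht =>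
    hRc.of_isClosed_subset isClosed_closure (Metric.closure_ball_subset_closedBall.trans
      (Metric.closedBall_subset_closedBall ht))
  obtain ⟨D, hD, hDS, hg⟩ := exists_generatesGerms_of_isCompactlyGenerated hmin hcg hS hgen hcov
    Metric.isOpen_ball (Metric.nonempty_ball.2 (half_pos hR)) (hball (R / 2) (by linarith))
  obtain ⟨ρ, hρ, hρR, hext⟩ := hg.exists_extension hS hcov hR hRc hRe hD hDS
  have hL : IsLocalModel S x₀ R ρ := ⟨hS, hqa, hRc, hRe, hρ, by linarith, hcov x₀, hext⟩
  obtain ⟨r, hM⟩ := hL.exists_isRigidModel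
  obtain ⟨r₁, hr₁⟩ := hL.exists_isScale hM.r_pos
  obtain ⟨r₂, hr₂⟩ := hL.exists_isScale hr₁.1
  obtain ⟨r₃, hr₃⟩ := hL.exists_isScale hr₂.1
  have hinto : ∀ x, ∃ s ∈ S, x ∈ s.source ∧ s x ∈ Metric.ball x₀ r₃ := by
    intro x
    obtain ⟨_, hy, h, hh, hxh, rfl⟩ := (hmin x).inter_open_nonempty _ Metric.isOpen_ball
      (Metric.nonempty_ball.2 hr₃.1)
    obtain ⟨s, hs, hxs, he⟩ := (hmem h).1 hh x hxh
    exact ⟨s, hs, hxs, he.eq_of_nhds ▸ hy⟩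
  -- Compact generation is used a second time: the first family of steps served to find ρ, on which
  -- the scale `r₃` depends, while generators of Γ must have chains that stay in the ball of radius
  -- `r₃`.
  obtain ⟨D', hD', hDS', hg'⟩ := exists_generatesGerms_of_isCompactlyGenerated hmin hcg hS hgen
    hcov Metric.isOpen_ball (Metric.nonempty_ball.2 hr₃.1) (hball r₃
      (by linarith [hr₁.1, hr₁.2.1, hr₂.1, hr₂.2.1, hr₃.2.1, hM.r_pos, hM.r_le]))
  obtain ⟨F, hF⟩ := hM.exists_isFrame hr₁ hr₂ hr₃ hinto hD' hDS' hg'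
  have hΩ := hF.isGauge
  exact ⟨hM.carrier (hM.gauge r₁ r₃ F), inferInstance, hM.ops hΩ, hM.gamma (hM.gauge r₁ r₃ F),
    hM.isLocalGroup hΩ, hM.actsByLeftTranslations hΩ, hM.locallyCompactSpace_carrier hΩ,
    hM.polishSpace_carrier hΩ, hM.isSubLocalGroup_gamma hΩ, hM.dense_gamma hΩ,
    hF.isFinitelyGenerated, hF.areEquivalent hcov hinto⟩
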